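/- Let $r\ge 0$ and let $F_r$ be the free group of rank $r$. A marked graph $(g,X)$ of rank $r$ is a finite connected graph $X$ (loops and multiple edges allowed) all of whose vertices are at least trivalent, with a homotopy equivalence $g$ from the $r$-petal rose to $X$; $(g,X)$ and $(g',X')$ are identified if there is a graph isomorphism $h\colon X\to X'$ with $h\circ g\simeq g'$. The simplicial closure $CX_r$ of Outer space has one closed simplex for each marked graph $(g,X)$, with vertex set the set of edges of $X$, where for each forest $\Phi\subset X$ the simplex of the marked graph $(g,X)/\Phi$ obtained by collapsing each tree of $\Phi$ to a point is identified with the face of the simplex of $(g,X)$ spanned by the edges outside $\Phi$. The subcomplex $A_r$ of simplices at infinity consists of the faces spanned by sets $S$ of edges of $X$ such that the complement of $S$ contains a cycle. $\mathrm{Out}(F_r)$ acts on $(CX_r,A_r)$ by changing the markings. Let $\tilde{\mathbb R}$ be $\mathbb R$ with $\alpha\in \mathrm{Out}(F_r)$ acting as multiplication by the determinant of the automorphism of $F_r^{ab}=\mathbb Z^r$ induced by $\alpha$, and let $H_p^{\mathrm{Out}(F_r)}(CX_r,A_r;\tilde{\mathbb R})=H_p(\mathrm{Out}(F_r);\,C_*(CX_r,A_r)\otimes\tilde{\mathbb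 R})$ be the equivariant homology, i.e. the homology of $\mathrm{Out}(F_r)$ with coefficients in the complex of relative simplicial chains tensored with $\tilde{\mathbb R}$. Let $X^{(r)}$ be the rank $r$ part of Kontsevich's commutative graph complex: $X^{(r)}_k$ is the real vector space spanned by the finite connected graphs with $k$ vertices, Euler characteristic $1-r$ and all vertices at least trivalent, each with an orientation (an ordering of the vertices and a direction of each edge, up to an even number of transpositions of vertices and reversals of edges), modulo isomorphism of oriented graphs and $(X,-or)=-(X,or)$. The boundary is $\partial_E(X)=\sum_e X_e$, where $X_e=0$ if $e$ is a loop, and otherwise $X_e$ is the graph with $e$ collapsed, oriented as follows: choose a representative of the orientation in which $e$ goes from the first to the second vertex; then the new vertex comes first, the other vertices retain their order and the other edges their directions. Then for every $p\ge 0$ there is an isomorphism of real vector spaces $$H_p^{\mathrm{Out}(F_r)}(CX_r,A_r;\tilde{\mathbb R})\;\cong\; H_{p+2-r}(X^{(r)}),$$ where the right-hand side is $0$ if $p+2-r<0$. -/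

import Mathlib

noncomputable section

open CategoryTheory

/-! ### Finite graphs -/

/-- A finite graph (multiple edges and loops allowed) with vertex set `Fin k` and edge set `Fin m`,
each edge being given with a direction.  The half-edges are the pairs `(e, s)` with `s = ±1`, and
`root e s` is the vertex at the half-edge `(e, s)`: the edge `e` runs from `root e (-1)` to
`root e 1`. -/
structure FinGraph (k m : ℕ) where
  root : Fin m → ℤˣ → Fin k

namespace FinGraph

variable {k m k' m' : ℕ}

/-- Two vertices are joined by a walk all of whose edges lie in `T`. -/
def Joined (X : FinGraph k m) (T : Set (Fin m)) : Fin k → Fin k → Prop :=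
  Relation.ReflTransGen fun a b => ∃ e ∈ T, ∃ s : ℤˣ, X.root e (-s) = a ∧ X.root e s = b

/-- A graph is connected if it is nonempty and any two vertices are joined by a walk. -/
def Connected (X : FinGraph k m) : Prop :=
  0 < k ∧ ∀ u v, X.Joined Set.univ u v

/-- The number of half-edges at a vertex (a loop counts twice). -/
def valence (X : FinGraph k m) (v : Fin k) : ℕ :=
  Nat.card {h : Fin m × ℤˣ // X.root h.1 h.2 = v}

/-- Connected graphs all of whose vertices are at least trivalent. -/
structure Admissible (X : FinGraph k m) : Prop where
  connected : X.Connected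
  valence : ∀ v, 3 ≤ X.valence v

/-- The subgraph with edge set `T` contains a cycle: it carries a nonzero 1-cycle. -/
def HasCycle (X : FinGraph k m) (T : Set (Fin m)) : Prop :=
  ∃ z : Fin m → ℝ, z ≠ 0 ∧ (∀ e ∉ T, z e = 0) ∧
    ∀ v, ∑ e, z e * ((if X.root e 1 = v then 1 else 0) - (if X.root e (-1) = v then 1 else 0)) = 0

/-- `X.IsPath u v x`: the element `x` of the free group on the edges is the class of an edge path
from `u` to `v`.  An edge path up to homotopy (rel endpoints) is the same as a reduced edge path,
so it is determined by `x`, `u` and `v`. -/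
inductive IsPath (X : FinGraph k m) (u : Fin k) : Fin k → FreeGroup (Fin m) → Prop
  | nil : IsPath X u u 1
  | step {x : FreeGroup (Fin m)} (e : Fin m) (s : ℤˣ) (h : IsPath X u (X.root e (-s)) x) :
      IsPath X u (X.root e s) (x * FreeGroup.of e ^ (s : ℤ))

theorem IsPath.trans {X : FinGraph k m} {u v w : Fin k} {x y : FreeGroup (Fin m)}
    (hx : X.IsPath u v x) (hy : X.IsPath v w y) : X.IsPath u w (x * y) := by
  induction hy with
  | nil => simpa using hx
  | step e s _ ih => rw [← mul_assoc]; exact ih.step e s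

theorem IsPath.symm {X : FinGraph k m} {u v : Fin k} {x : FreeGroup (Fin m)}
    (hx : X.IsPath u v x) : X.IsPath v u x⁻¹ := by
  induction hx with
  | nil => simpa using IsPath.nil
  | @step x e s _ ih =>
    have h : X.IsPath (X.root e s) (X.root e (-s)) (1 * FreeGroup.of e ^ ((-s : ℤˣ) : ℤ)) :=
      IsPath.step e (-s) (by rw [neg_neg]; exact IsPath.nil)
    have := h.trans ih
    simpa using this

/-- The fundamental group of `X` at `v`, as the group of reduced closed edge paths at `v`. -/
def fundamentalGroup (X : FinGraph k m) (v : Fin k) : Subgroup (FreeGroup (Fin m)) where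
  carrier := {x | X.IsPath v v x}
  mul_mem' := IsPath.trans
  one_mem' := IsPath.nil
  inv_mem' := IsPath.symm

/-- A map `X → Y` which collapses every tree of a forest of `X` to a point and is otherwise an
isomorphism.  The collapsed forest consists of the edges outside the range of `edge`;
the edge `edge f` of `X` is carried to the edge `f` of `Y`, with direction preserved or reversed
according to the sign `sgn f`. -/
structure ForestCollapse (X : FinGraph k m) (Y : FinGraph k' m') where
  onV : Fin k → Fin k'
  edge : Fin m' ↪ Fin m
  sgn : Fin m' → ℤˣ
  root_eq : ∀ f s, Y.root f (sgn f * s) = onV (X.root (edge f) s)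
  surjective : Function.Surjective onV
  fiber : ∀ u v, onV u = onV v ↔ X.Joined (Set.range edge)ᶜ u v
  forest : ¬ X.HasCycle (Set.range edge)ᶜ

/-- The effect of a forest collapse on edge paths. -/
def ForestCollapse.map {X : FinGraph k m} {Y : FinGraph k' m'} (c : ForestCollapse X Y) :
    FreeGroup (Fin m) →* FreeGroup (Fin m') :=
  FreeGroup.lift (Function.extend c.edge (fun f => FreeGroup.of f ^ (c.sgn f : ℤ)) 1)

/-- The identity, as the collapse of the empty forest. -/
def ForestCollapse.refl (X : FinGraph k m) : ForestCollapse X X where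
  onV := id
  edge := Function.Embedding.refl _
  sgn := 1
  root_eq := by simp
  surjective := Function.surjective_id
  fiber u v := by
    constructor
    · rintro rfl; exact Relation.ReflTransGen.refl
    · intro h
      induction h with
      | refl => rfl
      | tail _ h _ => obtain ⟨e, he, _⟩ := h; simp at he
  forest := by
    rintro ⟨z, hz, hz', -⟩
    exact hz (funext fun e => hz' e (by simp))

theorem ForestCollapse.refl_map (X : FinGraph k m) (x : FreeGroup (Fin m)) :
    (ForestCollapse.refl X).map x = x := by
  have : (ForestCollapse.refl X).map = MonoidHom.id _ := by
    ext e
    have h := Function.Injective.extend_apply (ForestCollapse.refl X).edge.injective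
      (fun f => FreeGroup.of f ^ (((ForestCollapse.refl X).sgn f : ℤˣ) : ℤ)) 1 e
    simp only [ForestCollapse.map, FreeGroup.lift_apply_of, MonoidHom.id_apply]
    exact h.trans (by simp [ForestCollapse.refl])
  rw [this]; rfl

end FinGraph

/-! ### The outer automorphism group of a free group -/

/-- The inner automorphisms of the free group of rank `r`. -/
def Inn (r : ℕ) : Subgroup (MulAut (FreeGroup (Fin r))) := MulAut.conj.range

instance (r : ℕ) : (Inn r).Normal := by
  constructor
  rintro _ ⟨w, rfl⟩ α
  refine ⟨α w, ?_⟩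
  ext x
  simp [MulAut.mul_apply, MulAut.conj_apply]

/-- `Out(F_r)`. -/
abbrev Out (r : ℕ) : Type := MulAut (FreeGroup (Fin r)) ⧸ Inn r

/-- The abelianization of the free group of rank `r`, a free `ℤ`-module of rank `r`. -/
abbrev FreeAb (r : ℕ) : Type := Additive (Abelianization (FreeGroup (Fin r)))

/-- The action of `Aut(F_r)` on the abelianization `ℤ^r`. -/
def abAction (r : ℕ) : MulAut (FreeGroup (Fin r)) →* Module.End ℤ (FreeAb r) where
  toFun α := (MonoidHom.toAdditive (Abelianization.map α.toMonoidHom)).toIntLinearMap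
  map_one' := by
    refine LinearMap.ext fun x => ?_
    induction x using Additive.rec with
    | _ x => induction x using QuotientGroup.induction_on with
      | H x => rfl
  map_mul' α β := by
    refine LinearMap.ext fun x => ?_
    induction x using Additive.rec with
    | _ x => induction x using QuotientGroup.induction_on with
      | H x => rfl

theorem abAction_inn (r : ℕ) : Inn r ≤ (abAction r).ker := by
  rintro _ ⟨w, rfl⟩
  refine LinearMap.ext fun x => ?_
  induction x using Additive.rec with
  | _ x => induction x using QuotientGroup.induction_on with
    | H x =>
      change Additive.ofMul (Abelianization.of (w * x * w⁻¹)) = Additive.ofMul (Abelianization.of x)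
      simp

/-- The homomorphism `Out(F_r) → GL(r, ℤ) → {±1} ⊆ ℤ`, `α ↦ det ᾱ`. -/
def outDet (r : ℕ) : Out r →* ℤ :=
  LinearMap.det.comp (QuotientGroup.lift (Inn r) (abAction r) (abAction_inn r))

/-- The representation `ℝ̃`: the reals, with `α` acting as multiplication by `det ᾱ`. -/
def detRep (r : ℕ) : Representation ℝ (Out r) ℝ :=
  (Algebra.lsmul ℝ ℝ ℝ).toMonoidHom.comp ((Int.castRingHom ℝ).toMonoidHom.comp (outDet r))

/-! ### The simplicial closure of Outer space -/

/-- A marked graph `(g, X)` of rank `r` with a list `e_0, …, e_p` of distinct edges.  The marking,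
a homotopy equivalence from the rose to `X`, is given by a base vertex `v` and an
isomorphism `F_r ≅ π₁(X, v)`. -/
structure MarkedSimplex (r p : ℕ) where
  (k m : ℕ)
  graph : FinGraph k m
  admissible : graph.Admissible
  base : Fin k
  marking : FreeGroup (Fin r) ≃* graph.fundamentalGroup base
  edges : Fin (p + 1) ↪ Fin m

namespace MarkedSimplex

variable {r p : ℕ}

/-- `(g, X, e_0, …, e_p)` and `(g', Y, f_0, …, f_p)` are related if there is a forest collapse
`c : X → Y` which does not collapse any of the `e_i`, carries `e_i` to `f_i`, and satisfies
`c ∘ g ≃ g'` (free homotopy: the track `γ` of the base point is arbitrary).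
An isomorphism is the case of the empty forest. -/
def Rel (a b : MarkedSimplex r p) : Prop :=
  ∃ c : FinGraph.ForestCollapse a.graph b.graph,
    (∀ i, a.edges i = c.edge (b.edges i)) ∧
    ∃ γ, b.graph.IsPath (c.onV a.base) b.base γ ∧
      ∀ x, (b.marking x : FreeGroup (Fin b.m)) = γ⁻¹ * c.map (a.marking x) * γ

/-- Reordering, or passing to a face: `(g, X, e_0, …, e_p) ↦ (g, X, e_{f 0}, …, e_{f q})`. -/
def reindex {q : ℕ} (f : Fin (q + 1) ↪ Fin (p + 1)) (a : MarkedSimplex r p) :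
    MarkedSimplex r q :=
  { a with edges := f.trans a.edges }

/-- `Aut(F_r)` acts by changing the marking: `α • (g, X, e) = (g ∘ α⁻¹, X, e)`. -/
def act (α : MulAut (FreeGroup (Fin r))) (a : MarkedSimplex r p) : MarkedSimplex r p :=
  { a with marking := MulEquiv.trans (MulEquiv.symm α) a.marking }

/-- The edges other than `e_0, …, e_p`, which have length `0`, contain a cycle. -/
def AtInfinity (a : MarkedSimplex r p) : Prop :=
  a.graph.HasCycle (Set.range a.edges)ᶜ

end MarkedSimplex

/-- The `p`-simplices of the simplicial closure `CX_r` with an ordering of their vertices.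
`CX_r` is glued from one closed simplex for each marked graph `(g, X)`, with vertices the
edges of `X`: the closed simplex of `(g, X)/Φ`, for a forest `Φ`, is identified with
the face of the simplex of `(g, X)` spanned by the edges outside `Φ`.
So `[(g, X, e_0, …, e_p)]` is the face spanned by `e_0, …, e_p` of the simplex of `(g, X)`. -/
def OrderedSimplex (r p : ℕ) : Type := Quot (MarkedSimplex.Rel (r := r) (p := p))

namespace OrderedSimplex

variable {r p q : ℕ}

def reindex (f : Fin (q + 1) ↪ Fin (p + 1)) : OrderedSimplex r p → OrderedSimplex r q :=
  Quot.map (MarkedSimplex.reindex f) (by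
    rintro a b ⟨c, h, γ, hγ, hm⟩
    exact ⟨c, fun i => h (f i), γ, hγ, hm⟩)

/-- The `i`-th face. -/
def face (i : Fin (p + 2)) : OrderedSimplex r (p + 1) → OrderedSimplex r p :=
  reindex i.succAboveEmb

/-- Change of the ordering of the vertices. -/
def permute (σ : Equiv.Perm (Fin (p + 1))) : OrderedSimplex r p → OrderedSimplex r p :=
  reindex σ.toEmbedding

instance : MulAction (MulAut (FreeGroup (Fin r))) (OrderedSimplex r p) where
  smul α := Quot.map (MarkedSimplex.act α) (by
    rintro a b ⟨c, h, γ, hγ, hm⟩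
    exact ⟨c, h, γ, hγ, fun x => hm _⟩)
  one_smul := by rintro ⟨a⟩; rfl
  mul_smul := by rintro α β ⟨a⟩; rfl

theorem inn_smul (w : FreeGroup (Fin r)) (s : OrderedSimplex r p) : MulAut.conj w • s = s := by
  obtain ⟨a⟩ := s
  refine Quot.sound ⟨FinGraph.ForestCollapse.refl a.graph, fun i => rfl,
    (a.marking w)⁻¹, ?_, fun x => ?_⟩
  · exact (a.graph.fundamentalGroup a.base).inv_mem (a.marking w).2
  · change (a.marking x : FreeGroup (Fin a.m)) = ((a.marking w : FreeGroup (Fin a.m))⁻¹)⁻¹ *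
      (FinGraph.ForestCollapse.refl a.graph).map (a.marking ((MulAut.conj w).symm x)) *
        (a.marking w : FreeGroup (Fin a.m))⁻¹
    rw [FinGraph.ForestCollapse.refl_map]
    simp [MulAut.conj_symm_apply, mul_assoc]

/-- The action of `Out(F_r)`. -/
instance : MulAction (Out r) (OrderedSimplex r p) :=
  MulAction.compHom (OrderedSimplex r p)
    (QuotientGroup.lift (Inn r)
      (MulAction.toPermHom (MulAut (FreeGroup (Fin r))) (OrderedSimplex r p)) (by
        rintro _ ⟨w, rfl⟩
        exact Equiv.ext fun s => inn_smul w s))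

theorem mk_smul (α : MulAut (FreeGroup (Fin r))) (s : OrderedSimplex r p) :
    (QuotientGroup.mk α : Out r) • s = α • s := rfl

theorem smul_reindex (g : Out r) (f : Fin (q + 1) ↪ Fin (p + 1)) (s : OrderedSimplex r p) :
    reindex f (g • s) = g • reindex f s := by
  obtain ⟨α, rfl⟩ := QuotientGroup.mk_surjective g
  obtain ⟨a⟩ := s
  rfl

theorem reindex_reindex {q' : ℕ} (f : Fin (q + 1) ↪ Fin (p + 1)) (f' : Fin (q' + 1) ↪ Fin (q + 1))
    (s : OrderedSimplex r p) : reindex f' (reindex f s) = reindex (f'.trans f) s := by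
  obtain ⟨a⟩ := s
  rfl

/-- The simplices of `A_r`, the added simplices at infinity. -/
def infinity (r p : ℕ) : Set (OrderedSimplex r p) :=
  {s | ∃ a : MarkedSimplex r p, a.AtInfinity ∧ Quot.mk _ a = s}

theorem reindex_infinity (f : Fin (q + 1) ↪ Fin (p + 1)) {s : OrderedSimplex r p}
    (hs : s ∈ infinity r p) : reindex f s ∈ infinity r q := by
  obtain ⟨a, ⟨z, h, h', h''⟩, rfl⟩ := hs
  refine ⟨a.reindex f, ⟨z, h, fun e he => h' e fun hc => he fun hr => hc ?_, h''⟩, rfl⟩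
  obtain ⟨i, rfl⟩ := hr
  exact ⟨f i, rfl⟩

theorem smul_infinity (g : Out r) {s : OrderedSimplex r p}
    (hs : s ∈ infinity r p) : g • s ∈ infinity r p := by
  obtain ⟨α, rfl⟩ := QuotientGroup.mk_surjective g
  obtain ⟨a, h, rfl⟩ := hs
  exact ⟨a.act α, h, rfl⟩

end OrderedSimplex

/-! ### Relative simplicial chains -/

namespace SimplicialChains

open OrderedSimplex

variable (r p : ℕ)

/-- The relations `(v_{σ 0}, …, v_{σ p}) = sign(σ) (v_0, …, v_p)`. -/
def altRel : Submodule ℝ (OrderedSimplex r p →₀ ℝ) :=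
  Submodule.span ℝ {x | ∃ (σ : Equiv.Perm (Fin (p + 1))) (s : OrderedSimplex r p),
    x = Finsupp.single (permute σ s) 1 - ((σ.sign : ℤ) : ℝ) • Finsupp.single s 1}

/-- `C_p(CX_r)`: the oriented simplicial chains, with real coefficients. -/
abbrev Chains : Type := (OrderedSimplex r p →₀ ℝ) ⧸ altRel r p

/-- `C_p(A_r)`, as a subspace of `C_p(CX_r)`. -/
def infinityChains : Submodule ℝ (Chains r p) :=
  Submodule.span ℝ ((fun s => (altRel r p).mkQ (Finsupp.single s 1)) '' infinity r p)

/-- `C_p(CX_r, A_r) = C_p(CX_r) / C_p(A_r)`. -/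
abbrev RelChains : Type := Chains r p ⧸ infinityChains r p

variable {r p}

/-- The class in `C_p(CX_r, A_r)` of an ordered simplex. -/
def cls (s : OrderedSimplex r p) : RelChains r p :=
  (infinityChains r p).mkQ ((altRel r p).mkQ (Finsupp.single s 1))

theorem cls_permute (σ : Equiv.Perm (Fin (p + 1))) (s : OrderedSimplex r p) :
    cls (permute σ s) = ((σ.sign : ℤ) : ℝ) • cls s := by
  rw [cls, cls, ← map_smul, ← map_smul]
  congr 1
  refine (Submodule.Quotient.eq _).2 (Submodule.subset_span ⟨σ, s, rfl⟩)

theorem cls_infinity {s : OrderedSimplex r p} (hs : s ∈ infinity r p) : cls s = 0 :=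
  (Submodule.Quotient.mk_eq_zero _).2 (Submodule.subset_span ⟨s, hs, rfl⟩)

/-- A map on ordered simplices which is compatible with the relations extends linearly. -/
def liftRel {M : Type*} [AddCommGroup M] [Module ℝ M] (F : OrderedSimplex r p → M)
    (h : ∀ σ s, F (permute σ s) = ((σ.sign : ℤ) : ℝ) • F s)
    (h' : ∀ s ∈ infinity r p, F s = 0) : RelChains r p →ₗ[ℝ] M :=
  (infinityChains r p).liftQ
    ((altRel r p).liftQ (Finsupp.linearCombination ℝ F) (by
      rw [altRel, Submodule.span_le]
      rintro _ ⟨σ, s, rfl⟩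
      simp [h])) (by
    rw [infinityChains, Submodule.span_le]
    rintro _ ⟨s, hs, rfl⟩
    simp [h' s hs])

@[simp] theorem liftRel_cls {M : Type*} [AddCommGroup M] [Module ℝ M] (F : OrderedSimplex r p → M)
    (h) (h') (s : OrderedSimplex r p) : liftRel F h h' (cls s) = F s := by
  simp [liftRel, cls]

theorem hom_ext {M : Type*} [AddCommGroup M] [Module ℝ M] {f g : RelChains r p →ₗ[ℝ] M}
    (h : ∀ s, f (cls s) = g (cls s)) : f = g := by
  refine Submodule.linearMap_qext _ (Submodule.linearMap_qext _ (Finsupp.lhom_ext' fun s => ?_))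
  exact LinearMap.ext_ring (h s)

/-- The action of `Out(F_r)` on `C_p(CX_r, A_r)`. -/
def rep (r p : ℕ) : Representation ℝ (Out r) (RelChains r p) where
  toFun g := liftRel (fun s => cls (g • s))
    (fun σ s => by rw [permute, ← smul_reindex, ← permute, cls_permute])
    (fun s hs => cls_infinity (smul_infinity g hs))
  map_one' := hom_ext fun s => by simp
  map_mul' g h := hom_ext fun s => by simp [mul_smul]

end SimplicialChains

/-! ### Signs -/

/-- A permutation of `Fin (n + 1)` fixing `0` restricts to a permutation of the same sign. -/
theorem exists_restrict_perm {n : ℕ} (ρ : Equiv.Perm (Fin (n + 1))) (h : ρ 0 = 0) :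
    ∃ τ : Equiv.Perm (Fin n), (∀ j, ρ j.succ = (τ j).succ) ∧ τ.sign = ρ.sign := by
  obtain ⟨⟨q, τ⟩, rfl⟩ := Equiv.Perm.decomposeFin.symm.surjective ρ
  have hq : q = 0 := by simpa using h
  subst hq
  exact ⟨τ, fun j => by simp, by simp⟩

theorem exists_perm_succAbove {n : ℕ} (σ : Equiv.Perm (Fin (n + 1))) (i : Fin (n + 1)) :
    ∃ τ : Equiv.Perm (Fin n), (∀ j, σ (i.succAbove j) = (σ i).succAbove (τ j)) ∧
      τ.sign = σ.sign * ((-1) ^ (i : ℕ) * (-1) ^ (σ i : ℕ)) := by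
  obtain ⟨τ, h, hs⟩ := exists_restrict_perm ((σ i).cycleRange * σ * i.cycleRange⁻¹)
    (by simp [Equiv.Perm.inv_def])
  refine ⟨τ, fun j => ?_, ?_⟩
  · have := h j
    rw [Equiv.Perm.mul_apply, Equiv.Perm.mul_apply, Equiv.Perm.inv_def,
      Fin.cycleRange_symm_succ] at this
    rw [← Fin.cycleRange_symm_succ (σ i), ← this, Equiv.symm_apply_apply]
  · rw [hs]; simp only [map_mul, Equiv.Perm.sign_inv, Fin.sign_cycleRange]; ac_rfl

namespace SimplicialChains

open OrderedSimplex

variable {r p : ℕ}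

/-- The simplicial boundary `(v_0, …, v_p) ↦ ∑ (-1)^i (v_0, …, v̂_i, …, v_p)`. -/
def boundary (r p : ℕ) : RelChains r (p + 1) →ₗ[ℝ] RelChains r p :=
  liftRel (fun s => ∑ i : Fin (p + 2), (-1 : ℝ) ^ (i : ℕ) • cls (face i s))
    (fun σ s => by
      rw [Finset.smul_sum, ← Equiv.sum_comp σ (fun i => ((σ.sign : ℤ) : ℝ) • _)]
      refine Finset.sum_congr rfl fun i _ => ?_
      obtain ⟨τ, h, hs⟩ := exists_perm_succAbove σ i
      have : face i (permute σ s) = permute τ (face (σ i) s) := by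
        simp only [face, permute, reindex_reindex]
        congr 1
        ext j : 1
        exact h j
      rw [this, cls_permute, hs, smul_smul, smul_smul]
      congr 1
      push_cast
      have h1 : ((-1 : ℝ) ^ (i : ℕ)) * (-1) ^ (i : ℕ) = 1 := by rw [← mul_pow]; simp
      linear_combination ((σ.sign : ℤ) : ℝ) * (-1) ^ (σ i : ℕ) * h1)
    (fun s hs => Finset.sum_eq_zero fun i _ => by
      rw [face, cls_infinity (reindex_infinity _ hs), smul_zero])

theorem boundary_cls (s : OrderedSimplex r (p + 1)) :
    boundary r p (cls s) = ∑ i : Fin (p + 2), (-1 : ℝ) ^ (i : ℕ) • cls (face i s) :=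
  liftRel_cls _ _ _ _

theorem boundary_boundary (r p : ℕ) : boundary r p ∘ₗ boundary r (p + 1) = 0 := by
  refine hom_ext fun s => ?_
  simp only [LinearMap.comp_apply, boundary_cls, map_sum, map_smul, Finset.smul_sum, smul_smul,
    LinearMap.zero_apply]
  rw [← Finset.sum_product']
  refine Finset.sum_involution (fun ij _ => (ij.1.succAbove ij.2, ij.2.predAbove ij.1)) ?_ ?_ ?_ ?_
  · rintro ⟨i, j⟩ -
    have : face ((j.predAbove i)) (face (i.succAbove j) s) = face j (face i s) := by
      simp only [face, reindex_reindex]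
      congr 1
      ext l : 1
      exact Fin.succAbove_succAbove_succAbove_predAbove i j l
    simp only [this]
    rw [← pow_add, ← pow_add, Fin.neg_one_pow_succAbove_add_predAbove, neg_smul, add_neg_cancel]
  · rintro ⟨i, j⟩ - - h
    exact Fin.succAbove_ne i j (congrArg Prod.fst h)
  · simp
  · rintro ⟨i, j⟩ -
    simp [Fin.succAbove_succAbove_predAbove, Fin.predAbove_predAbove_succAbove]

/-- The boundary commutes with the action. -/
def boundaryHom (r p : ℕ) : (rep r (p + 1)).IntertwiningMap (rep r p) where
  toLinearMap := boundary r p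
  isIntertwining' g := hom_ext fun s => by
    simp [rep, boundary_cls, face, smul_reindex]

end SimplicialChains

/-- The chain complex `C_*(CX_r, A_r) ⊗ ℝ̃` of real representations of `Out(F_r)`, with the
diagonal action. -/
def twistedChainComplex (r : ℕ) : ChainComplex (Rep.{0} ℝ (Out r)) ℕ :=
  ChainComplex.of (fun p => Rep.of ((SimplicialChains.rep r p).tprod (detRep r)))
    (fun p => Rep.ofHom ((SimplicialChains.boundaryHom r p).rTensor (detRep r)))
    (fun p => by
      rw [← Rep.ofHom_comp]
      have h : ((SimplicialChains.boundaryHom r p).rTensor (detRep r)).comp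
          ((SimplicialChains.boundaryHom r (p + 1)).rTensor (detRep r)) = 0 := by
        refine Representation.IntertwiningMap.ext ?_
        change (SimplicialChains.boundary r p).rTensor ℝ ∘ₗ
          (SimplicialChains.boundary r (p + 1)).rTensor ℝ = 0
        rw [← LinearMap.rTensor_comp, SimplicialChains.boundary_boundary, LinearMap.rTensor_zero]
      rw [h]
      rfl)

/-- The homology `H_n(G; C)` of a group `G` with coefficients in a chain complex `C` of
representations: the homology of the total complex of the double complex of the bar chains of `G`
with coefficients in the terms of `C`. -/
def hyperHomology {G : Type} [Group G] (C : ChainComplex (Rep.{0} ℝ G) ℕ) (n : ℕ) :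
    ModuleCat.{0} ℝ :=
  (HomologicalComplex₂.total
    (((groupHomology.chainsFunctor ℝ G).mapHomologicalComplex (ComplexShape.down ℕ)).obj C)
    (ComplexShape.down ℕ)).homology n

/-- The equivariant homology `H_p^{Out(F_r)}(CX_r, A_r; ℝ̃) = H_p(Out(F_r); C_*(CX_r, A_r) ⊗ ℝ̃)`. -/
def equivariantHomology (r p : ℕ) : ModuleCat.{0} ℝ :=
  hyperHomology (twistedChainComplex r) p

/-! ### The graph complex -/

namespace FinGraph

variable {k m : ℕ}

/-- An isomorphism of graphs; the edge `e` is carried to `onE e`, with direction preserved or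
reversed according to the sign `sgn e`. -/
structure Iso (X Y : FinGraph k m) where
  onV : Equiv.Perm (Fin k)
  onE : Equiv.Perm (Fin m)
  sgn : Fin m → ℤˣ
  root_eq : ∀ e s, Y.root (onE e) (sgn e * s) = onV (X.root e s)

/-- The orientation of a graph is given by the ordering of its vertices and the direction
of its edges.  This is the effect of an isomorphism on the orientations. -/
def Iso.orientation {X Y : FinGraph k m} (h : Iso X Y) : ℤˣ :=
  h.onV.sign * ∏ e, h.sgn e

/-- `π` moves the endpoints `root e (-t)` and `root e t` of `e` to the first and second place. -/
def Normalizes (X : FinGraph (k + 2) m) (e : Fin m) (t : ℤˣ) (π : Equiv.Perm (Fin (k + 2))) :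
    Prop :=
  π (X.root e (-t)) = 0 ∧ π (X.root e t) = 1

/-- An edge is a loop if its endpoints agree. -/
def IsLoop (X : FinGraph k m) (e : Fin m) : Prop := X.root e (-1) = X.root e 1

/-- A permutation moving the initial vertex of `e` to the first place and the
terminal vertex (if different) to the second place. -/
def normalizer (X : FinGraph (k + 2) m) (e : Fin m) : Equiv.Perm (Fin (k + 2)) :=
  Equiv.swap (Equiv.swap (X.root e (-1)) 0 (X.root e 1)) 1 * Equiv.swap (X.root e (-1)) 0

/-- Renumber the vertices by `π`, remove the edge `e` and identify the first two vertices.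
The new vertex is the first one, and the others retain their order. -/
def contract (X : FinGraph (k + 2) (m + 1)) (e : Fin (m + 1)) (π : Equiv.Perm (Fin (k + 2))) :
    FinGraph (k + 1) m where
  root f s := Fin.predAbove 0 (π (X.root (e.succAbove f) s))

theorem normalizes_normalizer {X : FinGraph (k + 2) m} {e : Fin m} (he : ¬ X.IsLoop e) :
    X.Normalizes e 1 (X.normalizer e) := by
  have h1 : Equiv.swap (X.root e (-1)) 0 (X.root e 1) ≠ 0 := by
    intro h
    rw [Equiv.swap_apply_eq_iff, Equiv.swap_apply_right] at h
    exact he h.symm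
  constructor
  · rw [normalizer, Equiv.Perm.mul_apply, Equiv.swap_apply_left,
      Equiv.swap_apply_of_ne_of_ne h1.symm Fin.zero_ne_one]
  · rw [normalizer, Equiv.Perm.mul_apply, Equiv.swap_apply_left]

theorem isLoop_iff {X : FinGraph k m} {e : Fin m} (t : ℤˣ) :
    X.IsLoop e ↔ X.root e (-t) = X.root e t := by
  rcases Int.units_eq_one_or t with rfl | rfl
  · rfl
  · rw [neg_neg]; exact eq_comm

theorem Normalizes.not_isLoop {X : FinGraph (k + 2) m} {e : Fin m} {t : ℤˣ}
    {π : Equiv.Perm (Fin (k + 2))} (h : X.Normalizes e t π) : ¬ X.IsLoop e := by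
  rw [isLoop_iff t]
  intro h'
  have := h.1
  rw [h', h.2] at this
  exact Fin.zero_ne_one this.symm

theorem predAbove_zero_eq_iff {u v : Fin (k + 2)} :
    Fin.predAbove (0 : Fin (k + 1)) u = Fin.predAbove 0 v ↔
      u = v ∨ (u = 0 ∧ v = 1) ∨ (u = 1 ∧ v = 0) := by
  refine Fin.cases ?_ (fun i => ?_) u <;> refine Fin.cases ?_ (fun j => ?_) v
  · simp
  · have h : (j.succ = 1) ↔ j = 0 := by
      rw [← Fin.succ_zero_eq_one, Fin.succ_inj]
    simp [h, (Fin.succ_ne_zero j).symm, eq_comm]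
  · have h : (i.succ = 1) ↔ i = 0 := by
      rw [← Fin.succ_zero_eq_one, Fin.succ_inj]
    simp [h, Fin.succ_ne_zero]
  · simp [Fin.succ_ne_zero]

theorem Admissible.contract {X : FinGraph (k + 2) (m + 1)} (hX : X.Admissible) {e : Fin (m + 1)}
    {t : ℤˣ} {π : Equiv.Perm (Fin (k + 2))} (h : X.Normalizes e t π) :
    (X.contract e π).Admissible := by
  classical
  have surj : Function.Surjective fun u => Fin.predAbove (0 : Fin (k + 1)) (π u) := by
    intro v
    exact ⟨π.symm v.succ, by simp⟩
  have card : ∀ {n l : ℕ} (Z : FinGraph n l) (v : Fin n), Z.valence v =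
      (Finset.univ.filter fun h : Fin l × ℤˣ => Z.root h.1 h.2 = v).card := by
    intro n l Z v
    rw [FinGraph.valence, Nat.card_eq_fintype_card, Fintype.card_subtype]
  refine ⟨⟨Nat.succ_pos _, ?_⟩, ?_⟩
  · intro u v
    obtain ⟨u, rfl⟩ := surj u
    obtain ⟨v, rfl⟩ := surj v
    induction hX.connected.2 u v with
    | refl => exact Relation.ReflTransGen.refl
    | @tail b c _ hbc ih =>
      obtain ⟨f, -, s, rfl, rfl⟩ := hbc
      by_cases hf : f = e
      · subst hf
        have : Fin.predAbove (0 : Fin (k + 1)) (π (X.root f (-s))) =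
            Fin.predAbove 0 (π (X.root f s)) := by
          rw [predAbove_zero_eq_iff]
          rcases Int.units_eq_one_or s with rfl | rfl <;>
            rcases Int.units_eq_one_or t with rfl | rfl <;>
            simp_all [Normalizes]
        simpa only [this] using ih
      · obtain ⟨g, rfl⟩ := Fin.exists_succAbove_eq hf
        exact ih.tail ⟨g, trivial, s, rfl, rfl⟩
  · intro v
    obtain ⟨u, hu⟩ := surj v
    -- the half-edges at the vertices over `v`, with the half-edges of `e` removed
    have key : (X.contract e π).valence v = ((Finset.univ.filter fun h : Fin (m + 1) × ℤˣ =>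
        Fin.predAbove 0 (π (X.root h.1 h.2)) = v).filter fun h => h.1 ≠ e).card := by
      rw [card]
      refine Finset.card_bij (fun h _ => (e.succAbove h.1, h.2)) ?_ ?_ ?_
      · rintro ⟨f, s⟩ hf
        have hf' := (Finset.mem_filter.1 hf).2
        exact Finset.mem_filter.2 ⟨Finset.mem_filter.2 ⟨Finset.mem_univ _, hf'⟩,
          Fin.succAbove_ne _ _⟩
      · rintro ⟨f, s⟩ - ⟨f', s'⟩ - h
        simpa using h
      · rintro ⟨f, s⟩ hf
        simp only [Finset.mem_filter, Finset.mem_univ, true_and] at hf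
        obtain ⟨g, rfl⟩ := Fin.exists_succAbove_eq hf.2
        exact ⟨(g, s), Finset.mem_filter.2 ⟨Finset.mem_univ _, hf.1⟩, rfl⟩
    rw [key]
    by_cases hv : v = 0
    · subst hv
      have hdis : Disjoint
          (Finset.univ.filter fun h : Fin (m + 1) × ℤˣ => X.root h.1 h.2 = X.root e (-t))
          (Finset.univ.filter fun h : Fin (m + 1) × ℤˣ => X.root h.1 h.2 = X.root e t) := by
        rw [Finset.disjoint_filter]
        intro x _ h1 h2
        exact h.not_isLoop ((isLoop_iff t).2 (h1.symm.trans h2))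
      have hsub : (Finset.univ.filter fun h : Fin (m + 1) × ℤˣ => X.root h.1 h.2 = X.root e (-t)) ∪
          (Finset.univ.filter fun h : Fin (m + 1) × ℤˣ => X.root h.1 h.2 = X.root e t) ⊆
          ((Finset.univ.filter fun h : Fin (m + 1) × ℤˣ =>
            Fin.predAbove (0 : Fin (k + 1)) (π (X.root h.1 h.2)) = 0).filter fun h => h.1 ≠ e) ∪
          {(e, 1), (e, -1)} := by
        rintro ⟨f, s⟩ hf
        by_cases hfe : f = e
        · subst hfe
          rcases Int.units_eq_one_or s with rfl | rfl <;> simp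
        · simp only [Finset.mem_union, Finset.mem_filter, Finset.mem_univ, true_and] at hf ⊢
          left
          refine ⟨?_, hfe⟩
          rcases hf with hf | hf
          · rw [hf, h.1]; simp
          · rw [hf, h.2, ← Fin.succ_zero_eq_one, Fin.predAbove_zero_succ]
      have h1 := Finset.card_le_card hsub
      rw [Finset.card_union_of_disjoint hdis, ← card, ← card] at h1
      have h2 := Finset.card_union_le ((Finset.univ.filter fun h : Fin (m + 1) × ℤˣ =>
            Fin.predAbove (0 : Fin (k + 1)) (π (X.root h.1 h.2)) = 0).filter fun h => h.1 ≠ e)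
          {(e, 1), (e, -1)}
      have h3 : ({(e, 1), (e, -1)} : Finset (Fin (m + 1) × ℤˣ)).card ≤ 2 := Finset.card_le_two
      have h4 := hX.valence (X.root e (-t))
      have h5 := hX.valence (X.root e t)
      omega
    · refine (hX.valence u).trans ?_
      rw [card]
      refine Finset.card_le_card ?_
      rintro ⟨f, s⟩ hf
      simp only [Finset.mem_filter, Finset.mem_univ, true_and] at hf ⊢
      refine ⟨by rw [hf]; exact hu, ?_⟩
      rintro rfl
      apply hv
      rw [← hu, ← hf]
      have hs : s = t ∨ s = -t := by
        rcases Int.units_eq_one_or s with rfl | rfl <;>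
          rcases Int.units_eq_one_or t with rfl | rfl <;> simp
      rcases hs with rfl | rfl
      · change Fin.predAbove 0 (π (X.root f s)) = 0
        rw [h.2, ← Fin.succ_zero_eq_one, Fin.predAbove_zero_succ]
      · change Fin.predAbove 0 (π (X.root f (-t))) = 0
        rw [h.1]; simp

end FinGraph

namespace GraphComplex

variable {k m : ℕ}

/-- The connected oriented graphs with `k` vertices and `m` edges and all vertices at
least trivalent. -/
abbrev OGraph (k m : ℕ) : Type := {X : FinGraph k m // X.Admissible}

/-- Isomorphic oriented graphs are equal, and `(X, -or) = -(X, or)`. -/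
def orRel (k m : ℕ) : Submodule ℝ (OGraph k m →₀ ℝ) :=
  Submodule.span ℝ {x | ∃ (X Y : OGraph k m) (h : FinGraph.Iso X.1 Y.1),
    x = Finsupp.single X 1 - ((h.orientation : ℤ) : ℝ) • Finsupp.single Y 1}

/-- The space spanned by the oriented graphs with `k` vertices and `m` edges. -/
abbrev GChains (k m : ℕ) : Type := (OGraph k m →₀ ℝ) ⧸ orRel k m

/-- The class of an oriented graph. -/
def cls (X : FinGraph k m) (hX : X.Admissible) : GChains k m :=
  (orRel k m).mkQ (Finsupp.single ⟨X, hX⟩ 1)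

theorem cls_iso {X Y : FinGraph k m} (hX : X.Admissible) (hY : Y.Admissible)
    (h : FinGraph.Iso X Y) : cls X hX = ((h.orientation : ℤ) : ℝ) • cls Y hY := by
  rw [cls, cls, ← map_smul]
  exact (Submodule.Quotient.eq _).2 (Submodule.subset_span ⟨⟨X, hX⟩, ⟨Y, hY⟩, h, rfl⟩)

/-- A permutation preserving `{0, 1}` induces a permutation after identification of `0` and `1`. -/
theorem exists_perm_predAbove (ρ : Equiv.Perm (Fin (k + 2))) (t : ℤˣ)
    (h : (t = 1 ∧ ρ 0 = 0 ∧ ρ 1 = 1) ∨ (t = -1 ∧ ρ 0 = 1 ∧ ρ 1 = 0)) :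
    ∃ ν : Equiv.Perm (Fin (k + 1)),
      (∀ u, Fin.predAbove 0 (ρ u) = ν (Fin.predAbove 0 u)) ∧ ν.sign = ρ.sign * t := by
  have main : ∀ ρ : Equiv.Perm (Fin (k + 2)), ρ 0 = 0 → ρ 1 = 1 →
      ∃ ν : Equiv.Perm (Fin (k + 1)),
      (∀ u, Fin.predAbove 0 (ρ u) = ν (Fin.predAbove 0 u)) ∧ ν.sign = ρ.sign := by
    intro ρ h0 h1
    obtain ⟨ν, h, hs⟩ := exists_restrict_perm ρ h0
    have hν : ν 0 = 0 := by
      have := h 0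
      rw [Fin.succ_zero_eq_one, h1, ← Fin.succ_zero_eq_one] at this
      exact (Fin.succ_injective _ this).symm
    refine ⟨ν, fun u => ?_, hs⟩
    refine Fin.cases ?_ (fun j => ?_) u
    · rw [h0]; simp [hν]
    · rw [h]; simp
  rcases h with ⟨rfl, h0, h1⟩ | ⟨rfl, h0, h1⟩
  · simpa using main ρ h0 h1
  · obtain ⟨ν, h, hs⟩ := main (Equiv.swap 0 1 * ρ) (by simp [h0]) (by simp [h1])
    refine ⟨ν, fun u => ?_, ?_⟩
    · rw [← h]
      rw [FinGraph.predAbove_zero_eq_iff, Equiv.Perm.mul_apply]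
      by_cases hu0 : ρ u = 0
      · simp [hu0]
      by_cases hu1 : ρ u = 1
      · simp [hu1]
      rw [Equiv.swap_apply_of_ne_of_ne hu0 hu1]; exact Or.inl rfl
    · rw [hs, map_mul, Equiv.Perm.sign_swap Fin.zero_ne_one, mul_comm]

theorem exists_contract_iso {X Y : FinGraph (k + 2) (m + 1)}
    (h : FinGraph.Iso X Y) {e : Fin (m + 1)} {t t' : ℤˣ} {π π' : Equiv.Perm (Fin (k + 2))}
    (hπ : X.Normalizes e t π) (hπ' : Y.Normalizes (h.onE e) t' π') :
    ∃ c : FinGraph.Iso (X.contract e π) (Y.contract (h.onE e) π'),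
      (∀ j, h.onE (e.succAbove j) = (h.onE e).succAbove (c.onE j)) ∧
      t * π.sign * c.orientation = h.orientation * (t' * π'.sign) := by
  obtain ⟨τ, hτ, -⟩ := exists_perm_succAbove h.onE e
  have e1 := h.root_eq e t
  have e2 := h.root_eq e (-t)
  obtain ⟨ν, hν, hs⟩ := exists_perm_predAbove (π' * h.onV * π⁻¹) (t' * h.sgn e * t) (by
    have i0 : π⁻¹ 0 = X.root e (-t) := by rw [← hπ.1]; simp
    have i1 : π⁻¹ 1 = X.root e t := by rw [← hπ.2]; simp
    simp only [Equiv.Perm.mul_apply, i0, i1, ← e1, ← e2]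
    have a := hπ'.1
    have b := hπ'.2
    rcases Int.units_eq_one_or t with rfl | rfl <;>
      rcases Int.units_eq_one_or t' with rfl | rfl <;>
      rcases Int.units_eq_one_or (h.sgn e) with hh | hh <;>
      simp_all)
  let c : FinGraph.Iso (X.contract e π) (Y.contract (h.onE e) π') :=
    { onV := ν
      onE := τ
      sgn := fun f => h.sgn (e.succAbove f)
      root_eq := fun f s => by
        change Fin.predAbove 0 (π' (Y.root ((h.onE e).succAbove (τ f)) _)) =
          ν (Fin.predAbove 0 (π (X.root (e.succAbove f) s)))
        rw [← hτ, h.root_eq, ← hν]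
        simp }
  have hc : c.orientation = h.orientation * (t * t') * (π.sign * π'.sign) := by
    change ν.sign * ∏ f, h.sgn (e.succAbove f) = _
    rw [hs, FinGraph.Iso.orientation, Fin.prod_univ_succAbove _ e]
    simp only [map_mul, Equiv.Perm.sign_inv]
    ac_rfl
  refine ⟨c, hτ, ?_⟩
  rw [hc]
  have q1 : t * t = 1 := Int.units_mul_self t
  have q2 : π.sign * π.sign = 1 := Int.units_mul_self _
  calc t * π.sign * (h.orientation * (t * t') * (π.sign * π'.sign))
      = (t * t) * (π.sign * π.sign) * (h.orientation * (t' * π'.sign)) := by ac_rfl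
    _ = _ := by rw [q1, q2]; simp

theorem contract_iso {X Y : FinGraph (k + 2) (m + 1)} (hX : X.Admissible) (hY : Y.Admissible)
    (h : FinGraph.Iso X Y) {e : Fin (m + 1)} {t t' : ℤˣ} {π π' : Equiv.Perm (Fin (k + 2))}
    (hπ : X.Normalizes e t π) (hπ' : Y.Normalizes (h.onE e) t' π') :
    (((t * π.sign : ℤˣ) : ℤ) : ℝ) • cls (X.contract e π) (hX.contract hπ) =
      ((h.orientation : ℤ) : ℝ) •
        (((t' * π'.sign : ℤˣ) : ℤ) : ℝ) • cls (Y.contract (h.onE e) π') (hY.contract hπ') := by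
  obtain ⟨c, -, hc⟩ := exists_contract_iso h hπ hπ'
  rw [cls_iso _ (hY.contract hπ') c, smul_smul, smul_smul]
  congr 1
  exact_mod_cast congrArg (fun u : ℤˣ => (u : ℤ)) hc

/-- The graph `X_e` with its induced orientation; it is zero if `e` is a loop. -/
def collapse (X : OGraph (k + 2) (m + 1)) (e : Fin (m + 1)) : GChains (k + 1) m :=
  open Classical in
  if he : X.1.IsLoop e then 0
  else (((X.1.normalizer e).sign : ℤ) : ℝ) • cls (X.1.contract e (X.1.normalizer e))
    (X.2.contract (FinGraph.normalizes_normalizer he))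

theorem collapse_eq (X : OGraph (k + 2) (m + 1)) {e : Fin (m + 1)} {t : ℤˣ}
    {π : Equiv.Perm (Fin (k + 2))} (hπ : X.1.Normalizes e t π) :
    collapse X e = (((t * π.sign : ℤˣ) : ℤ) : ℝ) • cls (X.1.contract e π) (X.2.contract hπ) := by
  rw [collapse, dif_neg hπ.not_isLoop]
  let i : FinGraph.Iso X.1 X.1 := ⟨1, 1, 1, by simp⟩
  have := contract_iso X.2 X.2 i
    (FinGraph.normalizes_normalizer hπ.not_isLoop) (e := e) (t' := t) (π' := π) hπ
  have hi : i.orientation = 1 := by simp [i, FinGraph.Iso.orientation]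
  rw [hi, Units.val_one, Int.cast_one, one_smul, one_mul] at this
  exact this

theorem collapse_iso {X Y : OGraph (k + 2) (m + 1)} (h : FinGraph.Iso X.1 Y.1) (e : Fin (m + 1)) :
    collapse X e = ((h.orientation : ℤ) : ℝ) • collapse Y (h.onE e) := by
  have e1 := h.root_eq e 1
  have e2 := h.root_eq e (-1)
  rw [mul_one] at e1
  rw [mul_neg_one] at e2
  by_cases he : X.1.IsLoop e
  · have he' : Y.1.IsLoop (h.onE e) := by
      rw [FinGraph.isLoop_iff (h.sgn e), e1, e2, show X.1.root e (-1) = X.1.root e 1 from he]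
    rw [collapse, dif_pos he, collapse, dif_pos he', smul_zero]
  · have he' : ¬ Y.1.IsLoop (h.onE e) := by
      intro hl
      rw [FinGraph.isLoop_iff (h.sgn e)] at hl
      exact he (h.onV.injective (e2.symm.trans (hl.trans e1)))
    rw [collapse_eq X (FinGraph.normalizes_normalizer he),
      collapse_eq Y (FinGraph.normalizes_normalizer he')]
    exact contract_iso X.2 Y.2 h (FinGraph.normalizes_normalizer he)
      (FinGraph.normalizes_normalizer he')

/-- The boundary `∂_E (X) = ∑_e X_e`. -/
def edgeBoundary (k m : ℕ) : GChains (k + 2) (m + 1) →ₗ[ℝ] GChains (k + 1) m :=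
  (orRel (k + 2) (m + 1)).liftQ (Finsupp.linearCombination ℝ fun X => ∑ e, collapse X e) (by
    rw [orRel, Submodule.span_le]
    rintro _ ⟨X, Y, h, rfl⟩
    simp only [SetLike.mem_coe, LinearMap.mem_ker, map_sub, map_smul,
      Finsupp.linearCombination_single, one_smul]
    rw [sub_eq_zero, Finset.smul_sum, ← Equiv.sum_comp h.onE (fun e => _ • collapse Y e)]
    exact Finset.sum_congr rfl fun e _ => collapse_iso h e)

theorem edgeBoundary_cls (X : OGraph (k + 2) (m + 1)) :
    edgeBoundary k m (cls X.1 X.2) = ∑ e, collapse X e := by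
  simp [edgeBoundary, cls]

/-- The graph `X` with first `e` and then a further edge collapsed. -/
def collapseTwo (X : OGraph (k + 3) (m + 2)) (e : Fin (m + 2)) (j : Fin (m + 1)) :
    GChains (k + 1) m :=
  open Classical in
  if he : X.1.IsLoop e then 0
  else (((X.1.normalizer e).sign : ℤ) : ℝ) • collapse ⟨X.1.contract e (X.1.normalizer e),
    X.2.contract (FinGraph.normalizes_normalizer he)⟩ j

theorem edgeBoundary_collapse (X : OGraph (k + 3) (m + 2)) (e : Fin (m + 2)) :
    edgeBoundary k m (collapse X e) = ∑ j, collapseTwo X e j := by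
  by_cases he : X.1.IsLoop e
  · simp [collapse, collapseTwo, he]
  · simp only [collapseTwo, he, dite_false]
    rw [collapse, dif_neg he, map_smul,
      edgeBoundary_cls ⟨_, X.2.contract (FinGraph.normalizes_normalizer he)⟩, Finset.smul_sum]

theorem collapseTwo_eq (X : OGraph (k + 3) (m + 2)) {e : Fin (m + 2)} {t : ℤˣ}
    {π : Equiv.Perm (Fin (k + 3))} (hπ : X.1.Normalizes e t π) (j : Fin (m + 1)) :
    collapseTwo X e j =
      (((t * π.sign : ℤˣ) : ℤ) : ℝ) • collapse ⟨X.1.contract e π, X.2.contract hπ⟩ j := by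
  rw [collapseTwo, dif_neg hπ.not_isLoop]
  let i : FinGraph.Iso X.1 X.1 := ⟨1, 1, 1, by simp⟩
  have hi : i.orientation = 1 := by simp [i, FinGraph.Iso.orientation]
  obtain ⟨c, hj, hc⟩ := exists_contract_iso i
    (FinGraph.normalizes_normalizer hπ.not_isLoop) (e := e) (t' := t) (π' := π) hπ
  have hj' : c.onE j = j := (Fin.succAbove_right_injective (hj j)).symm
  rw [collapse_iso (X := ⟨_, X.2.contract (FinGraph.normalizes_normalizer hπ.not_isLoop)⟩)
    (Y := ⟨X.1.contract e π, X.2.contract hπ⟩) c j, smul_smul, hj']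
  congr 1
  rw [hi, one_mul, one_mul] at hc
  exact_mod_cast congrArg (fun u : ℤˣ => (u : ℤ)) hc

/-- Any list of distinct elements can be moved to the front. -/
theorem exists_perm_front {j n : ℕ} (g : Fin j → Fin n) (hg : Function.Injective g) :
    ∃ π : Equiv.Perm (Fin n), ∀ i, (π (g i) : ℕ) = i := by
  have hjn : j ≤ n := by simpa using Fintype.card_le_of_injective g hg
  let a := Equiv.ofInjective g hg
  let b := Equiv.ofInjective (Fin.castLE hjn) (Fin.castLE_injective hjn)
  refine ⟨(a.symm.trans b).extendSubtype, fun i => ?_⟩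
  rw [Equiv.extendSubtype_apply_of_mem _ _ ⟨i, rfl⟩]
  have : a.symm ⟨g i, ⟨i, rfl⟩⟩ = i := by rw [Equiv.symm_apply_eq]; rfl
  rw [Equiv.trans_apply, this]
  rfl


theorem cls_congr {X Y : FinGraph k m} (h : X = Y) (hX : X.Admissible) (hY : Y.Admissible) :
    cls X hX = cls Y hY := by
  subst h; rfl

theorem val_predAbove_zero (u : Fin (k + 2)) :
    (Fin.predAbove (0 : Fin (k + 1)) u : ℕ) = (u : ℕ) - 1 := by
  refine Fin.cases ?_ (fun i => ?_) u <;> simp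

theorem val_swap {n : ℕ} (a b v : Fin n) : (Equiv.swap a b v : ℕ) =
    if (v : ℕ) = a then (b : ℕ) else if (v : ℕ) = b then (a : ℕ) else v := by
  simp only [Equiv.swap_apply_def, Fin.ext_iff]
  split_ifs <;> rfl

theorem collapseTwo_swap_aux (X : OGraph (k + 3) (m + 2)) (e : Fin (m + 2))
    (j : Fin (m + 1)) (he : ¬ X.1.IsLoop e) (hf : ¬ X.1.IsLoop (e.succAbove j))
    (hpar : ∀ t u : ℤˣ, X.1.root e t = X.1.root (e.succAbove j) u →
      X.1.root e (-t) ≠ X.1.root (e.succAbove j) (-u)) :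
    collapseTwo X (e.succAbove j) (j.predAbove e) = - collapseTwo X e j := by
  set f := e.succAbove j with hfdef
  have hfe : f.succAbove (j.predAbove e) = e := Fin.succAbove_succAbove_predAbove e j
  have hll : ∀ l, f.succAbove ((j.predAbove e).succAbove l) = e.succAbove (j.succAbove l) :=
    Fin.succAbove_succAbove_succAbove_predAbove e j
  have hr : ∀ (π' : Equiv.Perm (Fin (k + 3))) s,
      ((X.1.contract f π').root (j.predAbove e) s : ℕ) = (π' (X.1.root e s) : ℕ) - 1 := by
    intro π' s
    change (Fin.predAbove 0 (π' (X.1.root (f.succAbove (j.predAbove e)) s)) : ℕ) = _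
    rw [hfe, val_predAbove_zero]
  have hr' : ∀ (π' : Equiv.Perm (Fin (k + 3))) s,
      ((X.1.contract e π').root j s : ℕ) = (π' (X.1.root f s) : ℕ) - 1 :=
    fun π' s => val_predAbove_zero _
  by_cases hsh : ∃ t u : ℤˣ, X.1.root e t = X.1.root f (-u)
  · -- the edges share the vertex `root e t`
    obtain ⟨t, u, htu⟩ := hsh
    have n1 : X.1.root e (-t) ≠ X.1.root e t := fun h => he ((FinGraph.isLoop_iff t).2 h)
    have n2 : X.1.root e t ≠ X.1.root f u := fun h =>
      hf ((FinGraph.isLoop_iff u).2 (htu.symm.trans h))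
    have n3 : X.1.root e (-t) ≠ X.1.root f u := by simpa using hpar t (-u) htu
    obtain ⟨π, hπ⟩ := exists_perm_front
      ![X.1.root e (-t), X.1.root e t, X.1.root f u] (by
        intro a b hab
        fin_cases a <;> fin_cases b <;>
          first | rfl | exact absurd hab n1 | exact absurd hab n1.symm | exact absurd hab n2 |
            exact absurd hab n2.symm | exact absurd hab n3 | exact absurd hab n3.symm)
    have p0 : (π (X.1.root e (-t)) : ℕ) = 0 := hπ 0
    have p1 : (π (X.1.root e t) : ℕ) = 1 := hπ 1
    have p2 : (π (X.1.root f u) : ℕ) = 2 := hπ 2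
    have p1' : (π (X.1.root f (-u)) : ℕ) = 1 := htu ▸ p1
    have N1 : X.1.Normalizes e t π := ⟨Fin.ext p0, Fin.ext p1⟩
    have N2 : (X.1.contract e π).Normalizes j u 1 :=
      ⟨Fin.ext (by
          change (Fin.predAbove 0 (π (X.1.root f (-u))) : ℕ) = 0
          rw [val_predAbove_zero, p1']),
        Fin.ext (by
          change (Fin.predAbove 0 (π (X.1.root f u)) : ℕ) = 1
          rw [val_predAbove_zero, p2])⟩
    have hs : (⟨0, by omega⟩ : Fin (k + 3)) ≠ ⟨2, by omega⟩ := by simp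
    have M1 : X.1.Normalizes f (-u) (Equiv.swap ⟨0, by omega⟩ ⟨2, by omega⟩ * π) :=
      ⟨Fin.ext (by
          rw [neg_neg, Equiv.Perm.mul_apply, val_swap, p2]
          simp),
        Fin.ext (by
          rw [Equiv.Perm.mul_apply, val_swap, p1']
          simp)⟩
    have M2 : (X.1.contract f (Equiv.swap ⟨0, by omega⟩ ⟨2, by omega⟩ * π)).Normalizes
        (j.predAbove e) (-t) 1 :=
      ⟨Fin.ext (by
          rw [Equiv.Perm.one_apply, hr, neg_neg, Equiv.Perm.mul_apply, val_swap, p1]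
          simp),
        Fin.ext (by
          rw [Equiv.Perm.one_apply, hr, Equiv.Perm.mul_apply, val_swap, p0]
          simp)⟩
    rw [collapseTwo_eq X N1, collapse_eq ⟨_, X.2.contract N1⟩ N2,
      collapseTwo_eq X M1, collapse_eq ⟨_, X.2.contract M1⟩ M2]
    have hG : (X.1.contract f (Equiv.swap ⟨0, by omega⟩ ⟨2, by omega⟩ * π)).contract
        (j.predAbove e) 1 = (X.1.contract e π).contract j 1 := by
      simp only [FinGraph.contract, hll]
      congr 1
      funext l s
      apply Fin.ext
      simp only [Equiv.Perm.one_apply, val_predAbove_zero, Equiv.Perm.mul_apply, val_swap]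
      split_ifs <;> omega
    rw [cls_congr hG _ ((X.2.contract N1).contract N2), smul_smul, smul_smul, ← neg_smul]
    congr 1
    simp only [map_mul, Equiv.Perm.sign_swap hs, Equiv.Perm.sign_one]
    push_cast
    ring
  · -- the edges are disjoint
    have hd : ∀ t u : ℤˣ, X.1.root e t ≠ X.1.root f u := fun t u h =>
      hsh ⟨t, -u, by rwa [neg_neg]⟩
    have hinj : Function.Injective ![X.1.root e (-1), X.1.root e 1, X.1.root f (-1),
        X.1.root f 1] := by
      intro a b hab
      fin_cases a <;> fin_cases b <;>
        first | rfl | exact absurd hab he | exact absurd hab.symm he | exact absurd hab hf |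
          exact absurd hab.symm hf | exact absurd hab (hd _ _) | exact absurd hab.symm (hd _ _)
    have hk : 4 ≤ k + 3 := by simpa using Fintype.card_le_of_injective _ hinj
    obtain ⟨l, rfl⟩ : ∃ l, k = l + 1 := ⟨k - 1, by omega⟩
    obtain ⟨π, hπ⟩ := exists_perm_front _ hinj
    have p0 : (π (X.1.root e (-1)) : ℕ) = 0 := hπ 0
    have p1 : (π (X.1.root e 1) : ℕ) = 1 := hπ 1
    have p2 : (π (X.1.root f (-1)) : ℕ) = 2 := hπ 2
    have p3 : (π (X.1.root f 1) : ℕ) = 3 := hπ 3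
    let ρ : Equiv.Perm (Fin (l + 3)) :=
      Equiv.swap ⟨1, by omega⟩ ⟨2, by omega⟩ * Equiv.swap ⟨0, by omega⟩ ⟨1, by omega⟩
    let π' : Equiv.Perm (Fin (l + 4)) :=
      Equiv.swap ⟨0, by omega⟩ ⟨2, by omega⟩ * Equiv.swap ⟨1, by omega⟩ ⟨3, by omega⟩ * π
    have hρ : ρ.sign = 1 := by
      simp only [ρ, map_mul]
      rw [Equiv.Perm.sign_swap (by simp), Equiv.Perm.sign_swap (by simp)]
      rfl
    have hπ' : π'.sign = π.sign := by
      simp only [π', map_mul]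
      rw [Equiv.Perm.sign_swap (by simp), Equiv.Perm.sign_swap (by simp)]
      simp
    have vρ : ∀ v : Fin (l + 3), (ρ v : ℕ) = if (v : ℕ) = 0 then (2 : ℕ) else
        if (v : ℕ) = 1 then (0 : ℕ) else if (v : ℕ) = 2 then (1 : ℕ) else (v : ℕ) := by
      intro v
      simp only [ρ, Equiv.Perm.mul_apply, val_swap]
      generalize (v : ℕ) = n
      rcases n with _ | _ | _ | n <;> simp
    have vπ : ∀ v, (π' v : ℕ) = if (π v : ℕ) = 0 then (2 : ℕ) else
        if (π v : ℕ) = 1 then (3 : ℕ) else if (π v : ℕ) = 2 then (0 : ℕ) else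
        if (π v : ℕ) = 3 then (1 : ℕ) else (π v : ℕ) := by
      intro v
      simp only [π', Equiv.Perm.mul_apply, val_swap]
      generalize (π v : ℕ) = n
      rcases n with _ | _ | _ | _ | n <;> simp
    have N1 : X.1.Normalizes e 1 π := ⟨Fin.ext p0, Fin.ext p1⟩
    have N2 : (X.1.contract e π).Normalizes j 1 ρ :=
      ⟨Fin.ext (by rw [vρ, hr', p2]; simp), Fin.ext (by rw [vρ, hr', p3]; simp)⟩
    have M1 : X.1.Normalizes f 1 π' :=
      ⟨Fin.ext (by rw [vπ, p2]; simp), Fin.ext (by rw [vπ, p3]; simp)⟩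
    have M2 : (X.1.contract f π').Normalizes (j.predAbove e) 1 ρ :=
      ⟨Fin.ext (by rw [vρ, hr, vπ, p0]; simp), Fin.ext (by rw [vρ, hr, vπ, p1]; simp)⟩
    rw [collapseTwo_eq X N1, collapse_eq ⟨_, X.2.contract N1⟩ N2,
      collapseTwo_eq X M1, collapse_eq ⟨_, X.2.contract M1⟩ M2]
    let c : FinGraph.Iso ((X.1.contract f π').contract (j.predAbove e) ρ)
        ((X.1.contract e π).contract j ρ) :=
      { onV := Equiv.swap ⟨0, by omega⟩ ⟨1, by omega⟩
        onE := 1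
        sgn := 1
        root_eq := fun a s => by
          simp only [FinGraph.contract, hll, Equiv.Perm.one_apply, Pi.one_apply, one_mul]
          apply Fin.ext
          simp only [val_predAbove_zero, val_swap, vρ, vπ]
          generalize (π (X.1.root (e.succAbove (j.succAbove a)) s) : ℕ) = n
          clear * -
          rcases n with _ | _ | _ | _ | n <;> simp }
    have hc : c.orientation = -1 := by
      simp only [FinGraph.Iso.orientation, c, Pi.one_apply, Finset.prod_const_one, mul_one]
      exact Equiv.Perm.sign_swap (by simp)
    rw [cls_iso _ ((X.2.contract N1).contract N2) c, hc, hρ, hπ', smul_smul, smul_smul, smul_smul,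
      ← neg_smul]
    congr 1
    push_cast
    ring

theorem collapseTwo_eq_zero (X : OGraph (k + 3) (m + 2)) (e : Fin (m + 2)) (j : Fin (m + 1))
    (h : X.1.IsLoop e ∨ X.1.IsLoop (e.succAbove j) ∨
      ∃ t u : ℤˣ, X.1.root e t = X.1.root (e.succAbove j) u ∧
        X.1.root e (-t) = X.1.root (e.succAbove j) (-u)) :
    collapseTwo X e j = 0 := by
  by_cases he : X.1.IsLoop e
  · rw [collapseTwo, dif_pos he]
  have N := FinGraph.normalizes_normalizer he
  have hl : (X.1.contract e (X.1.normalizer e)).IsLoop j := by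
    rcases h with h | h | ⟨t, u, h1, h2⟩
    · exact absurd h he
    · change Fin.predAbove 0 _ = Fin.predAbove 0 _
      rw [show X.1.root (e.succAbove j) (-1) = X.1.root (e.succAbove j) 1 from h]
    · rw [FinGraph.isLoop_iff u]
      change Fin.predAbove 0 (X.1.normalizer e (X.1.root (e.succAbove j) (-u))) =
        Fin.predAbove 0 (X.1.normalizer e (X.1.root (e.succAbove j) u))
      rw [← h1, ← h2, FinGraph.predAbove_zero_eq_iff]
      rcases Int.units_eq_one_or t with rfl | rfl
      · exact Or.inr (Or.inl N)
      · rw [neg_neg]; exact Or.inr (Or.inr N.symm)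
  rw [collapseTwo, dif_neg he, collapse, dif_pos hl, smul_zero]

theorem collapseTwo_swap (X : OGraph (k + 3) (m + 2)) (e : Fin (m + 2)) (j : Fin (m + 1)) :
    collapseTwo X (e.succAbove j) (j.predAbove e) = - collapseTwo X e j := by
  have hfe : (e.succAbove j).succAbove (j.predAbove e) = e := Fin.succAbove_succAbove_predAbove e j
  by_cases h : X.1.IsLoop e ∨ X.1.IsLoop (e.succAbove j) ∨
      ∃ t u : ℤˣ, X.1.root e t = X.1.root (e.succAbove j) u ∧
        X.1.root e (-t) = X.1.root (e.succAbove j) (-u)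
  · rw [collapseTwo_eq_zero X e j h, collapseTwo_eq_zero, neg_zero]
    rw [hfe]
    rcases h with h | h | ⟨t, u, h1, h2⟩
    · exact Or.inr (Or.inl h)
    · exact Or.inl h
    · exact Or.inr (Or.inr ⟨u, t, h1.symm, h2.symm⟩)
  · push Not at h
    exact collapseTwo_swap_aux X e j h.1 h.2.1 h.2.2

theorem edgeBoundary_edgeBoundary (k m : ℕ) :
    edgeBoundary k m ∘ₗ edgeBoundary (k + 1) (m + 1) = 0 := by
  refine Submodule.linearMap_qext _ (Finsupp.lhom_ext' fun X => LinearMap.ext_ring ?_)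
  change edgeBoundary k m (edgeBoundary (k + 1) (m + 1) (cls X.1 X.2)) = 0
  rw [edgeBoundary_cls, map_sum]
  simp only [edgeBoundary_collapse]
  rw [← Finset.sum_product']
  refine Finset.sum_involution (fun ij _ => (ij.1.succAbove ij.2, ij.2.predAbove ij.1)) ?_ ?_ ?_ ?_
  · rintro ⟨e, j⟩ -
    exact add_eq_zero_iff_eq_neg'.2 (collapseTwo_swap X e j)
  · rintro ⟨i, j⟩ - - h
    exact Fin.succAbove_ne i j (congrArg Prod.fst h)
  · simp
  · rintro ⟨i, j⟩ -
    simp [Fin.succAbove_succAbove_predAbove, Fin.predAbove_predAbove_succAbove]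

/-- The number of edges of a connected graph with `k ≥ 1` vertices and Euler characteristic
`1 - r`.  (There is no connected graph with `k = 0` vertices.) -/
def edgeCount (r : ℕ) : ℕ → ℕ
  | 0 => 0
  | k + 1 => r + k

/-- The boundary `X^{(r)}_{k+1} → X^{(r)}_k`. -/
def boundary (r : ℕ) : (k : ℕ) → GChains (k + 1) (edgeCount r (k + 1)) →ₗ[ℝ]
    GChains k (edgeCount r k)
  | 0 => 0
  | k + 1 => edgeBoundary k (r + k)

theorem boundary_boundary (r k : ℕ) : boundary r k ∘ₗ boundary r (k + 1) = 0 := by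
  cases k with
  | zero => exact LinearMap.zero_comp _
  | succ k => exact edgeBoundary_edgeBoundary k (r + k)

end GraphComplex

/-- The rank `r` part `X^{(r)}` of the commutative graph complex: `X^{(r)}_k` is spanned by the
connected oriented graphs with `k` vertices and Euler characteristic `1 - r`, all of whose vertices
are at least trivalent. -/
def graphComplex (r : ℕ) : ChainComplex (ModuleCat.{0} ℝ) ℕ :=
  ChainComplex.of (fun k => ModuleCat.of ℝ (GraphComplex.GChains k (GraphComplex.edgeCount r k)))
    (fun k => ModuleCat.ofHom (GraphComplex.boundary r k))
    (fun k => by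
      rw [← ModuleCat.ofHom_comp, GraphComplex.boundary_boundary]
      rfl)

end

/-! Two facts carry the theorem: the equivariant homology is the homology of the complex of
coinvariants of the twisted relative chains, and this complex is the graph complex with a shift of
degree.

The first fact rests on finite stabilizers and real coefficients. A simplex not at infinity is
preserved by only finitely many elements of Out(F_r), since these come from automorphisms of a
finite graph (`finite_setOf_smul_eq_self`). Averaging over the finitely many elements that carry an
orbit representative to a given simplex yields an equivariant section of the map ℝ[G] ⊗ A → A
(`GroupPartition`, `partition`), and such a section contracts the bar complex onto degree 0
(`contraction_succ`, `contraction_zero`). These column contractions do not commute with the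
horizontal differential, but the resulting error in the total complex moves one column to the left
and is therefore nilpotent (`defect_pow`). Hence the total complex has the homology of any complex D
onto which its bottom row maps surjectively, with kernel killed by the average
(`nonempty_hyperHomology_equiv`).

The second fact is about graphs. Outside A_r the edges not belonging to a simplex form a forest, and
collapsing it represents the simplex by a marked graph with no further edges, unique up to
isomorphism (`exists_rel_isFull`, `mk_eq_mk_iff_of_isFull`). Passing to orbits forgets the marking.
A graph with k vertices, p + 1 edges and Euler characteristic 1 - r has k = p + 2 - r, which is the
shift.

For the orientations, the exact sequence 0 → H_1 → C_1 → C_0 → H_0 → 0 of the graph shows that an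
ordering of the edges together with an orientation of H_1 amounts to an ordering of the vertices
together with directions of the edges. The marking orients H_1, and changing it by α multiplies this
orientation by det α, which the twist by ℝ̃ undoes. The comparison is made by a nonzero real
determinant `orNum`; its absolute value plays no role, only its behaviour under renumbering
(`orNum_relabel`), change of marking (`orNum_marking`) and contraction of an edge
(`orNum_contract`). A simplex goes to `coef` times the class of its graph.

Finally, omitting a vertex e of a simplex means giving the edge e length 0. If e is a loop the face
is at infinity, and otherwise it is the simplex of the contracted graph, so the simplicial boundary
becomes ∂_E (`value_face`, `toGraphs_boundary`). Injectivity on coinvariants is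
`eq_zero_of_toGraphs_eq_zero`. -/

noncomputable section

open CategoryTheory

/-! ### Bicomplexes with contractible columns -/

namespace HomologicalComplex₂

variable (K : HomologicalComplex₂ (ModuleCat.{0} ℝ) (ComplexShape.down ℕ) (ComplexShape.down ℕ))

/-- The total complex of a first quadrant bicomplex. -/
abbrev tot : ChainComplex (ModuleCat.{0} ℝ) ℕ := K.total (ComplexShape.down ℕ)

/-- The inclusion of a summand in the total complex. -/
abbrev incl (p q n : ℕ) (h : p + q = n) : (K.X p).X q ⟶ K.tot.X n :=
  K.ιTotal (ComplexShape.down ℕ) p q n h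

/-- The sign of the vertical differentials in the total complex. -/
abbrev vsign (p : ℕ) : ℤˣ :=
  ComplexShape.ε₂ (ComplexShape.down ℕ) (ComplexShape.down ℕ) (ComplexShape.down ℕ) (p, 0)

theorem incl_succ_zero_d (p : ℕ) : K.incl (p + 1) 0 (p + 1) rfl ≫ K.tot.d (p + 1) p =
    (K.d (p + 1) p).f 0 ≫ K.incl p 0 p rfl := by
  rw [total_d, Preadditive.comp_add, ι_D₁, ι_D₂, d₂_eq_zero _ _ _ _ _ (by simp), add_zero,
    K.d₁_eq (ComplexShape.down ℕ) (show (ComplexShape.down ℕ).Rel (p + 1) p by simp) 0 p rfl]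
  exact one_smul _ _

theorem incl_zero_succ_d (q n : ℕ) (h : 0 + (q + 1) = n + 1) (h' : 0 + q = n) :
    K.incl 0 (q + 1) (n + 1) h ≫ K.tot.d (n + 1) n =
      vsign 0 • ((K.X 0).d (q + 1) q ≫ K.incl 0 q n h') := by
  rw [total_d, Preadditive.comp_add, ι_D₁, ι_D₂, d₁_eq_zero _ _ _ _ _ (by simp), zero_add,
    K.d₂_eq (ComplexShape.down ℕ) 0 (show (ComplexShape.down ℕ).Rel (q + 1) q by simp) n h']
  rfl

theorem incl_succ_succ_d (p q n : ℕ) (h : p + 1 + (q + 1) = n + 1) (h' : p + (q + 1) = n)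
    (h'' : p + 1 + q = n) :
    K.incl (p + 1) (q + 1) (n + 1) h ≫ K.tot.d (n + 1) n =
      (K.d (p + 1) p).f (q + 1) ≫ K.incl p (q + 1) n h' +
      vsign (p + 1) • ((K.X (p + 1)).d (q + 1) q ≫ K.incl (p + 1) q n h'') := by
  rw [total_d, Preadditive.comp_add, ι_D₁, ι_D₂,
    K.d₁_eq (ComplexShape.down ℕ) (show (ComplexShape.down ℕ).Rel (p + 1) p by simp) _ n h',
    K.d₂_eq (ComplexShape.down ℕ) _ (show (ComplexShape.down ℕ).Rel (q + 1) q by simp) n h'']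
  congr 1
  exact one_smul _ _

/-- Linear contractions of the columns of a bicomplex, up to an idempotent-like map in degree `0`. -/
structure ColumnContraction where
  h : ∀ p q : ℕ, (K.X p).X q ⟶ (K.X p).X (q + 1)
  proj : ∀ p : ℕ, (K.X p).X 0 ⟶ (K.X p).X 0
  zero : ∀ p, h p 0 ≫ (K.X p).d 1 0 = 𝟙 _ - proj p
  d_proj : ∀ p, (K.X p).d 1 0 ≫ proj p = 0
  succ : ∀ p q, h p (q + 1) ≫ (K.X p).d (q + 2) (q + 1) + (K.X p).d (q + 1) q ≫ h p q = 𝟙 _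

variable {K}

namespace ColumnContraction

variable (c : K.ColumnContraction)

/-- The contraction of the total complex given by the contractions of the columns. -/
def homotopy (n : ℕ) : K.tot.X n ⟶ K.tot.X (n + 1) :=
  K.totalDesc fun p q hpq => vsign p • (c.h p q ≫
    K.incl p (q + 1) (n + 1) (by rw [← add_assoc]; exact congrArg (· + 1) hpq))

theorem incl_homotopy (p q n : ℕ) (hpq : p + q = n) :
    K.incl p q n hpq ≫ c.homotopy n = vsign p • (c.h p q ≫
      K.incl p (q + 1) (n + 1) (by omega)) :=
  ι_totalDesc ..

/-- The map of the total complex given by the maps `proj`. -/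
def totProj (n : ℕ) : K.tot.X n ⟶ K.tot.X n :=
  K.totalDesc fun p q hpq => match q with
    | 0 => (show (K.X p).X 0 ⟶ (K.X p).X 0 from c.proj p) ≫ K.incl p 0 n hpq
    | _ + 1 => 0

theorem incl_totProj_zero (p n : ℕ) (hpq : p + 0 = n) :
    K.incl p 0 n hpq ≫ c.totProj n = c.proj p ≫ K.incl p 0 n hpq :=
  ι_totalDesc ..

theorem incl_totProj_succ (p q n : ℕ) (hpq : p + (q + 1) = n) :
    K.incl p (q + 1) n hpq ≫ c.totProj n = 0 :=
  ι_totalDesc ..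

/-- The differential followed by the contraction. -/
def dHomotopy : (n : ℕ) → (K.tot.X n ⟶ K.tot.X n)
  | 0 => 0
  | n + 1 => K.tot.d (n + 1) n ≫ c.homotopy n

/-- The failure of the contraction of the total complex to be a contraction. -/
def defect (n : ℕ) : K.tot.X n ⟶ K.tot.X n :=
  𝟙 _ - c.totProj n - c.homotopy n ≫ K.tot.d (n + 1) n - c.dHomotopy n

theorem vsign_smul_smul (p : ℕ) {A B : ModuleCat.{0} ℝ} (f : A ⟶ B) :
    vsign p • vsign p • f = f := by
  rw [smul_smul, Int.units_mul_self, one_smul]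

/-- No horizontal differential leaves column 0, so there the contraction identities hold without
error. -/
theorem incl_zero_defect (q n : ℕ) (hq : 0 + q = n) : K.incl 0 q n hq ≫ c.defect n = 0 := by
  obtain rfl : q = n := by omega
  simp only [defect, Preadditive.comp_sub, Category.comp_id]
  rw [← Category.assoc, incl_homotopy, Linear.units_smul_comp, Category.assoc,
    incl_zero_succ_d _ _ _ _ hq, Linear.comp_units_smul, vsign_smul_smul]
  cases q with
  | zero =>
    rw [incl_totProj_zero, dHomotopy, Limits.comp_zero, ← Category.assoc, c.zero]
    simp
  | succ q =>
    rw [incl_totProj_succ, dHomotopy, ← Category.assoc (K.incl _ _ _ _),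
      incl_zero_succ_d _ _ _ _ (by omega), Linear.units_smul_comp, Category.assoc,
      incl_homotopy, Linear.comp_units_smul, vsign_smul_smul, ← Category.assoc, ← Category.assoc,
      sub_zero, sub_sub, ← Preadditive.add_comp, c.succ, Category.id_comp, sub_self]

/-- The vertical terms cancel by the contraction identities of column p + 1, the signs `vsign`
squaring to 1. The surviving terms each contain one horizontal differential and so land in column p:
the defect lowers the column index. -/
theorem exists_incl_succ_defect (p q n : ℕ) (h : p + 1 + q = n) (h' : p + (q + 1) = n) :
    ∃ w, K.incl (p + 1) q n h ≫ c.defect n = w ≫ K.incl p (q + 1) n h' := by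
  obtain ⟨n, rfl⟩ : ∃ l, n = l + 1 := ⟨p + q, by omega⟩
  simp only [defect, Preadditive.comp_sub, Category.comp_id]
  rw [← Category.assoc, incl_homotopy, Linear.units_smul_comp, Category.assoc,
    incl_succ_succ_d _ _ _ _ _ h' h, Preadditive.comp_add, smul_add, Linear.comp_units_smul,
    vsign_smul_smul]
  cases q with
  | zero =>
    obtain rfl : p = n := by omega
    refine ⟨-(vsign (p + 1) • (c.h (p + 1) 0 ≫ (K.d (p + 1) p).f 1)) -
      vsign p • ((K.d (p + 1) p).f 0 ≫ c.h p 0), ?_⟩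
    rw [incl_totProj_zero, dHomotopy, ← Category.assoc (K.incl _ _ _ _), incl_succ_zero_d,
      Category.assoc, incl_homotopy, ← Category.assoc (c.h _ _) _ (K.incl (p + 1) 0 _ _), c.zero (p + 1)]
    simp only [Preadditive.sub_comp, Linear.comp_units_smul, Linear.units_smul_comp,
      Preadditive.neg_comp, Category.id_comp, Category.assoc]
    abel
  | succ q =>
    refine ⟨-(vsign (p + 1) • (c.h (p + 1) (q + 1) ≫ (K.d (p + 1) p).f (q + 2))) -
      vsign p • ((K.d (p + 1) p).f (q + 1) ≫ c.h p (q + 1)), ?_⟩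
    rw [incl_totProj_succ, dHomotopy, ← Category.assoc (K.incl _ _ _ _),
      incl_succ_succ_d _ _ _ _ _ (by omega) (by omega), Preadditive.add_comp,
      Linear.units_smul_comp, Category.assoc, Category.assoc, incl_homotopy, incl_homotopy,
      Linear.comp_units_smul, Linear.comp_units_smul, vsign_smul_smul,
      ← Category.assoc (c.h _ _) _ (K.incl (p + 1) (q + 1) _ _),
      eq_sub_of_add_eq (c.succ (p + 1) q)]
    simp only [Preadditive.sub_comp, Linear.units_smul_comp,
      Preadditive.neg_comp, Category.id_comp, Category.assoc]
    abel

/-- The contraction lands in rows of positive index, so row 0 of its boundary consists of vertical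
boundaries, which `proj` kills. This keeps the iteration in `exists_homotopy_eq` inside the kernel
of `totProj`. -/
theorem homotopy_d_totProj (n : ℕ) : c.homotopy n ≫ K.tot.d (n + 1) n ≫ c.totProj n = 0 := by
  refine total.hom_ext _ fun p q (hpq : p + q = n) => ?_
  change K.incl p q n hpq ≫ _ = _
  rw [Limits.comp_zero, ← Category.assoc, incl_homotopy, Linear.units_smul_comp]
  have key : K.incl p (q + 1) (n + 1) (by omega) ≫ K.tot.d (n + 1) n ≫ c.totProj n = 0 := by
    cases p with
    | zero =>
      rw [← Category.assoc, incl_zero_succ_d _ _ _ _ hpq, Linear.units_smul_comp, Category.assoc]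
      cases q with
      | zero => rw [incl_totProj_zero, ← Category.assoc, c.d_proj, Limits.zero_comp, smul_zero]
      | succ q => rw [incl_totProj_succ, Limits.comp_zero, smul_zero]
    | succ p =>
      rw [← Category.assoc, incl_succ_succ_d _ _ _ _ _ (by omega) hpq, Preadditive.add_comp,
        Linear.units_smul_comp, Category.assoc, Category.assoc, incl_totProj_succ,
        Limits.comp_zero, zero_add]
      cases q with
      | zero => rw [incl_totProj_zero, ← Category.assoc, c.d_proj, Limits.zero_comp, smul_zero]
      | succ q => rw [incl_totProj_succ, Limits.comp_zero, smul_zero]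
  rw [Category.assoc, key, Limits.comp_zero, smul_zero]

theorem defect_pow_incl (n p : ℕ) : ∀ (q : ℕ) (hpq : p + q = n) (x : (K.X p).X q),
    ((c.defect n).hom ^ (p + 1)) ((K.incl p q n hpq).hom x) = 0 := by
  induction p with
  | zero =>
    intro q hpq x
    have := congrArg (fun f => f.hom x) (c.incl_zero_defect q n hpq)
    simpa using this
  | succ p ih =>
    intro q hpq x
    obtain ⟨w, hw⟩ := c.exists_incl_succ_defect p q n hpq (by omega)
    have := congrArg (fun f => f.hom x) hw
    rw [pow_succ, Module.End.mul_apply]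
    simp only [ModuleCat.hom_comp, LinearMap.comp_apply] at this
    rw [this]
    exact ih (q + 1) _ _

/-- Total degree n involves only the columns 0, …, n, and every application of the defect moves one
column to the left. -/
theorem defect_pow (n : ℕ) : (c.defect n).hom ^ (n + 1) = 0 := by
  have : ModuleCat.ofHom ((c.defect n).hom ^ (n + 1)) = 0 := by
    refine total.hom_ext _ fun p q (hpq : p + q = n) => ModuleCat.hom_ext (LinearMap.ext fun x => ?_)
    obtain ⟨j, hj⟩ : ∃ j, n + 1 = j + (p + 1) := ⟨q, by omega⟩
    change ((c.defect n).hom ^ (n + 1)) ((K.incl p q n hpq).hom x) = 0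
    rw [hj, pow_add, Module.End.mul_apply, c.defect_pow_incl n p q hpq, map_zero]
  exact congrArg ModuleCat.Hom.hom this

/-- On such a cycle the defect subtracts the boundary of `homotopy x` and returns a cycle of the
same kind; as the defect is nilpotent, iteration exhausts x. The primitive is kept in the form
`homotopy y` because such chains have no bottom component. -/
theorem exists_homotopy_eq (n : ℕ) (x : K.tot.X n) (hx : ∀ m, (K.tot.d n m).hom x = 0)
    (hP : (c.totProj n).hom x = 0) :
    ∃ y, (K.tot.d (n + 1) n).hom ((c.homotopy n).hom y) = x := by
  suffices H : ∀ (j : ℕ) (x : K.tot.X n), (∀ m, (K.tot.d n m).hom x = 0) →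
      (c.totProj n).hom x = 0 → ((c.defect n).hom ^ j) x = 0 →
      ∃ y, (K.tot.d (n + 1) n).hom ((c.homotopy n).hom y) = x from
    H (n + 1) x hx hP (by rw [c.defect_pow]; rfl)
  intro j
  induction j with
  | zero => intro x _ _ h; exact ⟨0, by simpa using h.symm⟩
  | succ j ih =>
    intro x hx hP h
    have hN : (c.defect n).hom x = x - (K.tot.d (n + 1) n).hom ((c.homotopy n).hom x) := by
      have : (c.dHomotopy n).hom x = 0 := by
        cases n with
        | zero => rfl
        | succ n => simp [dHomotopy, hx]
      simp [defect, this, hP]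
    obtain ⟨y, hy⟩ := ih ((c.defect n).hom x) (fun m => by
        rw [hN, map_sub, hx, zero_sub, neg_eq_zero]
        exact congrArg (fun f => f.hom ((c.homotopy n).hom x)) (K.tot.d_comp_d (n + 1) n m))
      (by
        rw [hN, map_sub, hP, zero_sub, neg_eq_zero]
        exact congrArg (fun f => f.hom x) (c.homotopy_d_totProj n))
      (by rwa [pow_succ, Module.End.mul_apply] at h)
    exact ⟨x + y, by rw [map_add, map_add, hy, hN]; abel⟩

end ColumnContraction

variable (K) in
/-- The projection of the total complex onto the bottom row. -/
def bottom (n : ℕ) : K.tot.X n ⟶ (K.X n).X 0 :=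
  K.totalDesc fun p q hpq => match q with
    | 0 => (K.XXIsoOfEq _ _ _ (show p = n from hpq) (rfl : 0 = 0)).hom
    | _ + 1 => 0

theorem incl_bottom_zero (n : ℕ) : K.incl n 0 n rfl ≫ K.bottom n = 𝟙 _ := by
  rw [bottom]
  erw [ι_totalDesc]
  simp

theorem incl_bottom_succ (p q n : ℕ) (h : p + (q + 1) = n) :
    K.incl p (q + 1) n h ≫ K.bottom n = 0 :=
  ι_totalDesc ..

/-- Row 0 of a boundary comes horizontally from row 0 and vertically from row 1, and f kills the
second part. So projection to the bottom row followed by f behaves like a chain map. -/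
theorem d_bottom (n : ℕ) {A : ModuleCat.{0} ℝ} (f : (K.X n).X 0 ⟶ A)
    (hf : (K.X n).d 1 0 ≫ f = 0) :
    K.tot.d (n + 1) n ≫ K.bottom n ≫ f = K.bottom (n + 1) ≫ (K.d (n + 1) n).f 0 ≫ f := by
  refine total.hom_ext _ fun p q (hpq : p + q = n + 1) => ?_
  change K.incl p q _ hpq ≫ _ = K.incl p q _ hpq ≫ _
  cases q with
  | zero =>
    obtain rfl : p = n + 1 := hpq
    rw [← Category.assoc, incl_succ_zero_d, Category.assoc, ← Category.assoc (K.incl _ _ _ _),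
      incl_bottom_zero, ← Category.assoc (K.incl _ _ _ _), incl_bottom_zero]
    simp
  | succ q =>
    rw [← Category.assoc (K.incl _ _ _ _) (K.bottom _), incl_bottom_succ, Limits.zero_comp]
    have aux : ∀ (p : ℕ) (h : p + q = n), ((K.X p).d (q + 1) q ≫ K.incl p q n h) ≫
        K.bottom n ≫ f = 0 := by
      intro p h
      cases q with
      | zero =>
        obtain rfl : p = n := h
        rw [Category.assoc, ← Category.assoc (K.incl _ _ _ _), incl_bottom_zero, Category.id_comp,
          hf]
      | succ q =>
        rw [Category.assoc, ← Category.assoc (K.incl _ _ _ _), incl_bottom_succ, Limits.zero_comp,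
          Limits.comp_zero]
    cases p with
    | zero =>
      rw [← Category.assoc, incl_zero_succ_d _ _ _ _ (by omega), Linear.units_smul_comp, aux,
        smul_zero]
    | succ p =>
      rw [← Category.assoc, incl_succ_succ_d _ _ _ _ _ (by omega) (by omega), Preadditive.add_comp,
        Linear.units_smul_comp, aux, smul_zero, add_zero, Category.assoc,
        ← Category.assoc (K.incl _ _ _ _), incl_bottom_succ, Limits.zero_comp, Limits.comp_zero]

namespace ColumnContraction

variable (c : K.ColumnContraction)

theorem homotopy_bottom (n : ℕ) : c.homotopy n ≫ K.bottom (n + 1) = 0 := by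
  refine total.hom_ext _ fun p q (hpq : p + q = n) => ?_
  change K.incl p q n hpq ≫ _ = _
  rw [Limits.comp_zero, ← Category.assoc, incl_homotopy, Linear.units_smul_comp, Category.assoc,
    incl_bottom_succ, Limits.comp_zero, smul_zero]

theorem totProj_eq (n : ℕ) : c.totProj n = K.bottom n ≫ c.proj n ≫ K.incl n 0 n rfl := by
  refine total.hom_ext _ fun p q (hpq : p + q = n) => ?_
  change K.incl p q n hpq ≫ _ = K.incl p q n hpq ≫ _
  cases q with
  | zero =>
    obtain rfl : p = n := hpq
    rw [incl_totProj_zero, ← Category.assoc (K.incl _ _ _ _), incl_bottom_zero, Category.id_comp]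
  | succ q =>
    rw [incl_totProj_succ, ← Category.assoc (K.incl _ _ _ _), incl_bottom_succ, Limits.zero_comp]

/-- A cycle of the total complex whose bottom component is killed by `proj` is the boundary of a
chain without bottom component. -/
theorem exists_boundary (n : ℕ) (x : K.tot.X n) (hx : ∀ m, (K.tot.d n m).hom x = 0)
    (hP : (c.proj n).hom ((K.bottom n).hom x) = 0) :
    ∃ y, (K.tot.d (n + 1) n).hom y = x ∧ (K.bottom (n + 1)).hom y = 0 := by
  obtain ⟨y, hy⟩ := c.exists_homotopy_eq n x hx (by
    rw [totProj_eq]; simp [hP])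
  exact ⟨_, hy, congrArg (fun f => f.hom y) (c.homotopy_bottom n)⟩

end ColumnContraction
end HomologicalComplex₂

/-- A linear map inducing a bijection on homology classes gives an isomorphism of homology. -/
theorem nonempty_homology_equiv (S S' : ShortComplex (ModuleCat.{0} ℝ)) (φ : S.X₂ →ₗ[ℝ] S'.X₂)
    (hcyc : ∀ x, S.g.hom x = 0 → S'.g.hom (φ x) = 0)
    (hbd : ∀ x, ∃ y, S'.f.hom y = φ (S.f.hom x))
    (hinj : ∀ x, S.g.hom x = 0 → (∃ y, S'.f.hom y = φ x) → ∃ z, S.f.hom z = x)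
    (hsurj : ∀ y, S'.g.hom y = 0 → ∃ x, S.g.hom x = 0 ∧ φ x = y) :
    Nonempty (S.homology ≃ₗ[ℝ] S'.homology) := by
  let φ' : LinearMap.ker S.g.hom →ₗ[ℝ] LinearMap.ker S'.g.hom :=
    φ.restrict fun x hx => hcyc x hx
  let ψ : (LinearMap.ker S.g.hom ⧸ LinearMap.range S.moduleCatToCycles) →ₗ[ℝ]
      (LinearMap.ker S'.g.hom ⧸ LinearMap.range S'.moduleCatToCycles) :=
    Submodule.mapQ _ _ φ' (by
      rintro _ ⟨x, rfl⟩
      obtain ⟨y, hy⟩ := hbd x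
      exact ⟨y, Subtype.ext hy⟩)
  have hψ : Function.Bijective ψ := by
    constructor
    · rw [← LinearMap.ker_eq_bot, LinearMap.ker_eq_bot']
      intro x hx
      obtain ⟨⟨x, hx0⟩, rfl⟩ := Submodule.mkQ_surjective _ x
      have hx' : φ' ⟨x, hx0⟩ ∈ LinearMap.range S'.moduleCatToCycles :=
        (Submodule.Quotient.mk_eq_zero _).1 hx
      obtain ⟨y, hy⟩ := hx'
      obtain ⟨z, hz⟩ := hinj x hx0 ⟨y, congrArg Subtype.val hy⟩
      exact (Submodule.Quotient.mk_eq_zero _).2 ⟨z, Subtype.ext hz⟩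
    · intro y
      obtain ⟨⟨y, hy⟩, rfl⟩ := Submodule.mkQ_surjective _ y
      obtain ⟨x, hx, rfl⟩ := hsurj y hy
      exact ⟨Submodule.mkQ _ ⟨x, hx⟩, rfl⟩
  exact ⟨S.moduleCatHomologyIso.toLinearEquiv ≪≫ₗ LinearEquiv.ofBijective ψ hψ ≪≫ₗ
    S'.moduleCatHomologyIso.toLinearEquiv.symm⟩

theorem nonempty_chainComplex_homology_equiv (C D : ChainComplex (ModuleCat.{0} ℝ) ℕ) (n k : ℕ)
    (φ : C.X n →ₗ[ℝ] D.X k)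
    (hcyc : ∀ x, (∀ m, (C.d n m).hom x = 0) → ∀ m, (D.d k m).hom (φ x) = 0)
    (hbd : ∀ x, ∃ y, (D.d (k + 1) k).hom y = φ ((C.d (n + 1) n).hom x))
    (hinj : ∀ x, (∀ m, (C.d n m).hom x = 0) → (∃ y, (D.d (k + 1) k).hom y = φ x) →
      ∃ z, (C.d (n + 1) n).hom z = x)
    (hsurj : ∀ y, (∀ m, (D.d k m).hom y = 0) → ∃ x, (∀ m, (C.d n m).hom x = 0) ∧ φ x = y) :
    Nonempty (C.homology n ≃ₗ[ℝ] D.homology k) := by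
  have all : ∀ (E : ChainComplex (ModuleCat.{0} ℝ) ℕ) (l : ℕ) (x : E.X l),
      (E.d l ((ComplexShape.down ℕ).next l)).hom x = 0 ↔ ∀ m, (E.d l m).hom x = 0 := by
    intro E l x
    refine ⟨fun h m => ?_, fun h => h _⟩
    by_cases hm : (ComplexShape.down ℕ).Rel l m
    · rw [← (ComplexShape.down ℕ).next_eq' hm]; exact h
    · rw [E.shape _ _ hm]; rfl
  obtain ⟨e⟩ := nonempty_homology_equiv (C.sc' (n + 1) n ((ComplexShape.down ℕ).next n))
    (D.sc' (k + 1) k ((ComplexShape.down ℕ).next k)) φ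
    (fun x hx => (all D k _).2 (hcyc x ((all C n x).1 hx))) hbd
    (fun x hx => hinj x ((all C n x).1 hx))
    (fun y hy => by
      obtain ⟨x, hx, h⟩ := hsurj y ((all D k y).1 hy)
      exact ⟨x, (all C n x).2 hx, h⟩)
  exact ⟨(ShortComplex.homologyMapIso (C.isoSc' (n + 1) n _ (by simp) rfl)).toLinearEquiv ≪≫ₗ e
    ≪≫ₗ (ShortComplex.homologyMapIso (D.isoSc' (k + 1) k _ (by simp) rfl)).toLinearEquiv.symm⟩

/-! ### Comparison of the total complex with a quotient of the bottom row. -/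

namespace HomologicalComplex₂.ColumnContraction

variable {K : HomologicalComplex₂ (ModuleCat.{0} ℝ) (ComplexShape.down ℕ) (ComplexShape.down ℕ)}
  (c : K.ColumnContraction)

/-- Comparison of the total complex with a complex `D` to which the bottom row maps, in one
degree. -/
theorem nonempty_homology_equiv_of_lift (D : ChainComplex (ModuleCat.{0} ℝ) ℕ) (n k : ℕ)
    (f : (K.X n).X 0 ⟶ D.X k) (f' : (K.X (n + 1)).X 0 ⟶ D.X (k + 1))
    (hf : (K.X n).d 1 0 ≫ f = 0)
    (hker : ∀ x, f.hom x = 0 → (c.proj n).hom x = 0)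
    (hcomm : (K.d (n + 1) n).f 0 ≫ f = f' ≫ D.d (k + 1) k)
    (hsurj : Function.Surjective f'.hom)
    (hcyc : ∀ x, (∀ m, (K.tot.d n m).hom x = 0) →
      ∀ m, (D.d k m).hom (f.hom ((K.bottom n).hom x)) = 0)
    (hlift : ∀ y, (∀ m, (D.d k m).hom y = 0) → ∃ x, (∀ m, (K.tot.d n m).hom x = 0) ∧
      f.hom ((K.bottom n).hom x) = y) :
    Nonempty ((K.total (ComplexShape.down ℕ)).homology n ≃ₗ[ℝ] D.homology k) := by
  have comm : ∀ x, f.hom ((K.bottom n).hom ((K.tot.d (n + 1) n).hom x)) =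
      (D.d (k + 1) k).hom (f'.hom ((K.bottom (n + 1)).hom x)) := fun x => by
    have h1 := congrArg (fun g => g.hom x) (d_bottom n f hf)
    have h2 := congrArg (fun g => g.hom ((K.bottom (n + 1)).hom x)) hcomm
    exact h1.trans h2
  have bsurj : ∀ y, (K.bottom (n + 1)).hom ((K.incl (n + 1) 0 (n + 1) rfl).hom y) = y := fun y =>
    congrArg (fun g => g.hom y) (incl_bottom_zero (K := K) (n + 1))
  refine nonempty_chainComplex_homology_equiv K.tot D n k (f.hom ∘ₗ (K.bottom n).hom) hcyc
    (fun x => ⟨_, (comm x).symm⟩) ?_ hlift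
  rintro x hx ⟨b, hb⟩
  obtain ⟨a, rfl⟩ := hsurj b
  -- Subtracting the boundary of this lift of b makes the image in D vanish, and `hker` turns that
  -- into the hypothesis of `exists_boundary`.
  set y := (K.incl (n + 1) 0 (n + 1) rfl).hom a
  obtain ⟨z, hz, -⟩ := c.exists_boundary n (x - (K.tot.d (n + 1) n).hom y) (fun m => by
      rw [map_sub, hx, zero_sub, neg_eq_zero]
      exact congrArg (fun g => g.hom y) (K.tot.d_comp_d (n + 1) n m))
    (hker _ (by
      rw [map_sub, map_sub, comm, bsurj, hb, sub_eq_zero]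
      rfl))
  exact ⟨z + y, by rw [map_add, hz]; abel⟩

/-- What has to be added to `nonempty_homology_equiv_of_lift` is that cycles of D lift. A preimage
in the bottom row need not be a cycle, but its boundary maps to 0 under `f₀`, hence bounds a chain z
without bottom component; subtracting z gives a cycle with the same image. This is why three
consecutive degrees enter. -/
theorem nonempty_homology_equiv (D : ChainComplex (ModuleCat.{0} ℝ) ℕ) (n k : ℕ)
    (f₀ : (K.X n).X 0 ⟶ D.X k) (f₁ : (K.X (n + 1)).X 0 ⟶ D.X (k + 1))
    (f₂ : (K.X (n + 2)).X 0 ⟶ D.X (k + 2))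
    (hf₀ : (K.X n).d 1 0 ≫ f₀ = 0) (hf₁ : (K.X (n + 1)).d 1 0 ≫ f₁ = 0)
    (hker₀ : ∀ x, f₀.hom x = 0 → (c.proj n).hom x = 0)
    (hker₁ : ∀ x, f₁.hom x = 0 → (c.proj (n + 1)).hom x = 0)
    (hcomm₀ : (K.d (n + 1) n).f 0 ≫ f₀ = f₁ ≫ D.d (k + 1) k)
    (hcomm₁ : (K.d (n + 2) (n + 1)).f 0 ≫ f₁ = f₂ ≫ D.d (k + 2) (k + 1))
    (hsurj₁ : Function.Surjective f₁.hom) (hsurj₂ : Function.Surjective f₂.hom) :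
    Nonempty ((K.total (ComplexShape.down ℕ)).homology (n + 1) ≃ₗ[ℝ] D.homology (k + 1)) := by
  have comm : ∀ x, f₀.hom ((K.bottom n).hom ((K.tot.d (n + 1) n).hom x)) =
      (D.d (k + 1) k).hom (f₁.hom ((K.bottom (n + 1)).hom x)) := fun x => by
    have h1 := congrArg (fun g => g.hom x) (d_bottom n f₀ hf₀)
    have h2 := congrArg (fun g => g.hom ((K.bottom (n + 1)).hom x)) hcomm₀
    exact h1.trans h2
  have dz : ∀ (E : ChainComplex (ModuleCat.{0} ℝ) ℕ) (l : ℕ) (x : E.X (l + 1)),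
      (E.d (l + 1) l).hom x = 0 → ∀ m, (E.d (l + 1) m).hom x = 0 := by
    intro E l x h m
    by_cases hm : l = m
    · subst hm; exact h
    · rw [E.shape _ _ (fun h => hm (by simpa using h.symm))]; rfl
  refine c.nonempty_homology_equiv_of_lift D (n + 1) (k + 1) f₁ f₂ hf₁ hker₁ hcomm₁ hsurj₂ ?_ ?_
  · intro x hx
    refine dz _ _ _ ?_
    rw [← comm, hx, map_zero, map_zero]
  · intro y hy
    obtain ⟨a, rfl⟩ := hsurj₁ y
    have hb : (K.bottom (n + 1)).hom ((K.incl (n + 1) 0 (n + 1) rfl).hom a) = a :=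
      congrArg (fun g => g.hom a) (incl_bottom_zero (K := K) (n + 1))
    set x := (K.incl (n + 1) 0 (n + 1) rfl).hom a
    obtain ⟨z, hz, hz'⟩ := c.exists_boundary n ((K.tot.d (n + 1) n).hom x) (fun m =>
        congrArg (fun g => g.hom x) (K.tot.d_comp_d (n + 1) n m))
      (hker₀ _ (by rw [comm, hb, hy]))
    refine ⟨x - z, dz _ _ _ (by rw [map_sub, hz, sub_self]), ?_⟩
    rw [map_sub, hz', sub_zero, hb]

end HomologicalComplex₂.ColumnContraction

/-! ### Contraction of the bar complex -/

/-- A partition of unity on a representation: a decomposition `a = ∑ g, θ a g` which is compatible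
with the group action. -/
structure GroupPartition {G : Type} [Group G] {A : Type} [AddCommGroup A] [Module ℝ A]
    (ρ : Representation ℝ G A) where
  θ : A →ₗ[ℝ] (G →₀ A)
  sum_eq : ∀ a, (θ a).sum (fun _ b => b) = a
  equivariant : ∀ (h : G) (a : A), θ (ρ h a) =
    Finsupp.mapDomain (h * ·) (Finsupp.mapRange.linearMap (ρ h) (θ a))

namespace GroupPartition

variable {G : Type} [Group G] {A : Rep.{0} ℝ G} (P : GroupPartition A.ρ)

/-- The contraction of the bar complex. -/
def contraction (n : ℕ) : ((Fin n → G) →₀ A) →ₗ[ℝ] ((Fin (n + 1) → G) →₀ A) :=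
  Finsupp.lsum ℝ fun x => (Finsupp.lsum ℝ fun g : G =>
    Finsupp.lsingle (Fin.cons g⁻¹ x : Fin (n + 1) → G) ∘ₗ A.ρ g⁻¹) ∘ₗ P.θ

/-- The weighted average over the group. -/
def average : A →ₗ[ℝ] A := (Finsupp.lsum ℝ fun g : G => A.ρ g⁻¹) ∘ₗ P.θ

theorem contraction_single (n : ℕ) (x : Fin n → G) (a : A) : P.contraction n (Finsupp.single x a) =
    (P.θ a).sum fun g b => Finsupp.single (Fin.cons g⁻¹ x : Fin (n + 1) → G) (A.ρ g⁻¹ b) := by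
  simp [contraction]
  rfl

theorem average_apply (a : A) : P.average a = (P.θ a).sum fun g b => A.ρ g⁻¹ b := by
  simp [average]

/-- By equivariance a summand b at g becomes `ρ h b` at hg, and (hg)⁻¹h = g⁻¹. Hence the average
factors through the coinvariants. -/
theorem average_rho (h : G) (a : A) : P.average (A.ρ h a) = P.average a := by
  rw [average_apply, average_apply, P.equivariant, Finsupp.sum_mapDomain_index (by simp) (by simp),
    Finsupp.mapRange.linearMap_apply, Finsupp.sum_mapRange_index (by simp)]
  refine Finsupp.sum_congr fun g _ => ?_
  rw [mul_inv_rev, map_mul, Module.End.mul_apply, Representation.inv_self_apply]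

theorem contractNth_succ_cons {n : ℕ} (i : Fin (n + 1)) (y : G) (x : Fin (n + 1) → G) :
    Fin.contractNth i.succ (· * ·) (Fin.cons y x : Fin (n + 2) → G) =
      Fin.cons y (Fin.contractNth i (· * ·) x) := by
  funext j
  refine Fin.cases ?_ (fun j => ?_) j
  · simp [Fin.contractNth]
  · simp only [Fin.contractNth, Fin.cons_succ, Fin.val_succ, Nat.succ_lt_succ_iff,
      Nat.succ_inj, ← Fin.succ_castSucc]

theorem contractNth_zero_cons {n : ℕ} (y : G) (x : Fin (n + 1) → G) :
    Fin.contractNth 0 (· * ·) (Fin.cons y x : Fin (n + 2) → G) =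
      Fin.cons (y * x 0) (fun i => x i.succ) := by
  funext j
  refine Fin.cases ?_ (fun j => ?_) j
  · simp [Fin.contractNth]
  · simp [Fin.contractNth]

/-- Equivariance shifts the summation index to x₀⁻¹g, whose inverse is g⁻¹x₀. This is the product of
the first two entries of (g⁻¹, x₀, …), so the sum cancels against a face of the contracted chain in
`contraction_succ`. -/
theorem contraction_rho (n : ℕ) (x : Fin (n + 1) → G) (a : A) :
    P.contraction n (Finsupp.single (fun i => x i.succ) (A.ρ (x 0)⁻¹ a)) =
      (P.θ a).sum fun g b => Finsupp.single
        (Fin.cons (g⁻¹ * x 0) (fun i => x i.succ) : Fin (n + 1) → G) (A.ρ g⁻¹ b) := by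
  rw [contraction_single, P.equivariant, Finsupp.sum_mapDomain_index (by simp) (by simp),
    Finsupp.mapRange.linearMap_apply, Finsupp.sum_mapRange_index (by simp)]
  refine Finsupp.sum_congr fun g _ => ?_
  rw [mul_inv_rev, inv_inv, map_mul, Module.End.mul_apply, Representation.self_inv_apply]

/-- With a = ∑ b, the contraction of [x] ⊗ a is ∑ [g⁻¹, x] ⊗ g⁻¹b. Its first face gives ∑ [x] ⊗ b =
[x] ⊗ a, and all other faces cancel against the contraction of the boundary. -/
theorem contraction_succ (n : ℕ) (x : (Fin (n + 1) → G) →₀ A) :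
    (groupHomology.inhomogeneousChains.d A (n + 1)).hom (P.contraction (n + 1) x) +
      P.contraction n ((groupHomology.inhomogeneousChains.d A n).hom x) = x := by
  induction x using Finsupp.induction_linear with
  | zero => simp
  | add x y hx hy =>
    rw [map_add, map_add, map_add, map_add, add_add_add_comm, hx, hy]
  | single x a =>
    have h1 := groupHomology.inhomogeneousChains.d_single (A := A) n x a
    rw [h1, map_add, contraction_rho, contraction_single, map_finsuppSum]
    have h2 : ∀ (g : G) (b : A), (groupHomology.inhomogeneousChains.d A (n + 1)).hom
        (Finsupp.single (Fin.cons g⁻¹ x : Fin (n + 2) → G) (A.ρ g⁻¹ b)) =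
        Finsupp.single x b - Finsupp.single
          (Fin.cons (g⁻¹ * x 0) (fun i => x i.succ) : Fin (n + 1) → G) (A.ρ g⁻¹ b) +
        ∑ i : Fin (n + 1), (-1 : ℝ) ^ (i : ℕ) •
          Finsupp.single (Fin.cons g⁻¹ (Fin.contractNth i (· * ·) x)) (A.ρ g⁻¹ b) := by
      intro g b
      refine (groupHomology.inhomogeneousChains.d_single (A := A) (n + 1) _ _).trans ?_
      rw [Fin.sum_univ_succ, contractNth_zero_cons]
      simp only [contractNth_succ_cons, Fin.cons_succ, Fin.cons_zero, inv_inv,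
        Representation.self_inv_apply, Fin.val_zero, Fin.val_succ]
      rw [← add_assoc]
      congr 1
      · simp [sub_eq_add_neg]
      · refine Finset.sum_congr rfl fun i _ => ?_
        congr 1
        rw [pow_add, pow_add]; ring
    simp only [h2, map_sum, map_smul, contraction_single]
    have h3 : ((P.θ a).sum fun _ b => Finsupp.single x b) = Finsupp.single x a := by
      conv_rhs => rw [← P.sum_eq a]
      rw [Finsupp.single_sum]
    simp only [Finsupp.sum] at h3 ⊢
    rw [Finset.sum_add_distrib, Finset.sum_sub_distrib, h3, Finset.sum_comm]
    simp only [Finset.smul_sum, pow_succ, mul_neg_one, neg_smul, Finset.sum_neg_distrib]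
    abel

/-- Here [g⁻¹] ⊗ g⁻¹b has two faces: the first ones add up to a, the second ones to the average. -/
theorem contraction_zero (x : (Fin 0 → G) →₀ A) :
    (groupHomology.inhomogeneousChains.d A 0).hom (P.contraction 0 x) =
      x - Finsupp.mapRange.linearMap P.average x := by
  induction x using Finsupp.induction_linear with
  | zero => simp
  | add x y hx hy => rw [map_add, map_add, map_add, hx, hy]; abel
  | single x a =>
    rw [contraction_single, map_finsuppSum, Finsupp.mapRange.linearMap_apply,
      Finsupp.mapRange_single, average_apply]
    have h2 : ∀ (g : G) (b : A), (groupHomology.inhomogeneousChains.d A 0).hom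
        (Finsupp.single (Fin.cons g⁻¹ x : Fin 1 → G) (A.ρ g⁻¹ b)) =
        Finsupp.single x b - Finsupp.single x (A.ρ g⁻¹ b) := by
      intro g b
      refine (groupHomology.inhomogeneousChains.d_single (A := A) 0 _ _).trans ?_
      rw [Fin.sum_univ_one]
      simp [sub_eq_add_neg, Subsingleton.elim _ x]
    simp only [h2]
    rw [Finsupp.sum_sub, ← Finsupp.single_sum, ← Finsupp.single_sum, P.sum_eq]

end GroupPartition

/-! ### Equivariant homology as the homology of coinvariants -/

section HyperHomology

variable {G : Type} [Group G] (C : ChainComplex (Rep.{0} ℝ G) ℕ)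

/-- The bicomplex of bar chains with coefficients in a complex of representations. -/
abbrev barBicomplex :
    HomologicalComplex₂ (ModuleCat.{0} ℝ) (ComplexShape.down ℕ) (ComplexShape.down ℕ) :=
  ((groupHomology.chainsFunctor ℝ G).mapHomologicalComplex (ComplexShape.down ℕ)).obj C

theorem barBicomplex_vert (p q : ℕ) : ((barBicomplex C).X p).d (q + 1) q =
    groupHomology.inhomogeneousChains.d (C.X p) q :=
  groupHomology.inhomogeneousChains.d_def _ _

variable {C}

/-- The contractions of the columns of the bicomplex of bar chains. -/
def barContraction (P : ∀ p, GroupPartition (C.X p).ρ) : (barBicomplex C).ColumnContraction where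
  h p q := ModuleCat.ofHom ((P p).contraction q)
  proj p := ModuleCat.ofHom (Finsupp.mapRange.linearMap (P p).average)
  zero p := by
    rw [barBicomplex_vert]
    exact ModuleCat.hom_ext (LinearMap.ext fun x => (P p).contraction_zero x)
  d_proj p := by
    rw [barBicomplex_vert]
    refine groupHomology.inhomogeneousChains.ext fun x => ModuleCat.hom_ext (LinearMap.ext fun a => ?_)
    change Finsupp.mapRange.linearMap (P p).average
      ((groupHomology.inhomogeneousChains.d (C.X p) 0).hom (Finsupp.single x a)) = 0
    have := groupHomology.inhomogeneousChains.d_single (A := C.X p) 0 x a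
    rw [this, Fin.sum_univ_one, map_add, map_smul]
    simp [GroupPartition.average_rho, Subsingleton.elim _ (default : Fin 0 → G)]
  succ p q := by
    rw [barBicomplex_vert, barBicomplex_vert]
    exact ModuleCat.hom_ext (LinearMap.ext fun x => (P p).contraction_succ q x)

/-- A linear map on the coefficients, as a map on the bar chains of degree zero. -/
def barZero {A : Rep.{0} ℝ G} {M : ModuleCat.{0} ℝ} (f : A →ₗ[ℝ] M) :
    (groupHomology.inhomogeneousChains A).X 0 ⟶ M :=
  ModuleCat.ofHom (Finsupp.lsum ℝ fun _ : Fin 0 → G => f)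

theorem barZero_single {A : Rep.{0} ℝ G} {M : ModuleCat.{0} ℝ} (f : A →ₗ[ℝ] M) (x : Fin 0 → G)
    (a : A) : (barZero f).hom (Finsupp.single x a) = f a :=
  (Finsupp.lsum_single ..)

theorem exists_single_default_eq {ι A : Type} [AddCommMonoid A]
    (x : (Fin 0 → ι) →₀ A) :
    ∃ a, x = Finsupp.single default a :=
  ⟨x default, Finsupp.unique_single x⟩

theorem d_barZero {A : Rep.{0} ℝ G} {M : ModuleCat.{0} ℝ} (f : A →ₗ[ℝ] M)
    (hf : ∀ g a, f (A.ρ g a) = f a) :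
    (groupHomology.inhomogeneousChains A).d 1 0 ≫ barZero f = 0 := by
  rw [groupHomology.inhomogeneousChains.d_def]
  refine groupHomology.inhomogeneousChains.ext fun x => ModuleCat.hom_ext (LinearMap.ext fun a => ?_)
  change (barZero f).hom ((groupHomology.inhomogeneousChains.d A 0).hom (Finsupp.single x a)) = 0
  have := groupHomology.inhomogeneousChains.d_single (A := A) 0 x a
  rw [this, Fin.sum_univ_one, map_add, map_smul, barZero_single, barZero_single, hf]
  simp

theorem barZero_surjective {A : Rep.{0} ℝ G} {M : ModuleCat.{0} ℝ} {f : A →ₗ[ℝ] M}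
    (hf : Function.Surjective f) : Function.Surjective (barZero f).hom := fun y => by
  obtain ⟨a, rfl⟩ := hf y
  exact ⟨Finsupp.single default a, barZero_single f _ a⟩

theorem barContraction_proj_eq_zero (P : ∀ p, GroupPartition (C.X p).ρ) {n : ℕ}
    {M : ModuleCat.{0} ℝ} {f : C.X n →ₗ[ℝ] M}
    (hker : ∀ a, f a = 0 → (P n).average a = 0) (x : ((barBicomplex C).X n).X 0)
    (hx : (barZero f).hom x = 0) : ((barContraction P).proj n).hom x = 0 := by
  obtain ⟨a, rfl⟩ := exists_single_default_eq (A := C.X n) x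
  have h := hker a ((barZero_single f _ a).symm.trans hx)
  change Finsupp.mapRange.linearMap (P n).average (Finsupp.single default a) = 0
  simp [h]

theorem barBicomplex_comm {n m : ℕ} {M N : ModuleCat.{0} ℝ} {f : C.X m →ₗ[ℝ] M}
    {f' : C.X n →ₗ[ℝ] N} {d : N ⟶ M} (h : ∀ a, f ((C.d n m).hom a) = d.hom (f' a)) :
    ((barBicomplex C).d n m).f 0 ≫ barZero f = barZero f' ≫ d := by
  refine groupHomology.inhomogeneousChains.ext fun x => ModuleCat.hom_ext (LinearMap.ext fun a => ?_)
  change (barZero f).hom (((groupHomology.chainsMap (MonoidHom.id G) (C.d n m)).f 0).hom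
    (Finsupp.single x a)) = d.hom ((barZero f').hom (Finsupp.single x a))
  have h1 := groupHomology.chainsMap_f_single (MonoidHom.id G) (C.d n m) 0 x a
  rw [barZero_single, ← h]
  refine (congrArg _ h1).trans (barZero_single f _ _)

/-- If every term of `C` has a partition of unity, the hyperhomology is the homology of any
complex `D` which agrees with the coinvariants of `C`. -/
theorem nonempty_hyperHomology_equiv (P : ∀ p, GroupPartition (C.X p).ρ)
    (D : ChainComplex (ModuleCat.{0} ℝ) ℕ) (n k : ℕ)
    (f₀ : C.X n →ₗ[ℝ] D.X k) (f₁ : C.X (n + 1) →ₗ[ℝ] D.X (k + 1))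
    (f₂ : C.X (n + 2) →ₗ[ℝ] D.X (k + 2))
    (hf₀ : ∀ g a, f₀ ((C.X n).ρ g a) = f₀ a) (hf₁ : ∀ g a, f₁ ((C.X (n + 1)).ρ g a) = f₁ a)
    (hker₀ : ∀ a, f₀ a = 0 → (P n).average a = 0)
    (hker₁ : ∀ a, f₁ a = 0 → (P (n + 1)).average a = 0)
    (hcomm₀ : ∀ a, f₀ ((C.d (n + 1) n).hom a) = (D.d (k + 1) k).hom (f₁ a))
    (hcomm₁ : ∀ a, f₁ ((C.d (n + 2) (n + 1)).hom a) = (D.d (k + 2) (k + 1)).hom (f₂ a))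
    (hsurj₁ : Function.Surjective f₁) (hsurj₂ : Function.Surjective f₂) :
    Nonempty (hyperHomology C (n + 1) ≃ₗ[ℝ] D.homology (k + 1)) :=
  (barContraction P).nonempty_homology_equiv D n k (barZero f₀) (barZero f₁) (barZero f₂)
    (d_barZero f₀ hf₀) (d_barZero f₁ hf₁)
    (barContraction_proj_eq_zero P hker₀) (barContraction_proj_eq_zero P hker₁)
    (barBicomplex_comm hcomm₀) (barBicomplex_comm hcomm₁) (barZero_surjective hsurj₁)
    (barZero_surjective hsurj₂)

theorem subsingleton_tot {m : ℕ} (h : ∀ p ≤ m, Subsingleton (C.X p)) :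
    Subsingleton ((barBicomplex C).tot.X m) := by
  have : 𝟙 ((barBicomplex C).tot.X m) = 0 := by
    refine HomologicalComplex₂.total.hom_ext _ fun p q (hpq : p + q = m) =>
      ModuleCat.hom_ext (LinearMap.ext fun x => ?_)
    have := h p (by omega)
    have hs : Subsingleton ((Fin q → G) →₀ C.X p) := inferInstance
    rw [show x = 0 from hs.elim x 0, map_zero, map_zero]
  refine ⟨fun a b => ?_⟩
  have key : ∀ a : (barBicomplex C).tot.X m, a = 0 := fun a => congrArg (fun f => f.hom a) this
  rw [key a, key b]

/-- The lowest degree in which `C` is nonzero. -/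
theorem nonempty_hyperHomology_equiv_of_lowest (P : ∀ p, GroupPartition (C.X p).ρ)
    (D : ChainComplex (ModuleCat.{0} ℝ) ℕ) (n k : ℕ)
    (f₁ : C.X n →ₗ[ℝ] D.X k) (f₂ : C.X (n + 1) →ₗ[ℝ] D.X (k + 1))
    (hlow : ∀ p < n, Subsingleton (C.X p)) (hD : ∀ m, D.d k m = 0)
    (hf₁ : ∀ g a, f₁ ((C.X n).ρ g a) = f₁ a)
    (hker₁ : ∀ a, f₁ a = 0 → (P n).average a = 0)
    (hcomm₁ : ∀ a, f₁ ((C.d (n + 1) n).hom a) = (D.d (k + 1) k).hom (f₂ a))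
    (hsurj₁ : Function.Surjective f₁) (hsurj₂ : Function.Surjective f₂) :
    Nonempty (hyperHomology C n ≃ₗ[ℝ] D.homology k) := by
  refine (barContraction P).nonempty_homology_equiv_of_lift D n k (barZero f₁) (barZero f₂)
    (d_barZero f₁ hf₁) (barContraction_proj_eq_zero P hker₁)
    (barBicomplex_comm hcomm₁) (barZero_surjective hsurj₂) (fun x _ m => by rw [hD]; rfl) ?_
  intro y _
  obtain ⟨a, rfl⟩ := barZero_surjective hsurj₁ y
  refine ⟨((barBicomplex C).incl n 0 n rfl).hom a, fun m => ?_, ?_⟩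
  -- The columns of index less than n vanish, so the total complex is zero in degree n - 1 and every
  -- bottom element of degree n is a cycle.
  · by_cases hm : (ComplexShape.down ℕ).Rel n m
    · have hm' : m + 1 = n := hm
      have := subsingleton_tot (C := C) (m := m) fun p hp => hlow p (by omega)
      exact Subsingleton.elim _ _
    · rw [HomologicalComplex.shape _ _ _ hm]; rfl
  · exact congrArg (barZero f₁).hom (congrArg (fun g => g.hom a)
      (HomologicalComplex₂.incl_bottom_zero (K := barBicomplex C) n))

theorem subsingleton_hyperHomology {n : ℕ} (h : ∀ p ≤ n, Subsingleton (C.X p)) :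
    Subsingleton (hyperHomology C n) := by
  have := subsingleton_tot h
  have h0 : Limits.IsZero ((barBicomplex C).tot.X n) := ModuleCat.isZero_of_subsingleton _
  have : Limits.IsZero ((barBicomplex C).tot.homology n) :=
    ShortComplex.isZero_homology_of_isZero_X₂ _ h0
  exact ModuleCat.subsingleton_of_isZero this

end HyperHomology

/-! ### Exponent sums in free groups -/

namespace FreeGroup

variable {ι κ : Type}

/-- The vector of exponent sums of an element of a free group. -/
def expSum (x : FreeGroup ι) : ι →₀ ℝ :=
  Multiplicative.toAdd (FreeGroup.lift (fun i => Multiplicative.ofAdd (Finsupp.single i (1 : ℝ))) x)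

@[simp] theorem expSum_one : expSum (1 : FreeGroup ι) = 0 := by simp [expSum]

@[simp] theorem expSum_mul (x y : FreeGroup ι) : expSum (x * y) = expSum x + expSum y := by
  simp [expSum]

@[simp] theorem expSum_inv (x : FreeGroup ι) : expSum x⁻¹ = - expSum x := by
  simp [expSum]

@[simp] theorem expSum_zpow (x : FreeGroup ι) (n : ℤ) : expSum (x ^ n) = (n : ℝ) • expSum x := by
  simp [expSum, Int.cast_smul_eq_zsmul]

@[simp] theorem expSum_of (i : ι) : expSum (of i) = Finsupp.single i 1 := by
  simp [expSum]

/-- A homomorphism to a real vector space is determined by its values on the generators, so it sees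
only exponent sums. This converts markings and automorphisms into matrices. -/
theorem map_eq_linearCombination {V : Type*} [AddCommGroup V] [Module ℝ V]
    (h : FreeGroup ι →* Multiplicative V) (x : FreeGroup ι) :
    (h x).toAdd = Finsupp.linearCombination ℝ (fun i => (h (of i)).toAdd) (expSum x) := by
  induction x using FreeGroup.induction_on with
  | C1 => simp
  | of i => simp
  | inv_of i _ => simp
  | mul x y hx hy => simp [hx, hy]

/-- Exponent sums as a homomorphism. -/
def expSumHom (ι : Type) : FreeGroup ι →* Multiplicative (ι →₀ ℝ) where
  toFun x := Multiplicative.ofAdd (expSum x)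
  map_one' := by simp
  map_mul' := by simp

theorem expSum_map (f : FreeGroup ι →* FreeGroup κ) (x : FreeGroup ι) :
    expSum (f x) = Finsupp.linearCombination ℝ (fun i => expSum (f (of i))) (expSum x) :=
  map_eq_linearCombination ((expSumHom κ).comp f) x

end FreeGroup

/-! ### Cycles and edge paths -/

namespace FinGraph

open FreeGroup (expSum)

variable {k m k' m' k'' m'' : ℕ}

/-- The value on the potential `φ` of the boundary of the 1-chain `z`. -/
def pair (X : FinGraph k m) (z : Fin m → ℝ) (φ : Fin k → ℝ) : ℝ :=
  ∑ e, z e * (φ (X.root e 1) - φ (X.root e (-1)))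

/-- A 1-cycle: a chain with zero boundary. -/
def IsCycle (X : FinGraph k m) (z : Fin m → ℝ) : Prop := ∀ φ, X.pair z φ = 0

theorem pair_add_left (X : FinGraph k m) (z w : Fin m → ℝ) (φ : Fin k → ℝ) :
    X.pair (z + w) φ = X.pair z φ + X.pair w φ := by
  simp [pair, add_mul, Finset.sum_add_distrib]

theorem pair_sub_left (X : FinGraph k m) (z w : Fin m → ℝ) (φ : Fin k → ℝ) :
    X.pair (z - w) φ = X.pair z φ - X.pair w φ := by
  simp [pair, sub_mul, Finset.sum_sub_distrib]

theorem pair_smul_left (X : FinGraph k m) (c : ℝ) (z : Fin m → ℝ) (φ : Fin k → ℝ) :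
    X.pair (c • z) φ = c * X.pair z φ := by
  simp [pair, mul_assoc, Finset.mul_sum]

theorem pair_sum_left {ι : Type*} (s : Finset ι) (X : FinGraph k m) (z : ι → Fin m → ℝ)
    (φ : Fin k → ℝ) : X.pair (∑ i ∈ s, z i) φ = ∑ i ∈ s, X.pair (z i) φ := by
  simp [pair, Finset.sum_mul]
  rw [Finset.sum_comm]

theorem pair_single (X : FinGraph k m) (e : Fin m) (φ : Fin k → ℝ) :
    X.pair (Pi.single e 1) φ = φ (X.root e 1) - φ (X.root e (-1)) := by
  simp [pair, Pi.single_apply]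

theorem pair_eq_sum (X : FinGraph k m) (z : Fin m → ℝ) (φ : Fin k → ℝ) :
    X.pair z φ = ∑ v, φ v * ∑ e, z e * ((if X.root e 1 = v then 1 else 0) -
      (if X.root e (-1) = v then 1 else 0)) := by
  simp only [pair, Finset.mul_sum]
  rw [Finset.sum_comm]
  refine Finset.sum_congr rfl fun e _ => ?_
  simp only [mul_sub, Finset.sum_sub_distrib]
  simp [mul_comm]

theorem isCycle_iff (X : FinGraph k m) (z : Fin m → ℝ) : X.IsCycle z ↔
    ∀ v, ∑ e, z e * ((if X.root e 1 = v then 1 else 0) -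
      (if X.root e (-1) = v then 1 else 0)) = 0 := by
  constructor
  · intro h v
    have := h (Pi.single v 1)
    rw [pair_eq_sum] at this
    simpa [Pi.single_apply] using this
  · intro h φ
    simp [pair_eq_sum, h]

theorem hasCycle_iff (X : FinGraph k m) (T : Set (Fin m)) :
    X.HasCycle T ↔ ∃ z, z ≠ 0 ∧ (∀ e ∉ T, z e = 0) ∧ X.IsCycle z := by
  simp only [isCycle_iff]; rfl

theorem pair_units (X : FinGraph k m) (e : Fin m) (s : ℤˣ) (φ : Fin k → ℝ) :
    ((s : ℤ) : ℝ) * (φ (X.root e 1) - φ (X.root e (-1))) = φ (X.root e s) - φ (X.root e (-s)) := by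
  rcases Int.units_eq_one_or s with rfl | rfl <;> simp

/-- The differences of the potential telescope along the path. In particular closed paths have
cycles as exponent vectors. -/
theorem IsPath.pair {X : FinGraph k m} {u v : Fin k} {x : FreeGroup (Fin m)} (h : X.IsPath u v x)
    (φ : Fin k → ℝ) : X.pair (expSum x) φ = φ v - φ u := by
  induction h with
  | nil => simp [FinGraph.pair]
  | @step x e s h ih =>
    have : (⇑(expSum (x * FreeGroup.of e ^ (s : ℤ))) : Fin m → ℝ) =
        ⇑(expSum x) + ((s : ℤ) : ℝ) • (Pi.single e 1 : Fin m → ℝ) := by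
      ext f
      simp [Finsupp.single_apply, Pi.single_apply, eq_comm]
    rw [this, pair_add_left, ih, pair_smul_left, pair_single, pair_units]
    ring

theorem Joined.exists_isPath {X : FinGraph k m} {T : Set (Fin m)} {u v : Fin k}
    (h : X.Joined T u v) : ∃ x ∈ Subgroup.closure (FreeGroup.of '' T), X.IsPath u v x := by
  induction h with
  | refl => exact ⟨1, one_mem _, IsPath.nil⟩
  | tail _ h ih =>
    obtain ⟨x, hx, hp⟩ := ih
    obtain ⟨e, he, s, rfl, rfl⟩ := h
    exact ⟨_, mul_mem hx (zpow_mem (Subgroup.subset_closure (Set.mem_image_of_mem _ he)) _), hp.step e s⟩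

/-! ### Forest collapses on edge paths and on cycles. -/

namespace ForestCollapse

variable {X : FinGraph k m} {Y : FinGraph k' m'} {Z : FinGraph k'' m''}

theorem map_of_edge (c : ForestCollapse X Y) (f : Fin m') :
    c.map (FreeGroup.of (c.edge f)) = FreeGroup.of f ^ (c.sgn f : ℤ) := by
  simp only [map, FreeGroup.lift_apply_of]
  exact Function.Injective.extend_apply c.edge.injective _ _ f

theorem map_of_notMem (c : ForestCollapse X Y) {e : Fin m} (he : e ∉ Set.range c.edge) :
    c.map (FreeGroup.of e) = 1 := by
  simp only [map, FreeGroup.lift_apply_of]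
  exact Function.extend_apply' _ _ _ he

theorem onV_eq (c : ForestCollapse X Y) {e : Fin m} (he : e ∉ Set.range c.edge) (s : ℤˣ) :
    c.onV (X.root e (-s)) = c.onV (X.root e s) :=
  (c.fiber _ _).2 (Relation.ReflTransGen.single ⟨e, he, s, rfl, rfl⟩)

theorem onV_root (c : ForestCollapse X Y) (f : Fin m') (s : ℤˣ) :
    c.onV (X.root (c.edge f) s) = Y.root f (c.sgn f * s) :=
  (c.root_eq f s).symm

theorem isPath_map (c : ForestCollapse X Y) {u v : Fin k} {x : FreeGroup (Fin m)}
    (h : X.IsPath u v x) : Y.IsPath (c.onV u) (c.onV v) (c.map x) := by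
  induction h with
  | nil => rw [map_one]; exact IsPath.nil
  | @step x e s h ih =>
    rw [map_mul, map_zpow]
    by_cases he : e ∈ Set.range c.edge
    · obtain ⟨f, rfl⟩ := he
      rw [map_of_edge, ← zpow_mul, onV_root, ← Units.val_mul]
      rw [onV_root, mul_neg] at ih
      exact ih.step f _
    · rw [map_of_notMem c he, one_zpow, mul_one, ← c.onV_eq he]
      exact ih

/-- The two vertices are joined inside the collapsed forest, all of whose edges map to 1. -/
theorem exists_isPath_of_onV_eq (c : ForestCollapse X Y) {u v : Fin k} (h : c.onV u = c.onV v) :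
    ∃ x, X.IsPath u v x ∧ c.map x = 1 := by
  obtain ⟨x, hx, hp⟩ := ((c.fiber u v).1 h).exists_isPath
  refine ⟨x, hp, ?_⟩
  have : Subgroup.closure (FreeGroup.of '' (Set.range c.edge)ᶜ) ≤ c.map.ker := by
    rw [Subgroup.closure_le]
    rintro _ ⟨e, he, rfl⟩
    exact c.map_of_notMem he
  exact this hx

/-- Edge paths can be lifted along a forest collapse. -/
theorem exists_lift (c : ForestCollapse X Y) (u : Fin k) {w : Fin k'} {y : FreeGroup (Fin m')}
    (h : Y.IsPath (c.onV u) w y) (v : Fin k) (hv : c.onV v = w) :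
    ∃ x, X.IsPath u v x ∧ c.map x = y := by
  induction h generalizing v with
  | nil => exact c.exists_isPath_of_onV_eq hv.symm
  | @step y f s h ih =>
    obtain ⟨x, hx, rfl⟩ := ih (X.root (c.edge f) (-(c.sgn f * s))) (by
      rw [onV_root, mul_neg, ← mul_assoc, Int.units_mul_self, one_mul])
    have h1 := hx.step (c.edge f) (c.sgn f * s)
    -- After crossing the lifted edge, a path in the collapsed forest leads to the prescribed
    -- endpoint v.
    obtain ⟨x', hx', h'⟩ := c.exists_isPath_of_onV_eq
      (u := X.root (c.edge f) (c.sgn f * s)) (v := v) (by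
        rw [onV_root, ← mul_assoc, Int.units_mul_self, one_mul, hv])
    refine ⟨_, h1.trans hx', ?_⟩
    rw [map_mul, map_mul, map_zpow, map_of_edge, h', mul_one, ← zpow_mul, ← Units.val_mul,
      ← mul_assoc, Int.units_mul_self, one_mul]

theorem expSum_map_apply (c : ForestCollapse X Y) (x : FreeGroup (Fin m)) (f : Fin m') :
    expSum (c.map x) f = ((c.sgn f : ℤ) : ℝ) * expSum x (c.edge f) := by
  induction x using FreeGroup.induction_on with
  | C1 => simp
  | mul x y hx hy => simp [hx, hy, mul_add]
  | inv_of i h => simpa using h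
  | of e =>
    by_cases he : e ∈ Set.range c.edge
    · obtain ⟨f', rfl⟩ := he
      rw [map_of_edge]
      by_cases hf : f' = f
      · subst hf; simp
      · simp [hf]
    · rw [map_of_notMem c he]
      have : e ≠ c.edge f := fun h => he ⟨f, h.symm⟩
      simp [this]

/-- The image of a 1-chain. -/
def push (c : ForestCollapse X Y) (z : Fin m → ℝ) (f : Fin m') : ℝ :=
  ((c.sgn f : ℤ) : ℝ) * z (c.edge f)

theorem sum_edge (c : ForestCollapse X Y) (g : Fin m → ℝ) (hg : ∀ e ∉ Set.range c.edge, g e = 0) :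
    ∑ e, g e = ∑ f, g (c.edge f) := by
  rw [← Finset.sum_map Finset.univ c.edge g]
  refine (Finset.sum_subset (Finset.subset_univ _) fun e _ he => hg e ?_).symm
  simpa using he

theorem pair_push (c : ForestCollapse X Y) (z : Fin m → ℝ) (ψ : Fin k' → ℝ) :
    Y.pair (c.push z) ψ = X.pair z (ψ ∘ c.onV) := by
  rw [pair, pair, c.sum_edge]
  · refine Finset.sum_congr rfl fun f _ => ?_
    have := pair_units Y f (c.sgn f) ψ
    simp only [push, Function.comp, onV_root, mul_neg, mul_one]
    rw [← this]; ring
  · intro e he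
    simp [c.onV_eq he 1]

/-- A cycle with zero image would be supported on the collapsed edges, and a forest carries no
cycle. -/
theorem push_ne_zero (c : ForestCollapse X Y) {z : Fin m → ℝ} (hz : z ≠ 0) (h : X.IsCycle z) :
    c.push z ≠ 0 := by
  intro h0
  refine c.forest ((hasCycle_iff _ _).2 ⟨z, hz, fun e he => ?_, h⟩)
  obtain ⟨f, rfl⟩ := not_not.1 he
  have := congrFun h0 f
  simpa [push] using this

/-- Every cycle lifts to a cycle. -/
theorem exists_push_eq (c : ForestCollapse X Y) {z : Fin m' → ℝ} (h : Y.IsCycle z) :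
    ∃ w, X.IsCycle w ∧ c.push w = z := by
  classical
  let bd : (Fin m → ℝ) →ₗ[ℝ] Module.Dual ℝ (Fin k → ℝ) := LinearMap.mk₂ ℝ X.pair
    (fun _ _ _ => pair_add_left ..) (fun _ _ _ => pair_smul_left ..)
    (fun z φ ψ => by simp [pair, ← Finset.sum_add_distrib]; refine Finset.sum_congr rfl fun _ _ => ?_; ring)
    (fun t z φ => by simp [pair, Finset.mul_sum]; refine Finset.sum_congr rfl fun _ _ => ?_; ring)
  -- Extension of z by zero. Its boundary has to be cancelled by a chain supported on the collapsed
  -- edges, that is, by an element of U.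
  let w₀ : Fin m → ℝ := Function.extend c.edge (fun f => ((c.sgn f : ℤ) : ℝ) * z f) 0
  have hw₀ : c.push w₀ = z := by
    ext f
    simp only [push, w₀, c.edge.injective.extend_apply]
    rcases Int.units_eq_one_or (c.sgn f) with h | h <;> simp [h]
  let U : Submodule ℝ (Fin m → ℝ) :=
    { carrier := {w | ∀ f, w (c.edge f) = 0}
      add_mem' := fun ha hb f => by simp [ha f, hb f]
      zero_mem' := fun f => rfl
      smul_mem' := fun t a ha f => by simp [ha f] }
  have hmem : bd w₀ ∈ U.map bd := by
    -- Otherwise a functional on boundaries, which is evaluation at a potential φ, vanishes on those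
    -- of U but not on that of w₀. Such a φ is constant along collapsed edges, so it comes from Y,
    -- where it pairs to 0 with the cycle z.
    by_contra hn
    obtain ⟨F, hF, hF'⟩ := Submodule.exists_le_ker_of_notMem hn
    obtain ⟨φ, rfl⟩ := (Module.evalEquiv ℝ (Fin k → ℝ)).surjective F
    have hφ : ∀ u v, X.Joined (Set.range c.edge)ᶜ u v → φ u = φ v := by
      intro u v huv
      induction huv with
      | refl => rfl
      | tail _ hs ih =>
        obtain ⟨e, he, s, rfl, rfl⟩ := hs
        rw [ih]
        have h1 : (Pi.single e 1 : Fin m → ℝ) ∈ U := fun f => by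
          rw [Pi.single_apply, if_neg fun h => he ⟨f, h⟩]
        have h2 : X.pair (Pi.single e 1) φ = 0 := hF' (Submodule.mem_map_of_mem h1)
        rw [pair_single] at h2
        have h3 := pair_units X e s φ
        rw [h2, mul_zero] at h3
        linarith
    obtain ⟨j, hj⟩ := c.surjective.hasRightInverse
    have hφ' : φ = (φ ∘ j) ∘ c.onV := funext fun v =>
      hφ _ _ ((c.fiber _ _).1 (hj (c.onV v)).symm)
    apply hF
    change X.pair w₀ φ = 0
    rw [hφ', ← c.pair_push, hw₀, h]
  obtain ⟨u, hu, hu'⟩ := hmem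
  refine ⟨w₀ - u, fun φ => ?_, ?_⟩
  · rw [pair_sub_left, sub_eq_zero]
    exact (congrArg (fun F => F φ) hu').symm
  · rw [← hw₀]
    ext f
    simp [push, hu f]

/-- Nonzero cycles push forward to nonzero cycles and every cycle lifts, with matching supports on
the edges that survive. This makes being at infinity independent of the representative and also
gives the forest condition for composites. -/
theorem hasCycle_iff (c : ForestCollapse X Y) (S : Set (Fin m')) :
    X.HasCycle (c.edge '' S)ᶜ ↔ Y.HasCycle Sᶜ := by
  rw [FinGraph.hasCycle_iff, FinGraph.hasCycle_iff]
  constructor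
  · rintro ⟨z, hz, hS, h⟩
    refine ⟨c.push z, c.push_ne_zero hz h, fun f hf => ?_, fun ψ => ?_⟩
    · rw [push, hS, mul_zero]
      exact fun h => h ⟨f, not_not.1 hf, rfl⟩
    · rw [pair_push, h]
  · rintro ⟨z, hz, hS, h⟩
    obtain ⟨w, hw, rfl⟩ := c.exists_push_eq h
    refine ⟨w, ?_, fun e he => ?_, hw⟩
    · rintro rfl
      exact hz (by ext; simp [push])
    · obtain ⟨f, hf, rfl⟩ := not_not.1 he
      have := hS f (fun h => h hf)
      simpa [push] using this

/-- Forest collapses can be composed. -/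
def comp (c : ForestCollapse X Y) (d : ForestCollapse Y Z) : ForestCollapse X Z where
  onV := d.onV ∘ c.onV
  edge := d.edge.trans c.edge
  sgn f := d.sgn f * c.sgn (d.edge f)
  root_eq f s := by
    change _ = d.onV (c.onV (X.root (c.edge (d.edge f)) s))
    rw [onV_root, onV_root, mul_assoc]
  surjective := d.surjective.comp c.surjective
  fiber u v := by
    have mono : ∀ {u v}, X.Joined (Set.range c.edge)ᶜ u v →
        X.Joined (Set.range (d.edge.trans c.edge))ᶜ u v := by
      intro u v h
      refine Relation.ReflTransGen.mono (fun a b => ?_) u v h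
      rintro ⟨e, he, h⟩
      exact ⟨e, fun ⟨f, hf⟩ => he ⟨d.edge f, hf⟩, h⟩
    constructor
    · intro h
      have h' := (d.fiber _ _).1 h
      have : ∀ {a b}, Y.Joined (Set.range d.edge)ᶜ a b → ∀ u v, c.onV u = a → c.onV v = b →
          X.Joined (Set.range (d.edge.trans c.edge))ᶜ u v := by
        intro a b hab
        induction hab with
        | refl => intro u v hu hv; exact mono ((c.fiber u v).1 (hu.trans hv.symm))
        | tail _ h ih =>
          intro u v hu hv
          obtain ⟨f, hf, s, rfl, rfl⟩ := h
          have h1 := ih u (X.root (c.edge f) (c.sgn f * -s)) hu (by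
            rw [onV_root, ← mul_assoc, Int.units_mul_self, one_mul])
          refine (h1.tail ⟨c.edge f, ?_, c.sgn f * s, by rw [mul_neg], rfl⟩).trans
            (mono ((c.fiber _ _).1 ?_))
          · rintro ⟨g, hg⟩
            exact hf ⟨g, c.edge.injective hg⟩
          · rw [hv, onV_root, ← mul_assoc, Int.units_mul_self, one_mul]
      exact this h' u v rfl rfl
    · intro h
      induction h with
      | refl => rfl
      | tail _ h ih =>
        rw [ih]
        obtain ⟨e, he, s, rfl, rfl⟩ := h
        by_cases hc : e ∈ Set.range c.edge
        · obtain ⟨f, rfl⟩ := hc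
          have hf : f ∉ Set.range d.edge := fun ⟨g, hg⟩ => he ⟨g, congrArg c.edge hg⟩
          simp only [Function.comp, onV_root, mul_neg]
          exact d.onV_eq hf _
        · exact congrArg d.onV (c.onV_eq hc s)
  forest := by
    have : Set.range (d.edge.trans c.edge) = c.edge '' Set.range d.edge := by
      rw [← Set.range_comp]; rfl
    rw [this, c.hasCycle_iff]
    exact d.forest

theorem comp_map (c : ForestCollapse X Y) (d : ForestCollapse Y Z) (x : FreeGroup (Fin m)) :
    (c.comp d).map x = d.map (c.map x) := by
  have : (c.comp d).map = d.map.comp c.map := by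
    refine FreeGroup.ext_hom _ _ fun e => ?_
    rw [MonoidHom.comp_apply]
    by_cases hc : e ∈ Set.range c.edge
    · obtain ⟨f, rfl⟩ := hc
      rw [map_of_edge, map_zpow]
      by_cases hd : f ∈ Set.range d.edge
      · obtain ⟨g, rfl⟩ := hd
        rw [map_of_edge, ← zpow_mul, ← Units.val_mul]
        exact (c.comp d).map_of_edge g
      · rw [map_of_notMem d hd, one_zpow, map_of_notMem]
        rintro ⟨g, hg⟩
        exact hd ⟨g, c.edge.injective hg⟩
    · rw [map_of_notMem c hc, map_one, map_of_notMem]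
      rintro ⟨g, hg⟩
      exact hc ⟨d.edge g, hg⟩
  rw [this]; rfl

end ForestCollapse

end FinGraph

/-! ### Transitivity of the relation between marked simplices, and invariance of being at infinity.
-/

namespace MarkedSimplex

variable {r p : ℕ}

theorem Rel.trans {a b c : MarkedSimplex r p} (hab : Rel a b) (hbc : Rel b c) : Rel a c := by
  obtain ⟨d, h, γ, hγ, hm⟩ := hab
  obtain ⟨d', h', γ', hγ', hm'⟩ := hbc
  refine ⟨d.comp d', fun i => by rw [h, h']; rfl, d'.map γ * γ', (d'.isPath_map hγ).trans hγ', ?_⟩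
  intro x
  rw [hm', hm, FinGraph.ForestCollapse.comp_map]
  simp [mul_assoc]

theorem Rel.atInfinity_iff {a b : MarkedSimplex r p} (h : Rel a b) :
    a.AtInfinity ↔ b.AtInfinity := by
  obtain ⟨c, h, -⟩ := h
  rw [AtInfinity, AtInfinity, ← c.hasCycle_iff]
  have : (Set.range a.edges) = c.edge '' Set.range b.edges := by
    rw [← Set.range_comp]
    exact congrArg Set.range (funext h)
  rw [this]

end MarkedSimplex

namespace FinGraph

variable {k m k' m' : ℕ}

theorem joined_empty {X : FinGraph k m} {u v : Fin k} : X.Joined ∅ u v ↔ u = v := by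
  constructor
  · intro h
    induction h with
    | refl => rfl
    | tail _ h _ => obtain ⟨e, he, _⟩ := h; exact he.elim
  · rintro rfl; exact Relation.ReflTransGen.refl

theorem not_hasCycle_empty (X : FinGraph k m) : ¬ X.HasCycle ∅ := by
  rintro ⟨z, hz, h, -⟩
  exact hz (funext fun e => h e (Set.notMem_empty e))

/-- A bijective relabelling of a graph, as the collapse of the empty forest. -/
def ForestCollapse.ofBijective {X : FinGraph k m} {Y : FinGraph k' m'} (onV : Fin k → Fin k')
    (hV : Function.Bijective onV) (edge : Fin m' ≃ Fin m) (sgn : Fin m' → ℤˣ)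
    (root_eq : ∀ f s, Y.root f (sgn f * s) = onV (X.root (edge f) s)) : ForestCollapse X Y where
  onV := onV
  edge := edge.toEmbedding
  sgn := sgn
  root_eq := root_eq
  surjective := hV.2
  fiber u v := by simp [joined_empty, hV.1.eq_iff]
  forest := by simp [not_hasCycle_empty]

end FinGraph

/-! ### Uniqueness of the complete collapse. -/

namespace MarkedSimplex

open FinGraph

variable {r p : ℕ}

/-- All edges of the graph belong to the simplex. -/
def IsFull (a : MarkedSimplex r p) : Prop := Function.Surjective a.edges

theorem Rel.refl (a : MarkedSimplex r p) : Rel a a :=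
  ⟨ForestCollapse.refl a.graph, fun _ => rfl, 1, IsPath.nil, fun x => by
    simp [ForestCollapse.refl_map]⟩

theorem Rel.range_edge {a z : MarkedSimplex r p} (hz : z.IsFull)
    {c : ForestCollapse a.graph z.graph} (h : ∀ i, a.edges i = c.edge (z.edges i)) :
    Set.range c.edge = Set.range a.edges := by
  rw [show (a.edges : Fin (p + 1) → Fin a.m) = c.edge ∘ z.edges from funext h,
    Set.range_comp, hz.range_eq, Set.image_univ]

/-- Any two complete collapses of a marked graph are isomorphic. -/
theorem Rel.of_isFull {a z z' : MarkedSimplex r p} (hz : z.IsFull) (hz' : z'.IsFull)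
    (h : Rel a z) (h' : Rel a z') : Rel z z' := by
  obtain ⟨c, hc, γ, hγ, hm⟩ := h
  obtain ⟨c', hc', γ', hγ', hm'⟩ := h'
  have hr := Rel.range_edge hz hc
  have hr' := Rel.range_edge hz' hc'
  let E := Equiv.ofBijective z.edges ⟨z.edges.injective, hz⟩
  let E' := Equiv.ofBijective z'.edges ⟨z'.edges.injective, hz'⟩
  let T := E'.symm.trans E
  have hT : ∀ f, c.edge (T f) = c'.edge f := by
    intro f
    obtain ⟨i, rfl⟩ := E'.surjective f
    simp only [T, Equiv.trans_apply, Equiv.symm_apply_apply]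
    exact (hc i).symm.trans (hc' i)
  obtain ⟨j, hj⟩ := c.surjective.hasRightInverse
  -- Both maps collapse the edges outside the list, so they identify the same vertices; choosing
  -- preimages under c therefore gives a well-defined bijection between the two targets.
  have hfib : ∀ u v, c.onV u = c.onV v ↔ c'.onV u = c'.onV v := by
    intro u v; rw [c.fiber, c'.fiber, hr, hr']
  have hV : ∀ u, c'.onV (j (c.onV u)) = c'.onV u := fun u => (hfib _ _).1 (hj _)
  let d : ForestCollapse z.graph z'.graph := ForestCollapse.ofBijective (c'.onV ∘ j)
    ⟨fun u v huv => by
        have := (hfib _ _).2 huv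
        rwa [hj, hj] at this,
      fun w => by
        obtain ⟨u, rfl⟩ := c'.surjective w
        exact ⟨c.onV u, hV u⟩⟩ T (fun f => c'.sgn f * c.sgn (T f)) (fun f s => by
      have h1 := c.onV_root (T f) (c.sgn (T f) * s)
      rw [← mul_assoc, Int.units_mul_self, one_mul] at h1
      rw [Function.comp, ← h1, hV, hT, c'.onV_root, mul_assoc])
  have hd : ∀ x, d.map (c.map x) = c'.map x := by
    have : d.map.comp c.map = c'.map := by
      refine FreeGroup.ext_hom _ _ fun e => ?_
      rw [MonoidHom.comp_apply]
      by_cases he : e ∈ Set.range c.edge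
      · obtain ⟨f, rfl⟩ := he
        obtain ⟨f, rfl⟩ := T.surjective f
        have h1 : d.map (FreeGroup.of (T f)) = _ := d.map_of_edge f
        rw [c.map_of_edge, map_zpow, h1, hT, c'.map_of_edge, ← zpow_mul, ← Units.val_mul]
        change FreeGroup.of f ^ ((c'.sgn f * c.sgn (T f) * c.sgn (T f) : ℤˣ) : ℤ) = _
        rw [mul_assoc, Int.units_mul_self, mul_one]
      · rw [c.map_of_notMem he, map_one, c'.map_of_notMem (by rwa [hr', ← hr])]
    intro x; rw [← this]; rfl
  refine ⟨d, fun i => ?_, (d.map γ)⁻¹ * γ', ?_, fun x => ?_⟩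
  · change E i = T (E' i)
    simp [T]
  · have h1 := (d.isPath_map hγ).symm
    have h2 : d.onV (c.onV a.base) = c'.onV a.base := hV _
    rw [h2] at h1
    exact h1.trans hγ'
  · rw [hm', hm, map_mul, map_mul, map_inv, hd]
    simp [mul_assoc]

end MarkedSimplex

/-! ### Contraction of an edge -/

namespace FinGraph

variable {k m : ℕ} {X : FinGraph (k + 2) (m + 1)} {e : Fin (m + 1)} {t : ℤˣ}
  {π : Equiv.Perm (Fin (k + 2))}

theorem Normalizes.predAbove_eq_iff (h : X.Normalizes e t π) {u v : Fin (k + 2)} :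
    Fin.predAbove (0 : Fin (k + 1)) (π u) = Fin.predAbove 0 (π v) ↔
      u = v ∨ (u = X.root e (-t) ∧ v = X.root e t) ∨ (u = X.root e t ∧ v = X.root e (-t)) := by
  have h0 : ∀ w, π w = 0 ↔ w = X.root e (-t) := fun w => by rw [← h.1, π.injective.eq_iff]
  have h1 : ∀ w, π w = 1 ↔ w = X.root e t := fun w => by rw [← h.2, π.injective.eq_iff]
  rw [predAbove_zero_eq_iff, π.injective.eq_iff, h0, h0, h1, h1]

theorem compl_range_succAbove (e : Fin (m + 1)) :
    (Set.range e.succAboveEmb)ᶜ = ({e} : Set (Fin (m + 1))) := by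
  simp

/-- The contraction of an edge which is not a loop. -/
def Normalizes.collapse (h : X.Normalizes e t π) : ForestCollapse X (X.contract e π) where
  onV u := Fin.predAbove 0 (π u)
  edge := e.succAboveEmb
  sgn := 1
  root_eq f s := by simp [contract]
  surjective v := ⟨π.symm v.succ, by simp⟩
  fiber u v := by
    rw [h.predAbove_eq_iff, compl_range_succAbove]
    constructor
    · rintro (rfl | ⟨rfl, rfl⟩ | ⟨rfl, rfl⟩)
      · exact Relation.ReflTransGen.refl
      · exact Relation.ReflTransGen.single ⟨e, rfl, t, rfl, rfl⟩
      · exact Relation.ReflTransGen.single ⟨e, rfl, -t, by rw [neg_neg], rfl⟩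
    · intro hj
      have : ∀ a b, X.Joined {e} a b → Fin.predAbove (0 : Fin (k + 1)) (π a) =
          Fin.predAbove 0 (π b) := by
        intro a b hab
        induction hab with
        | refl => rfl
        | tail _ hs ih =>
          rw [ih]
          obtain ⟨f, hf, s, rfl, rfl⟩ := hs
          obtain rfl : f = e := hf
          rw [h.predAbove_eq_iff]
          rcases Int.units_eq_one_or s with rfl | rfl <;>
            rcases Int.units_eq_one_or t with rfl | rfl <;> simp
      rw [← h.predAbove_eq_iff]
      exact this u v hj
  forest := by
    rw [compl_range_succAbove, hasCycle_iff]
    rintro ⟨z, hz, hz', hc⟩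
    have hs : z = z e • Pi.single e 1 := by
      ext f
      by_cases hf : f = e
      · subst hf; simp
      · simp [hf, hz' f hf]
    apply hz
    have h1 := hc (Pi.single (X.root e 1) 1)
    rw [hs, pair_smul_left, pair_single] at h1
    have h2 : X.root e (-1) ≠ X.root e 1 := h.not_isLoop
    rw [Pi.single_eq_same, Pi.single_eq_of_ne h2, sub_zero, mul_one] at h1
    rw [hs, h1, zero_smul]

/-- Label the endpoint `root e t` by e^t and all other vertices by 1, and let ψ' change each edge by
the labels at its ends. Then ψ' sends e to 1, so it factors through the contraction, while on closed
paths at v it is conjugation by the label of v, which is injective. -/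
theorem Normalizes.map_injective (h : X.Normalizes e t π) {v : Fin (k + 2)}
    {x : FreeGroup (Fin (m + 1))} (hx : X.IsPath v v x) (h1 : h.collapse.map x = 1) : x = 1 := by
  classical
  let l : Fin (k + 2) → FreeGroup (Fin (m + 1)) := fun w =>
    if w = X.root e t then FreeGroup.of e ^ (t : ℤ) else 1
  let ψ' : FreeGroup (Fin (m + 1)) →* FreeGroup (Fin (m + 1)) :=
    FreeGroup.lift fun f => l (X.root f (-1)) * FreeGroup.of f * (l (X.root f 1))⁻¹
  let ψ : FreeGroup (Fin m) →* FreeGroup (Fin (m + 1)) :=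
    FreeGroup.lift fun f => ψ' (FreeGroup.of (e.succAbove f))
  have hl : X.root e (-1) ≠ X.root e 1 := h.not_isLoop
  have hψ : ∀ x, ψ (h.collapse.map x) = ψ' x := by
    have : ψ.comp h.collapse.map = ψ' := by
      refine FreeGroup.ext_hom _ _ fun f => ?_
      rw [MonoidHom.comp_apply]
      by_cases hf : f = e
      · rw [h.collapse.map_of_notMem (by simp [Normalizes.collapse, hf]), map_one]
        subst hf
        simp only [ψ', FreeGroup.lift_apply_of, l]
        rcases Int.units_eq_one_or t with rfl | rfl
        · rw [if_neg hl]; simp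
        · rw [if_neg (Ne.symm hl)]; simp
      · obtain ⟨g, rfl⟩ := Fin.exists_succAbove_eq hf
        have := h.collapse.map_of_edge g
        change h.collapse.map (FreeGroup.of (e.succAbove g)) = FreeGroup.of g ^ (1 : ℤ) at this
        rw [this, zpow_one]
        simp [ψ]
    intro x; rw [← this]; rfl
  have hs : ∀ (f : Fin (m + 1)) (s : ℤˣ), ψ' (FreeGroup.of f ^ (s : ℤ)) =
      l (X.root f (-s)) * FreeGroup.of f ^ (s : ℤ) * (l (X.root f s))⁻¹ := by
    intro f s
    rcases Int.units_eq_one_or s with rfl | rfl <;> simp [ψ', mul_assoc]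
  have hp : ∀ {u v : Fin (k + 2)} {x}, X.IsPath u v x → ψ' x = l u * x * (l v)⁻¹ := by
    intro u v x hx
    induction hx with
    | nil => simp
    | step f s _ ih => rw [map_mul, ih, hs]; simp [mul_assoc]
  have h2 := hp hx
  rw [← hψ, h1, map_one, eq_mul_inv_iff_mul_eq, one_mul] at h2
  exact (mul_left_cancel ((mul_one _).trans h2)).symm

/-- The contraction of an edge induces an isomorphism of fundamental groups. -/
def Normalizes.fundamentalGroupEquiv (h : X.Normalizes e t π) (v : Fin (k + 2)) :
    X.fundamentalGroup v ≃* (X.contract e π).fundamentalGroup (Fin.predAbove 0 (π v)) :=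
  MulEquiv.ofBijective
    ((h.collapse.map.comp (X.fundamentalGroup v).subtype).codRestrict _
      fun x => h.collapse.isPath_map x.2) (by
    constructor
    · rw [injective_iff_map_eq_one]
      intro x hx
      exact Subtype.ext (h.map_injective x.2 (congrArg Subtype.val hx))
    · rintro ⟨y, hy⟩
      obtain ⟨x, hx, hxy⟩ := h.collapse.exists_lift v hy v rfl
      exact ⟨⟨x, hx⟩, Subtype.ext hxy⟩)

end FinGraph

/-! ### Existence of the complete collapse, and equality of simplices. -/

namespace MarkedSimplex

open FinGraph

variable {r p : ℕ}

/-- The marked simplex obtained by contraction of an edge outside of it. -/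
def contractEdge {k m : ℕ} {X : FinGraph (k + 2) (m + 1)} (hX : X.Admissible) (v : Fin (k + 2))
    (μ : FreeGroup (Fin r) ≃* X.fundamentalGroup v) {e : Fin (m + 1)} {t : ℤˣ}
    {π : Equiv.Perm (Fin (k + 2))} (h : X.Normalizes e t π) (f : Fin (p + 1) ↪ Fin m) :
    MarkedSimplex r p where
  k := k + 1
  m := m
  graph := X.contract e π
  admissible := hX.contract h
  base := Fin.predAbove 0 (π v)
  marking := μ.trans (h.fundamentalGroupEquiv v)
  edges := f

theorem rel_contractEdge {k m : ℕ} {X : FinGraph (k + 2) (m + 1)} (hX : X.Admissible)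
    (v : Fin (k + 2)) (μ : FreeGroup (Fin r) ≃* X.fundamentalGroup v) {e : Fin (m + 1)} {t : ℤˣ}
    {π : Equiv.Perm (Fin (k + 2))} (h : X.Normalizes e t π) (f : Fin (p + 1) ↪ Fin m) :
    Rel ⟨k + 2, m + 1, X, hX, v, μ, f.trans e.succAboveEmb⟩ (contractEdge hX v μ h f) :=
  ⟨h.collapse, fun _ => rfl, 1, IsPath.nil, fun x => by
    rw [inv_one, one_mul, mul_one]; rfl⟩

theorem _root_.FinGraph.hasCycle_of_isLoop {k m : ℕ} {X : FinGraph k m} {e : Fin m} (he : X.IsLoop e)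
    {T : Set (Fin m)} (heT : e ∈ T) : X.HasCycle T := by
  refine (FinGraph.hasCycle_iff _ _).2 ⟨Pi.single e 1, by simp, fun f hf => ?_, fun φ => ?_⟩
  · exact Pi.single_eq_of_ne (fun h => hf (by rwa [h])) _
  · rw [pair_single, show X.root e (-1) = X.root e 1 from he, sub_self]

/-- Away from infinity an edge outside the list cannot be a loop, so it can be contracted.
Contraction preserves not being at infinity and lowers the number of edges, hence the induction. -/
theorem exists_rel_isFull (a : MarkedSimplex r p) (ha : ¬ a.AtInfinity) :
    ∃ z : MarkedSimplex r p, z.IsFull ∧ Rel a z := by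
  obtain ⟨n, hn⟩ : ∃ n, a.m = n := ⟨_, rfl⟩
  induction n generalizing a with
  | zero => exact ((hn ▸ a.edges 0 : Fin 0)).elim0
  | succ n ih =>
    by_cases hs : Function.Surjective a.edges
    · exact ⟨a, hs, Rel.refl a⟩
    · obtain ⟨k, m, X, hX, v, μ, f⟩ := a
      obtain rfl : m = n + 1 := hn
      simp only [Function.Surjective, not_forall, not_exists] at hs
      obtain ⟨e, he⟩ := hs
      have hl : ¬ X.IsLoop e := fun hl => ha (hasCycle_of_isLoop hl (by simpa using he))
      -- An edge which is not a loop has two distinct endpoints.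
      obtain ⟨k, rfl⟩ : ∃ l, k = l + 2 := by
        refine ⟨k - 2, ?_⟩
        have h1 := (X.root e 1).isLt
        have h2 := (X.root e (-1)).isLt
        have h3 : (X.root e (-1) : ℕ) ≠ X.root e 1 := fun h => hl (Fin.ext h)
        omega
      have hN := normalizes_normalizer hl
      choose g hg using fun i => Fin.exists_succAbove_eq (he i)
      obtain ⟨g', rfl⟩ : ∃ g' : Fin (p + 1) ↪ Fin n, f = g'.trans e.succAboveEmb :=
        ⟨⟨g, fun i j hij => f.injective (by rw [← hg, ← hg, hij])⟩, by
          ext i : 1; exact (hg i).symm⟩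
      have hrel := rel_contractEdge hX v μ hN g'
      obtain ⟨z, hz, hz'⟩ := ih (contractEdge hX v μ hN g')
        (fun h => ha (hrel.atInfinity_iff.2 h)) rfl
      exact ⟨z, hz, hrel.trans hz'⟩

theorem IsFull.not_atInfinity {z : MarkedSimplex r p} (hz : z.IsFull) : ¬ z.AtInfinity := by
  rw [AtInfinity, hz.range_eq, Set.compl_univ]
  exact not_hasCycle_empty _

/-- Marked simplices with the same complete collapse represent the same simplex. -/
theorem mk_eq_mk_iff_of_isFull {z z' : MarkedSimplex r p} (hz : z.IsFull) (hz' : z'.IsFull) :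
    (Quot.mk Rel z : OrderedSimplex r p) = Quot.mk Rel z' ↔ Rel z z' := by
  refine ⟨fun h => ?_, fun h => Quot.sound h⟩
  -- `Rel` is not symmetric, so equality of classes is a zigzag of collapses. The invariant carried
  -- along the zigzag is a common complete collapse, unless both ends are at infinity; transitivity
  -- is where uniqueness of complete collapses is used.
  have key : ∀ a b : MarkedSimplex r p, Relation.EqvGen Rel a b → (a.AtInfinity ∧ b.AtInfinity) ∨
      ∃ w : MarkedSimplex r p, w.IsFull ∧ Rel a w ∧ Rel b w := by
    intro a b hab
    induction hab with
    | rel a b h =>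
      by_cases ha : a.AtInfinity
      · exact Or.inl ⟨ha, h.atInfinity_iff.1 ha⟩
      · obtain ⟨w, hw, hbw⟩ := b.exists_rel_isFull (fun hb => ha (h.atInfinity_iff.2 hb))
        exact Or.inr ⟨w, hw, h.trans hbw, hbw⟩
    | refl a =>
      by_cases ha : a.AtInfinity
      · exact Or.inl ⟨ha, ha⟩
      · obtain ⟨w, hw, haw⟩ := a.exists_rel_isFull ha
        exact Or.inr ⟨w, hw, haw, haw⟩
    | symm a b _ ih =>
      rcases ih with h | ⟨w, hw, h1, h2⟩
      · exact Or.inl h.symm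
      · exact Or.inr ⟨w, hw, h2, h1⟩
    | trans a b c _ _ ih ih' =>
      rcases ih with h | ⟨w, hw, h1, h2⟩ <;> rcases ih' with h' | ⟨w', hw', h1', h2'⟩
      · exact Or.inl ⟨h.1, h'.2⟩
      · exact absurd (h1'.atInfinity_iff.1 h.2) hw'.not_atInfinity
      · exact absurd (h2.atInfinity_iff.1 h'.1) hw.not_atInfinity
      · exact Or.inr ⟨w', hw', h1.trans (Rel.of_isFull hw hw' h2 h1'), h2'⟩
  rcases key z z' (Quot.eqvGen_exact h) with h | ⟨w, hw, h1, h2⟩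
  · exact absurd h.1 hz.not_atInfinity
  · exact h1.trans (Rel.of_isFull hw hz' h2 (Rel.refl z'))

end MarkedSimplex

/-! ### The cycle space of a graph and its fundamental group -/

namespace FinGraph

open FreeGroup (expSum)

variable {k m r : ℕ}

/-- `N v` is a 1-chain whose boundary is `v` minus a fixed 0-chain. -/
def IsSplitting (X : FinGraph k m) (N : Fin k → Fin m → ℝ) : Prop :=
  ∀ v w φ, X.pair (N v - N w) φ = φ v - φ w

/-- A basis of the space of 1-cycles. -/
structure IsCycleBasis (X : FinGraph k m) {ι : Type} (B : ι → Fin m → ℝ) : Prop where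
  isCycle : ∀ i, X.IsCycle (B i)
  linearIndependent : LinearIndependent ℝ B
  mem_span : ∀ z, X.IsCycle z → z ∈ Submodule.span ℝ (Set.range B)

theorem Connected.exists_isPath {X : FinGraph k m} (hX : X.Connected) (u v : Fin k) :
    ∃ x, X.IsPath u v x := by
  obtain ⟨x, -, hx⟩ := (hX.2 u v).exists_isPath
  exact ⟨x, hx⟩

theorem Connected.exists_isSplitting {X : FinGraph k m} (hX : X.Connected) :
    ∃ N, X.IsSplitting N := by
  choose P hP using hX.exists_isPath ⟨0, hX.1⟩
  refine ⟨fun v => expSum (P v), fun v w φ => ?_⟩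
  rw [pair_sub_left, (hP v).pair, (hP w).pair]
  ring

/-- The cycles represented by a basis of the fundamental group. -/
def markedCycles (X : FinGraph k m) {v : Fin k} {ι : Type}
    (μ : FreeGroup ι ≃* X.fundamentalGroup v) (i : ι) : Fin m → ℝ :=
  expSum (μ (FreeGroup.of i) : FreeGroup (Fin m))

/-- This is H_1(X; ℝ) = π_1(X)^ab ⊗ ℝ. For independence, closing every edge to a loop at v by chosen
paths defines `R`, which on closed paths at v is conjugation by `P v`; composed with the inverse
marking and exponent sums it induces a linear map taking the i-th cycle to the i-th unit vector. -/
theorem isCycleBasis_markedCycles {X : FinGraph k m} (hX : X.Connected) {v : Fin k} {ι : Type}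
    (μ : FreeGroup ι ≃* X.fundamentalGroup v) : X.IsCycleBasis (X.markedCycles μ) := by
  choose P hP using hX.exists_isPath v
  have hloop : ∀ e, P (X.root e (-1)) * FreeGroup.of e * (P (X.root e 1))⁻¹ ∈
      X.fundamentalGroup v := fun e => by
    have := (hP (X.root e (-1))).step e 1
    rw [Units.val_one, zpow_one] at this
    exact this.trans (hP _).symm
  refine ⟨fun i φ => ?_, ?_, fun z hz => ?_⟩
  · rw [markedCycles, IsPath.pair (μ (FreeGroup.of i)).2, sub_self]
  · let R : FreeGroup (Fin m) →* X.fundamentalGroup v := FreeGroup.lift fun e => ⟨_, hloop e⟩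
    have hR : ∀ {a b x}, X.IsPath a b x → (R x : FreeGroup (Fin m)) = P a * x * (P b)⁻¹ := by
      intro a b x h
      induction h with
      | nil => simp
      | @step x e s _ ih =>
        rw [map_mul, Subgroup.coe_mul, ih]
        rcases Int.units_eq_one_or s with rfl | rfl <;> simp [R, mul_assoc]
    let h : FreeGroup (Fin m) →* Multiplicative (ι →₀ ℝ) :=
      (FreeGroup.expSumHom ι).comp (μ.symm.toMonoidHom.comp R)
    let Λ := Finsupp.linearCombination ℝ (fun e => (h (FreeGroup.of e)).toAdd)
    have hΛ : ∀ i, Λ (expSum (μ (FreeGroup.of i) : FreeGroup (Fin m))) = Finsupp.single i 1 := by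
      intro i
      rw [← FreeGroup.map_eq_linearCombination h]
      have h1 : R (μ (FreeGroup.of i)) =
          ⟨P v, hP v⟩ * μ (FreeGroup.of i) * (⟨P v, hP v⟩ : X.fundamentalGroup v)⁻¹ :=
        Subtype.ext (hR (μ (FreeGroup.of i)).2)
      change expSum (μ.symm (R (μ (FreeGroup.of i)))) = _
      rw [h1]
      simp
    have h1 : LinearIndependent ℝ fun i => expSum (μ (FreeGroup.of i) : FreeGroup (Fin m)) := by
      refine LinearIndependent.of_comp Λ ?_
      have : (Λ ∘ fun i => expSum (μ (FreeGroup.of i) : FreeGroup (Fin m))) =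
          fun i => Finsupp.single i 1 := funext hΛ
      rw [this]
      exact Finsupp.linearIndependent_single_one ℝ ι
    exact h1.map' (Finsupp.lcoeFun : (Fin m →₀ ℝ) →ₗ[ℝ] _)
      (LinearMap.ker_eq_bot.2 DFunLike.coe_injective)
  · have hmem : ∀ x ∈ X.fundamentalGroup v, (⇑(expSum x) : Fin m → ℝ) ∈
        Submodule.span ℝ (Set.range (X.markedCycles μ)) := by
      intro x hx
      obtain ⟨y, hy⟩ := μ.surjective ⟨x, hx⟩
      have h1 := FreeGroup.expSum_map ((X.fundamentalGroup v).subtype.comp μ.toMonoidHom) y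
      have h2 : ((X.fundamentalGroup v).subtype.comp μ.toMonoidHom) y = x :=
        congrArg Subtype.val hy
      rw [h2, Finsupp.linearCombination_apply, Finsupp.sum] at h1
      rw [h1, Finsupp.coe_finsetSum]
      refine Submodule.sum_mem _ fun i _ => ?_
      rw [Finsupp.coe_smul]
      exact Submodule.smul_mem _ _ (Submodule.subset_span ⟨i, rfl⟩)
    -- For spanning, replace each edge in z by its loop: the added connecting paths contribute the
    -- pairing of z with a potential, which is zero because z is a cycle.
    have hz' : z = ∑ e, z e • ⇑(expSum (P (X.root e (-1)) * FreeGroup.of e *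
        (P (X.root e 1))⁻¹)) := by
      ext f
      have h1 := hz fun w => expSum (P w) f
      rw [pair] at h1
      have h2 : z f = ∑ e, z e * (Finsupp.single e (1 : ℝ)) f := by
        simp [Finsupp.single_apply]
      simp only [Finset.sum_apply, Pi.smul_apply, smul_eq_mul, FreeGroup.expSum_mul,
        FreeGroup.expSum_inv, FreeGroup.expSum_of, Finsupp.add_apply, Finsupp.neg_apply]
      rw [h2, ← sub_eq_zero, ← h1, ← Finset.sum_sub_distrib]
      refine Finset.sum_congr rfl fun e _ => ?_
      ring
    rw [hz']
    exact Submodule.sum_mem _ fun e _ => Submodule.smul_mem _ _ (hmem _ (hloop e))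

/-! ### The determinant of an oriented marked graph -/

/-- The matrix with columns `(1, N v)` and `(0, B i)`. -/
def orMatrix (N : Fin k → Fin m → ℝ) (B : Fin r → Fin m → ℝ) :
    Matrix (Fin 1 ⊕ Fin m) (Fin k ⊕ Fin r) ℝ :=
  Matrix.fromBlocks (Matrix.of fun _ _ => 1) 0 (Matrix.of fun e v => N v e)
    (Matrix.of fun e i => B i e)

/-- The first element is separated from the others. -/
def headTail (m : ℕ) : Fin (m + 1) ≃ Fin 1 ⊕ Fin m where
  toFun := Fin.cases (Sum.inl 0) Sum.inr
  invFun := Sum.elim (fun _ => 0) Fin.succ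
  left_inv i := by refine Fin.cases rfl (fun _ => rfl) i
  right_inv i := by
    rcases i with i | i
    · rw [Subsingleton.elim i 0]; rfl
    · rfl

/-- The identification of the two index sets of `orMatrix`. -/
def columnEquiv (h : k + r = m + 1) : Fin (m + 1) ≃ Fin k ⊕ Fin r :=
  (finCongr h.symm).trans finSumFinEquiv.symm

/-- The determinant of `orMatrix`. -/
def orDet (h : k + r = m + 1) (N : Fin k → Fin m → ℝ) (B : Fin r → Fin m → ℝ) : ℝ :=
  ((orMatrix N B).submatrix (headTail m) (columnEquiv h)).det

/-- All the transformation laws of `orDet` are row operations L and column operations R. The two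
index sets of the matrix are only matched by a numbering, so the identity is transported through it.
-/
theorem orDet_eq_of_mul {h : k + r = m + 1} {N N' : Fin k → Fin m → ℝ} {B B' : Fin r → Fin m → ℝ}
    (L : Matrix (Fin 1 ⊕ Fin m) (Fin 1 ⊕ Fin m) ℝ) (R : Matrix (Fin k ⊕ Fin r) (Fin k ⊕ Fin r) ℝ)
    (hLR : orMatrix N' B' = L * orMatrix N B * R) :
    orDet h N' B' = L.det * orDet h N B * R.det := by
  have h1 : (orMatrix N' B').submatrix (headTail m) (columnEquiv h) =
      L.submatrix (headTail m) (headTail m) *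
        (orMatrix N B).submatrix (headTail m) (columnEquiv h) *
        R.submatrix (columnEquiv h) (columnEquiv h) := by
    rw [hLR, Matrix.submatrix_mul_equiv, Matrix.submatrix_mul_equiv]
  rw [orDet, h1, Matrix.det_mul, Matrix.det_mul, Matrix.det_submatrix_equiv_self,
    Matrix.det_submatrix_equiv_self, orDet]

theorem orMatrix_mulVec_inl (N : Fin k → Fin m → ℝ) (B : Fin r → Fin m → ℝ)
    (x : Fin k ⊕ Fin r → ℝ) (i : Fin 1) :
    (orMatrix N B).mulVec x (Sum.inl i) = ∑ v, x (Sum.inl v) := by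
  simp [orMatrix, Matrix.mulVec, dotProduct]

theorem orMatrix_mulVec_inr (N : Fin k → Fin m → ℝ) (B : Fin r → Fin m → ℝ)
    (x : Fin k ⊕ Fin r → ℝ) :
    (fun e => (orMatrix N B).mulVec x (Sum.inr e)) =
      ∑ v, x (Sum.inl v) • N v + ∑ i, x (Sum.inr i) • B i := by
  ext e
  simp [orMatrix, Matrix.mulVec, dotProduct, mul_comm]

theorem IsSplitting.pair_sum {X : FinGraph k m} {N : Fin k → Fin m → ℝ} (hN : X.IsSplitting N)
    (y : Fin k → ℝ) (hy : ∑ v, y v = 0) (φ : Fin k → ℝ) :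
    X.pair (∑ v, y v • N v) φ = ∑ v, y v * φ v := by
  rcases Nat.eq_zero_or_pos k with rfl | hk
  · simp [pair]
  have : ∀ v, X.pair (y v • N v) φ =
      y v * φ v + y v * (X.pair (N ⟨0, hk⟩) φ - φ ⟨0, hk⟩) := by
    intro v
    have := hN v ⟨0, hk⟩ φ
    rw [pair_sub_left] at this
    rw [pair_smul_left, ← mul_add]
    congr 1
    linarith
  rw [pair_sum_left, Finset.sum_congr rfl fun v _ => this v, Finset.sum_add_distrib,
    ← Finset.sum_mul, hy, zero_mul, add_zero]

/-- The top row says that the vertex coefficients have sum 0, so the combination of the N v has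
those coefficients as its boundary. Cycles have no boundary, so these coefficients vanish, and
independence of the cycles does the rest. -/
theorem orMatrix_injective {X : FinGraph k m} {N : Fin k → Fin m → ℝ} (hN : X.IsSplitting N)
    {B : Fin r → Fin m → ℝ} (hB : X.IsCycleBasis B) (x : Fin k ⊕ Fin r → ℝ)
    (hx : (orMatrix N B).mulVec x = 0) : x = 0 := by
  have h0 : ∑ v, x (Sum.inl v) = 0 := by
    rw [← orMatrix_mulVec_inl N B x 0, hx]; rfl
  have h1 := orMatrix_mulVec_inr N B x
  rw [hx] at h1
  have h2 : ∀ φ : Fin k → ℝ, ∑ v, x (Sum.inl v) * φ v = 0 := by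
    intro φ
    rw [← hN.pair_sum _ h0 φ, eq_neg_of_add_eq_zero_left h1.symm, ← neg_one_smul ℝ,
      pair_smul_left, pair_sum_left]
    simp [pair_smul_left, hB.isCycle _ φ]
  have h3 : ∀ v, x (Sum.inl v) = 0 := fun v => by
    simpa [Pi.single_apply] using h2 (Pi.single v 1)
  simp only [h3, zero_smul, Finset.sum_const_zero, zero_add] at h1
  have h4 := Fintype.linearIndependent_iff.1 hB.linearIndependent _ h1.symm
  ext (v | i)
  · exact h3 v
  · exact h4 i

/-- After t N v₀ accounts for the top entry t, the vertex coefficients y are read off from the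
boundary of the remaining chain z. What is left of z after that is a cycle, hence a combination of
the basis. -/
theorem orMatrix_surjective {X : FinGraph k m} (hk : 0 < k) {N : Fin k → Fin m → ℝ}
    (hN : X.IsSplitting N)
    {B : Fin r → Fin m → ℝ} (hB : X.IsCycleBasis B) (b : Fin 1 ⊕ Fin m → ℝ) :
    ∃ x, (orMatrix N B).mulVec x = b := by
  let v₀ : Fin k := ⟨0, hk⟩
  let t := b (Sum.inl 0)
  let z : Fin m → ℝ := (fun e => b (Sum.inr e)) - t • N v₀
  let y : Fin k → ℝ := fun v => X.pair z (Pi.single v 1)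
  have hy : ∀ φ, ∑ v, y v * φ v = X.pair z φ := by
    intro φ
    rw [pair_eq_sum]
    refine Finset.sum_congr rfl fun v _ => ?_
    rw [mul_comm]
    congr 1
    simp [y, pair, Pi.single_apply]
  have hy0 : ∑ v, y v = 0 := by
    have := hy 1
    simpa [pair] using this
  obtain ⟨x, hx⟩ := (Submodule.mem_span_range_iff_exists_fun ℝ).1
    (hB.mem_span (z - ∑ v, y v • N v) fun φ => by
      rw [pair_sub_left, hN.pair_sum y hy0, hy, sub_self])
  refine ⟨Sum.elim (y + Pi.single v₀ t) x, ?_⟩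
  ext (i | e)
  · rw [orMatrix_mulVec_inl, Subsingleton.elim i 0]
    simp [Finset.sum_add_distrib, hy0, t]
  · have := congrFun (orMatrix_mulVec_inr N B (Sum.elim (y + Pi.single v₀ t) x)) e
    refine this.trans ?_
    simp only [Sum.elim_inl, Sum.elim_inr, hx, Pi.add_apply, add_smul, Finset.sum_add_distrib]
    have h1 : ∑ v, (Pi.single v₀ t : Fin k → ℝ) v • N v = t • N v₀ := by
      rw [Finset.sum_eq_single v₀ (fun v _ hv => by simp [hv]) (by simp), Pi.single_eq_same]
    rw [h1]
    simp [z]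
    ring

/-- The Euler characteristic. -/
theorem IsCycleBasis.card_eq {X : FinGraph k m} (hX : X.Connected) {B : Fin r → Fin m → ℝ}
    (hB : X.IsCycleBasis B) : k + r = m + 1 := by
  obtain ⟨N, hN⟩ := hX.exists_isSplitting
  have e : (Fin k ⊕ Fin r → ℝ) ≃ₗ[ℝ] (Fin 1 ⊕ Fin m → ℝ) :=
    LinearEquiv.ofBijective (orMatrix N B).mulVecLin
      ⟨(injective_iff_map_eq_zero _).2 fun x hx => orMatrix_injective hN hB x hx,
        fun b => orMatrix_surjective hX.1 hN hB b⟩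
  have := e.finrank_eq
  simp at this
  omega

theorem orDet_ne_zero {X : FinGraph k m} (h : k + r = m + 1) {N : Fin k → Fin m → ℝ}
    (hN : X.IsSplitting N) {B : Fin r → Fin m → ℝ} (hB : X.IsCycleBasis B) : orDet h N B ≠ 0 := by
  intro h0
  obtain ⟨x, hx, hx'⟩ := Matrix.exists_mulVec_eq_zero_iff.2 h0
  apply hx
  rw [Matrix.submatrix_mulVec_equiv] at hx'
  have : (orMatrix N B).mulVec (x ∘ (columnEquiv h).symm) = 0 := by
    funext i
    obtain ⟨i, rfl⟩ := (headTail m).surjective i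
    exact congrFun hx' i
  have h2 := orMatrix_injective hN hB _ this
  funext i
  simpa using congrFun h2 (columnEquiv h i)

/-- Two splittings differ by a fixed chain plus a cycle depending on v. The fixed chain is a
multiple of the row of ones added to the other rows, and the cycles are combinations of the last r
columns; neither operation changes the determinant. -/
theorem orDet_splitting {X : FinGraph k m} (h : k + r = m + 1) {N N' : Fin k → Fin m → ℝ}
    (hN : X.IsSplitting N) (hN' : X.IsSplitting N') {B : Fin r → Fin m → ℝ}
    (hB : X.IsCycleBasis B) : orDet h N' B = orDet h N B := by
  rcases Nat.eq_zero_or_pos k with rfl | hk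
  · congr 1; funext v; exact v.elim0
  let v₀ : Fin k := ⟨0, hk⟩
  have hc : ∀ v, X.IsCycle (N' v - N v - (N' v₀ - N v₀)) := fun v φ => by
    have h1 := hN v v₀ φ
    have h2 := hN' v v₀ φ
    simp only [pair_sub_left] at h1 h2 ⊢
    linarith
  choose a ha using fun v => (Submodule.mem_span_range_iff_exists_fun ℝ).1 (hB.mem_span _ (hc v))
  rw [orDet_eq_of_mul
    (Matrix.fromBlocks 1 0 (Matrix.of fun e _ => N' v₀ e - N v₀ e) 1)
    (Matrix.fromBlocks 1 0 (Matrix.of fun i v => a v i) 1) (N := N) (B := B)]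
  · simp
  · simp only [orMatrix, Matrix.fromBlocks_multiply]
    congr 1
    · simp
    · simp
    · ext e v
      have := congrFun (ha v) e
      simp [Matrix.mul_apply] at this ⊢
      simp only [mul_comm] at this ⊢
      rw [this]; ring
    · simp

theorem isSplitting_relabel {X Y : FinGraph k m} (ν : Equiv.Perm (Fin k)) (σ : Equiv.Perm (Fin m))
    (sgn : Fin m → ℤˣ) (hroot : ∀ f s, Y.root f (sgn f * s) = ν (X.root (σ f) s))
    {N : Fin k → Fin m → ℝ} (hN : X.IsSplitting N) :
    Y.IsSplitting fun v f => ((sgn f : ℤ) : ℝ) * N (ν.symm v) (σ f) := by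
  let c : ForestCollapse X Y := ForestCollapse.ofBijective ν ν.bijective σ sgn hroot
  intro v w φ
  have h := c.pair_push (N (ν.symm v) - N (ν.symm w)) φ
  rw [hN] at h
  have h1 : ∀ u, c.onV (ν.symm u) = u := ν.apply_symm_apply
  simp only [Function.comp, h1] at h
  rw [← h]
  congr 1
  funext f
  change _ = ((sgn f : ℤ) : ℝ) * (N (ν.symm v) - N (ν.symm w)) (σ f)
  simp [mul_sub]

/-- The effect on `orDet` of a change of numbering and directions and of the cycle basis. -/
theorem orDet_relabel (h : k + r = m + 1) (ν : Equiv.Perm (Fin k)) (σ : Equiv.Perm (Fin m))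
    (sgn : Fin m → ℤˣ) (A : Matrix (Fin r) (Fin r) ℝ) (N : Fin k → Fin m → ℝ)
    (B B' : Fin r → Fin m → ℝ)
    (hB : ∀ i f, B' i f = ((sgn f : ℤ) : ℝ) * ∑ j, B j (σ f) * A j i) :
    orDet h (fun v f => ((sgn f : ℤ) : ℝ) * N (ν.symm v) (σ f)) B' =
      (((∏ f, sgn f) * σ.sign * ν.sign : ℤˣ) : ℤ) * A.det * orDet h N B := by
  rw [orDet_eq_of_mul (N := N) (B := B)
    (Matrix.fromBlocks 1 0 0 (Matrix.diagonal (fun f => ((sgn f : ℤ) : ℝ)) *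
      (1 : Matrix (Fin m) (Fin m) ℝ).submatrix σ id))
    (Matrix.fromBlocks ((1 : Matrix (Fin k) (Fin k) ℝ).submatrix id ν.symm) 0 0 A)]
  · rw [Matrix.det_fromBlocks_zero₂₁, Matrix.det_fromBlocks_zero₂₁, Matrix.det_mul,
      Matrix.det_diagonal, Matrix.det_permute, Matrix.det_permute']
    simp
    ring
  · have hD : ∀ f j, (Matrix.diagonal (fun f => ((sgn f : ℤ) : ℝ)) *
        (1 : Matrix (Fin m) (Fin m) ℝ).submatrix σ id) f j =
          if σ f = j then ((sgn f : ℤ) : ℝ) else 0 := by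
      intro f j
      rw [Matrix.diagonal_mul]
      simp [Matrix.one_apply]
    generalize Matrix.diagonal (fun f => ((sgn f : ℤ) : ℝ)) *
        (1 : Matrix (Fin m) (Fin m) ℝ).submatrix σ id = D at hD
    simp only [orMatrix, Matrix.fromBlocks_multiply]
    congr 1
    · ext i v
      simp [Matrix.mul_apply, Matrix.one_apply]
    · simp
    · ext e v
      simp [Matrix.mul_apply, Matrix.one_apply, hD]
    · ext e i
      simp [Matrix.mul_apply, hD, hB, Finset.mul_sum, mul_assoc]

/-- Deleting the column of the second vertex turns the numbering of columns for k + 2 vertices into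
that for k + 1, as the minor in `orDet_contract_one` requires. -/
theorem columnEquiv_succAbove (h : k + 2 + r = m + 1 + 1) (h' : k + 1 + r = m + 1)
    (j : Fin (m + 1)) : columnEquiv h ((1 : Fin (m + 2)).succAbove j) =
      Sum.map (1 : Fin (k + 2)).succAbove id (columnEquiv h' j) := by
  obtain ⟨x, rfl⟩ := (columnEquiv h').symm.surjective j
  rw [Equiv.apply_symm_apply, ← Equiv.eq_symm_apply]
  rcases x with v | i
  · apply Fin.ext
    simp [columnEquiv, Fin.succAbove, Fin.lt_def]
    split_ifs <;> simp
  · apply Fin.ext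
    simp [columnEquiv, Fin.succAbove, Fin.lt_def]
    omega

/-- The effect on `orDet` of the contraction of an edge from the first to the second vertex. -/
theorem orDet_contract_one {X : FinGraph (k + 2) (m + 1)} (h : k + 2 + r = m + 1 + 1)
    (h' : k + 1 + r = m + 1) {e : Fin (m + 1)} {t : ℤˣ} (hX : X.Normalizes e t 1)
    {N : Fin (k + 2) → Fin (m + 1) → ℝ} (hN : X.IsSplitting N)
    {B : Fin r → Fin (m + 1) → ℝ} (hB : X.IsCycleBasis B) :
    ∃ N', (X.contract e 1).IsSplitting N' ∧
      orDet h N B = (-1) ^ (e : ℕ) * ((t : ℤ) : ℝ) *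
        orDet h' N' (fun i f => B i (e.succAbove f)) := by
  have r0 : X.root e (-t) = 0 := hX.1
  have r1 : X.root e t = 1 := hX.2
  -- The splitting is changed so that vertex 1 is reached from vertex 0 through e; the columns 0 and
  -- 1 then differ only by ±e.
  let N₁ : Fin (k + 2) → Fin (m + 1) → ℝ :=
    Function.update N 1 (N 0 + ((t : ℤ) : ℝ) • Pi.single e 1)
  have h0 : N₁ 0 = N 0 := Function.update_of_ne Fin.zero_ne_one _ _
  have h1 : N₁ 1 = N 0 + ((t : ℤ) : ℝ) • Pi.single e 1 := Function.update_self ..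
  have hN₁ : X.IsSplitting N₁ := by
    have key : ∀ v φ, X.pair (N₁ v) φ = φ v + (X.pair (N 0) φ - φ 0) := by
      intro v φ
      by_cases hv : v = 1
      · subst hv
        rw [h1, pair_add_left, pair_smul_left, pair_single, pair_units, r0, r1]
        ring
      · have : N₁ v = N v := Function.update_of_ne hv _ _
        have h2 := hN v 0 φ
        rw [pair_sub_left] at h2
        rw [this]; linarith
    intro v w φ
    rw [pair_sub_left, key, key]; ring
  rw [orDet_splitting h hN₁ hN hB]
  refine ⟨fun w f => N₁ ((1 : Fin (k + 2)).succAbove w) (e.succAbove f), fun v w ψ => ?_, ?_⟩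
  · have h2 := hX.collapse.pair_push
      (N₁ ((1 : Fin (k + 2)).succAbove v) - N₁ ((1 : Fin (k + 2)).succAbove w)) ψ
    rw [hN₁] at h2
    have h3 : ∀ u, hX.collapse.onV ((1 : Fin (k + 2)).succAbove u) = u := fun u => by
      change Fin.predAbove 0 ((1 : Fin (k + 2)).succAbove u) = u
      refine Fin.cases ?_ (fun u => ?_) u
      · rfl
      · rw [← Fin.succ_zero_eq_one, Fin.succ_succAbove_succ, Fin.succAbove_zero,
          Fin.predAbove_zero_succ]
    simp only [Function.comp, h3] at h2
    rw [← h2]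
    congr 1
    funext f
    simp [ForestCollapse.push, Normalizes.collapse]
  · set Q := (orMatrix N₁ B).submatrix (headTail (m + 1)) (columnEquiv h) with hQ
    have c0 : columnEquiv h 0 = Sum.inl 0 := by
      rw [← Equiv.eq_symm_apply]; apply Fin.ext; simp [columnEquiv]
    have c1 : columnEquiv h 1 = Sum.inl 1 := by
      rw [← Equiv.eq_symm_apply]; apply Fin.ext; simp [columnEquiv]
    -- After subtracting column 0 from column 1, the latter has a single nonzero entry t, in the row
    -- of e, and the determinant is expanded along it.
    have hdet := Matrix.det_updateCol_add_smul_self Q (i := 1) (j := 0) (by simp) (-1 : ℝ)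
    set Q' := Q.updateCol 1 fun k => Q k 1 + (-1 : ℝ) • Q k 0 with hQ'
    have hcol : ∀ i, Q' i 1 = if i = e.succ then ((t : ℤ) : ℝ) else 0 := by
      intro i
      rw [hQ', Matrix.updateCol_self, hQ]
      simp only [Matrix.submatrix_apply, c0, c1]
      refine Fin.cases ?_ (fun f => ?_) i
      · simp [orMatrix, headTail, (Fin.succ_ne_zero _).symm]
      · simp [orMatrix, headTail, h0, h1, Pi.single_apply]
    rw [orDet, ← hQ, ← hdet, Matrix.det_succ_column Q' 1, Finset.sum_eq_single e.succ]
    -- The entry stands in row e + 1, because of the row of ones, and in column 1, so the cofactor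
    -- sign is (-1)^(e + 2) = (-1)^e.
    · rw [hcol, if_pos rfl, orDet]
      congr 1
      · simp [pow_succ]
      · congr 1
        ext i j
        rw [hQ', Matrix.submatrix_updateCol_succAbove]
        simp only [hQ, Matrix.submatrix_apply, columnEquiv_succAbove h h']
        refine Fin.cases ?_ (fun f => ?_) i
        · rcases columnEquiv h' j with v | l <;> simp [orMatrix, headTail]
        · rcases columnEquiv h' j with v | l <;>
            simp [orMatrix, headTail, Fin.succ_succAbove_succ]
    · intro i _ hi
      rw [hcol, if_neg hi]; simp
    · simp

/-- A connected graph with Euler characteristic `1 - r` has a marking. -/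
theorem Connected.nonempty_marking {X : FinGraph k m} (hX : X.Connected) (h : k + r = m + 1)
    (v : Fin k) : Nonempty (FreeGroup (Fin r) ≃* X.fundamentalGroup v) := by
  -- The fundamental group is free as a subgroup of a free group. A basis gives independent cycles,
  -- so it is finite, and the Euler characteristic shows that it has r elements.
  let μ := IsFreeGroup.mulEquiv (X.fundamentalGroup v)
  have hB := isCycleBasis_markedCycles hX μ
  have hf : Finite (IsFreeGroup.Generators (X.fundamentalGroup v)) :=
    hB.linearIndependent.finite
  obtain ⟨n, ⟨σ⟩⟩ := Finite.exists_equiv_fin (IsFreeGroup.Generators (X.fundamentalGroup v))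
  let μ' : FreeGroup (Fin n) ≃* X.fundamentalGroup v := (FreeGroup.freeGroupCongr σ.symm).trans μ
  have := (isCycleBasis_markedCycles hX μ').card_eq hX
  obtain rfl : n = r := by omega
  exact ⟨μ'⟩

/-- The number comparing the orientation of a graph given by the numbering of its vertices and
the directions of its edges with the one given by the numbering of its edges and a marking. -/
def orNum (h : k + r = m + 1) {X : FinGraph k m} (hX : X.Connected) {v : Fin k}
    (μ : FreeGroup (Fin r) ≃* X.fundamentalGroup v) : ℝ :=
  orDet h hX.exists_isSplitting.choose (X.markedCycles μ)

theorem orNum_eq (h : k + r = m + 1) {X : FinGraph k m} (hX : X.Connected) {v : Fin k}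
    (μ : FreeGroup (Fin r) ≃* X.fundamentalGroup v) {N : Fin k → Fin m → ℝ}
    (hN : X.IsSplitting N) : orNum h hX μ = orDet h N (X.markedCycles μ) :=
  orDet_splitting h hN hX.exists_isSplitting.choose_spec (isCycleBasis_markedCycles hX μ)

theorem orNum_ne_zero (h : k + r = m + 1) {X : FinGraph k m} (hX : X.Connected) {v : Fin k}
    (μ : FreeGroup (Fin r) ≃* X.fundamentalGroup v) : orNum h hX μ ≠ 0 :=
  orDet_ne_zero h hX.exists_isSplitting.choose_spec (isCycleBasis_markedCycles hX μ)

theorem orNum_relabel (h : k + r = m + 1) {X Y : FinGraph k m} (hX : X.Connected)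
    (hY : Y.Connected) {v w : Fin k} (μ : FreeGroup (Fin r) ≃* X.fundamentalGroup v)
    (μ' : FreeGroup (Fin r) ≃* Y.fundamentalGroup w) (ν : Equiv.Perm (Fin k))
    (σ : Equiv.Perm (Fin m)) (sgn : Fin m → ℤˣ)
    (hroot : ∀ f s, Y.root f (sgn f * s) = ν (X.root (σ f) s)) (A : Matrix (Fin r) (Fin r) ℝ)
    (hB : ∀ i f, Y.markedCycles μ' i f =
      ((sgn f : ℤ) : ℝ) * ∑ j, X.markedCycles μ j (σ f) * A j i) :
    orNum h hY μ' = (((∏ f, sgn f) * σ.sign * ν.sign : ℤˣ) : ℤ) * A.det * orNum h hX μ := by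
  obtain ⟨N, hN⟩ := hX.exists_isSplitting
  rw [orNum_eq h hX μ hN, orNum_eq h hY μ' (isSplitting_relabel ν σ sgn hroot hN),
    orDet_relabel h ν σ sgn A N _ _ hB]

/-- Precomposing the marking with α changes the cycle basis by the exponent sum matrix of α, the
matrix of its action on the abelianization. -/
theorem orNum_marking (h : k + r = m + 1) {X : FinGraph k m} (hX : X.Connected) {v : Fin k}
    (μ : FreeGroup (Fin r) ≃* X.fundamentalGroup v) (α : MulAut (FreeGroup (Fin r))) :
    orNum h hX (MulEquiv.trans α μ) =
      (Matrix.of fun j i => expSum (α (FreeGroup.of i)) j).det * orNum h hX μ := by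
  rw [orNum_relabel h hX hX μ (MulEquiv.trans α μ) 1 1 1 (by simp)
    (Matrix.of fun j i => expSum (α (FreeGroup.of i)) j)]
  · simp
  · intro i f
    have := FreeGroup.expSum_map ((X.fundamentalGroup v).subtype.comp μ.toMonoidHom)
      (α (FreeGroup.of i))
    rw [Finsupp.linearCombination_apply, Finsupp.sum_fintype _ _ (by simp)] at this
    have h1 := congrArg (fun z : Fin m →₀ ℝ => z f) this
    simp only [Finsupp.coe_finsetSum, Finset.sum_apply] at h1
    refine h1.trans ?_
    simp only [Pi.one_apply, Units.val_one, Int.cast_one, one_mul, Equiv.Perm.one_apply]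
    refine Finset.sum_congr rfl fun j _ => ?_
    exact mul_comm _ _

/-- Renumbering the vertices by π costs its sign and reduces to an edge from the first to the second
vertex, or back according to t. The cycles marked in the contracted graph are the old ones
restricted to the remaining edges. -/
theorem orNum_contract (h : k + 2 + r = m + 1 + 1) (h' : k + 1 + r = m + 1)
    {X : FinGraph (k + 2) (m + 1)} (hX : X.Admissible) {v : Fin (k + 2)}
    (μ : FreeGroup (Fin r) ≃* X.fundamentalGroup v) {e : Fin (m + 1)} {t : ℤˣ}
    {π : Equiv.Perm (Fin (k + 2))} (hπ : X.Normalizes e t π) :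
    orNum h hX.connected μ = (-1) ^ (e : ℕ) * ((t * π.sign : ℤˣ) : ℤ) *
      orNum h' (hX.contract hπ).connected (μ.trans (hπ.fundamentalGroupEquiv v)) := by
  obtain ⟨N, hN⟩ := hX.connected.exists_isSplitting
  have hB := isCycleBasis_markedCycles hX.connected μ
  let Y : FinGraph (k + 2) (m + 1) := ⟨fun f s => π (X.root f s)⟩
  have hY : Y.Normalizes e t 1 := hπ
  have hroot : ∀ f s, Y.root f ((1 : Fin (m + 1) → ℤˣ) f * s) =
      π (X.root ((1 : Equiv.Perm (Fin (m + 1))) f) s) := fun f s => by simp [Y]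
  have hNY := isSplitting_relabel π 1 1 hroot hN
  have hBY : Y.IsCycleBasis (X.markedCycles μ) := by
    refine ⟨fun i φ => hB.isCycle i (φ ∘ π), hB.linearIndependent, fun z hz => hB.mem_span z ?_⟩
    intro φ
    have := hz (φ ∘ π.symm)
    rw [← this]
    simp [pair, Y]
  obtain ⟨N', hN', hdet⟩ := orDet_contract_one h h' hY hNY hBY
  have h1 := orDet_relabel h π 1 1 1 N (X.markedCycles μ) (X.markedCycles μ)
    (fun i f => by simp [Matrix.one_apply])
  have hm : (X.contract e π).markedCycles (μ.trans (hπ.fundamentalGroupEquiv v)) =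
      fun i f => X.markedCycles μ i (e.succAbove f) := by
    funext i f
    exact (hπ.collapse.expSum_map_apply _ f).trans (by simp [Normalizes.collapse, markedCycles])
  rw [orNum_eq h hX.connected μ hN, orNum_eq h' (hX.contract hπ).connected _ hN', hm]
  rw [h1] at hdet
  have hs : (((π.sign : ℤˣ) : ℤ) : ℝ) * ((π.sign : ℤˣ) : ℤ) = 1 := by
    rw [← Int.cast_mul, ← Units.val_mul, Int.units_mul_self]; simp
  simp only [Pi.one_apply, Finset.prod_const_one, Equiv.Perm.sign_one, one_mul,
    Matrix.det_one, mul_one] at hdet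
  rw [Units.val_mul, Int.cast_mul]
  linear_combination ((π.sign : ℤˣ) : ℤ) * hdet - (orDet h N (X.markedCycles μ)) * hs

end FinGraph

/-- The determinant of an outer automorphism in terms of exponent sums. -/
theorem outDet_mk (r : ℕ) (α : MulAut (FreeGroup (Fin r))) :
    ((outDet r (QuotientGroup.mk α) : ℤ) : ℝ) =
      (Matrix.of fun j i => FreeGroup.expSum (α (FreeGroup.of i)) j).det := by
  let b : Module.Basis (Fin r) ℤ (FreeAb r) := FreeAbelianGroup.basis (Fin r)
  have h1 : outDet r (QuotientGroup.mk α) = (LinearMap.toMatrix b b (abAction r α)).det :=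
    (LinearMap.det_toMatrix b _).symm
  have hb : ∀ i, Additive.ofMul (Abelianization.of (FreeGroup.of i)) = b i := fun i =>
    b.repr.injective ((FreeAbelianGroup.toFinsupp_of i).trans (b.repr_self i).symm)
  have h2 : ∀ (x : FreeGroup (Fin r)) (j : Fin r),
      ((b.repr (Additive.ofMul (Abelianization.of x)) j : ℤ) : ℝ) = FreeGroup.expSum x j := by
    intro x j
    let f : FreeGroup (Fin r) →* Multiplicative ℝ :=
      { toFun := fun x => Multiplicative.ofAdd
          ((b.repr (Additive.ofMul (Abelianization.of x)) j : ℤ) : ℝ)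
        map_one' := by simp
        map_mul' := by simp }
    have h3 := FreeGroup.map_eq_linearCombination f x
    have h4 : ∀ i, (f (FreeGroup.of i)).toAdd = if i = j then 1 else 0 := by
      intro i
      change ((b.repr (Additive.ofMul (Abelianization.of (FreeGroup.of i))) j : ℤ) : ℝ) = _
      rw [hb, Module.Basis.repr_self, Finsupp.single_apply]
      simp
    change (f x).toAdd = _
    rw [h3, Finsupp.linearCombination_apply, Finsupp.sum_fintype _ _ (by simp)]
    simp [h4]
  rw [h1]
  refine ((Int.castRingHom ℝ).map_det _).trans ?_
  congr 1
  ext j i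
  rw [RingHom.mapMatrix_apply, Matrix.map_apply, LinearMap.toMatrix_apply, Matrix.of_apply, ← h2]
  rw [← hb]
  rfl

theorem outDet_mul_self (r : ℕ) (g : Out r) : outDet r g * outDet r g = 1 := by
  have h : IsUnit (outDet r g) := (Group.isUnit g).map (outDet r)
  obtain ⟨u, hu⟩ := h
  rw [← hu, ← Units.val_mul, Int.units_mul_self, Units.val_one]

/-! ### Simplices of full marked graphs and their orientations -/

namespace OrderedSimplex

/-- The ordered simplex of a marked graph with a list of edges. -/
def mk {r p : ℕ} (a : MarkedSimplex r p) : OrderedSimplex r p := Quot.mk _ a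

/-- `infinity` only asks for some representative at infinity; since `AtInfinity` is invariant under
`Rel`, it can be tested on any. -/
theorem mk_mem_infinity_iff {r p : ℕ} (a : MarkedSimplex r p) :
    mk a ∈ infinity r p ↔ a.AtInfinity := by
  refine ⟨?_, fun h => ⟨a, h, rfl⟩⟩
  rintro ⟨b, hb, hab⟩
  have := congrArg (Quot.lift MarkedSimplex.AtInfinity
    fun _ _ h => propext (MarkedSimplex.Rel.atInfinity_iff h)) hab
  exact this.mp hb

end OrderedSimplex

namespace FinGraph

variable {K M : ℕ}

/-- The isomorphism given by permutations of the vertices and edges. -/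
def isoOf {X Y : FinGraph K M} (ν : Equiv.Perm (Fin K)) (τ : Equiv.Perm (Fin M))
    (sgn : Fin M → ℤˣ) (hroot : ∀ f s, Y.root f (sgn f * s) = ν (X.root (τ f) s)) : Iso X Y where
  onV := ν
  onE := τ.symm
  sgn e := sgn (τ.symm e)
  root_eq e s := by rw [hroot, Equiv.apply_symm_apply]

theorem isoOf_orientation {X Y : FinGraph K M} (ν : Equiv.Perm (Fin K)) (τ : Equiv.Perm (Fin M))
    (sgn : Fin M → ℤˣ) (hroot : ∀ f s, Y.root f (sgn f * s) = ν (X.root (τ f) s)) :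
    (isoOf ν τ sgn hroot).orientation = ν.sign * ∏ f, sgn f := by
  rw [Iso.orientation]
  congr 1
  exact Equiv.prod_comp τ.symm sgn

/-- An isomorphism, as the collapse of the empty forest. -/
def Iso.collapse {X Y : FinGraph K M} (h : Iso X Y) : ForestCollapse X Y :=
  ForestCollapse.ofBijective h.onV h.onV.bijective h.onE.symm (fun f => h.sgn (h.onE.symm f))
    fun f s => by
      have := h.root_eq (h.onE.symm f) s
      rwa [Equiv.apply_symm_apply] at this

/-- If no edge is collapsed, sending f back to `edge f` with the same sign is a left inverse. -/
theorem ForestCollapse.map_injective_of_surjective {k m k' m' : ℕ} {X : FinGraph k m}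
    {Y : FinGraph k' m'} (c : ForestCollapse X Y) (hc : Function.Surjective c.edge) :
    Function.Injective c.map := by
  let ψ : FreeGroup (Fin m') →* FreeGroup (Fin m) :=
    FreeGroup.lift fun f => FreeGroup.of (c.edge f) ^ (c.sgn f : ℤ)
  have : ψ.comp c.map = MonoidHom.id _ := by
    refine FreeGroup.ext_hom _ _ fun e => ?_
    obtain ⟨f, rfl⟩ := hc e
    rw [MonoidHom.comp_apply, c.map_of_edge, map_zpow, FreeGroup.lift_apply_of, ← zpow_mul,
      ← Units.val_mul, Int.units_mul_self, Units.val_one, zpow_one]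
    rfl
  exact Function.LeftInverse.injective (g := ψ) fun x => congrArg (fun f => f x) this

end FinGraph

/-! ### From marked graphs with ordered edges to oriented graphs. -/

namespace MarkedSimplex

open FinGraph OrderedSimplex

variable {r p K M : ℕ}

/-- A marked graph with all of its edges, in the order given by `σ`. -/
def std (hM : p + 1 = M) {X : FinGraph K M} (hX : X.Admissible) {v : Fin K}
    (μ : FreeGroup (Fin r) ≃* X.fundamentalGroup v) (σ : Equiv.Perm (Fin M)) :
    MarkedSimplex r p :=
  ⟨K, M, X, hX, v, μ, ((finCongr hM).trans σ).toEmbedding⟩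

theorem std_isFull (hM : p + 1 = M) {X : FinGraph K M} (hX : X.Admissible) {v : Fin K}
    (μ : FreeGroup (Fin r) ≃* X.fundamentalGroup v) (σ : Equiv.Perm (Fin M)) :
    (std hM hX μ σ).IsFull :=
  ((finCongr hM).trans σ).surjective

/-- The number comparing the orientations of a marked graph. -/
def coef (h : K + r = M + 1) {X : FinGraph K M} (hX : X.Admissible) {v : Fin K}
    (μ : FreeGroup (Fin r) ≃* X.fundamentalGroup v) (σ : Equiv.Perm (Fin M)) : ℝ :=
  ((σ.sign : ℤ) : ℝ) * orNum h hX.connected μ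

theorem units_cast_mul_self (u : ℤˣ) : ((u : ℤ) : ℝ) * ((u : ℤ) : ℝ) = 1 := by
  rw [← Int.cast_mul, ← Units.val_mul, Int.units_mul_self]; simp

theorem coef_ne_zero (h : K + r = M + 1) {X : FinGraph K M} (hX : X.Admissible) {v : Fin K}
    (μ : FreeGroup (Fin r) ≃* X.fundamentalGroup v) (σ : Equiv.Perm (Fin M)) :
    coef h hX μ σ ≠ 0 :=
  mul_ne_zero (left_ne_zero_of_mul_eq_one (units_cast_mul_self _)) (orNum_ne_zero h _ μ)

theorem markedCycles_of_marking {X Y : FinGraph K M} {v w : Fin K}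
    {μ : FreeGroup (Fin r) ≃* X.fundamentalGroup v}
    {μ' : FreeGroup (Fin r) ≃* Y.fundamentalGroup w} (c : ForestCollapse X Y)
    {γ : FreeGroup (Fin M)}
    (hm : ∀ x, (μ' x : FreeGroup (Fin M)) = γ⁻¹ * c.map (μ x) * γ) (i : Fin r) (f : Fin M) :
    Y.markedCycles μ' i f = ((c.sgn f : ℤ) : ℝ) * X.markedCycles μ i (c.edge f) := by
  rw [markedCycles, hm, markedCycles, ← c.expSum_map_apply]
  simp

/-- The sign of the edge permutation τ occurs both in `orNum` and in the ordering of the edges, so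
it cancels. What remains is the sign of the vertex permutation times the edge reversals, which is
the orientation character of the graph complex. -/
theorem coef_relabel (h : K + r = M + 1) {X Y : FinGraph K M} (hX : X.Admissible)
    (hY : Y.Admissible) {v w : Fin K} {μ : FreeGroup (Fin r) ≃* X.fundamentalGroup v}
    {μ' : FreeGroup (Fin r) ≃* Y.fundamentalGroup w} {σ σ' : Equiv.Perm (Fin M)}
    (ν : Equiv.Perm (Fin K)) (τ : Equiv.Perm (Fin M)) (sgn : Fin M → ℤˣ)
    (hroot : ∀ f s, Y.root f (sgn f * s) = ν (X.root (τ f) s))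
    (hB : ∀ i f, Y.markedCycles μ' i f = ((sgn f : ℤ) : ℝ) * X.markedCycles μ i (τ f))
    (hσ : σ = τ * σ') :
    coef h hY μ' σ' = (((isoOf ν τ sgn hroot).orientation : ℤ) : ℝ) * coef h hX μ σ := by
  rw [coef, coef, isoOf_orientation, orNum_relabel h hX.connected hY.connected μ μ' ν τ sgn hroot 1
    (fun i f => by rw [hB]; simp [Matrix.one_apply]), hσ, map_mul, Matrix.det_one]
  push_cast
  ring

theorem exists_iso_of_rel (h : K + r = M + 1) (hM : p + 1 = M) {X Y : FinGraph K M}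
    (hX : X.Admissible) (hY : Y.Admissible) {v w : Fin K}
    {μ : FreeGroup (Fin r) ≃* X.fundamentalGroup v}
    {μ' : FreeGroup (Fin r) ≃* Y.fundamentalGroup w} {σ σ' : Equiv.Perm (Fin M)}
    (hrel : Rel (std hM hX μ σ) (std hM hY μ' σ')) :
    ∃ i : Iso X Y, coef h hY μ' σ' = ((i.orientation : ℤ) : ℝ) * coef h hX μ σ := by
  obtain ⟨c, he, γ, hγ, hm⟩ := hrel
  change ForestCollapse X Y at c
  have hτ : Function.Bijective c.edge := Finite.injective_iff_bijective.1 c.edge.injective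
  have hν : Function.Bijective c.onV := Finite.surjective_iff_bijective.1 c.surjective
  let τ : Equiv.Perm (Fin M) := Equiv.ofBijective c.edge hτ
  let ν : Equiv.Perm (Fin K) := Equiv.ofBijective c.onV hν
  refine ⟨isoOf ν τ c.sgn c.root_eq, coef_relabel h hX hY ν τ c.sgn c.root_eq
    (markedCycles_of_marking c hm) ?_⟩
  ext i : 1
  obtain ⟨i, rfl⟩ := (finCongr hM).surjective i
  exact he i

/-- A complete representative has p + 1 edges, and then the Euler characteristic determines the
number of its vertices. -/
theorem exists_std (h : K + r = M + 1) (hM : p + 1 = M) (s : OrderedSimplex r p)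
    (hs : s ∉ infinity r p) : ∃ (X : FinGraph K M) (hX : X.Admissible) (v : Fin K)
      (μ : FreeGroup (Fin r) ≃* X.fundamentalGroup v) (σ : Equiv.Perm (Fin M)),
      s = OrderedSimplex.mk (std hM hX μ σ) := by
  obtain ⟨a⟩ := s
  obtain ⟨z, hz, haz⟩ := a.exists_rel_isFull fun h => hs ⟨a, h, rfl⟩
  have haz' : OrderedSimplex.mk a = OrderedSimplex.mk z := Quot.sound haz
  change ∃ (X : FinGraph K M) (hX : X.Admissible) (v : Fin K)
      (μ : FreeGroup (Fin r) ≃* X.fundamentalGroup v) (σ : Equiv.Perm (Fin M)),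
      OrderedSimplex.mk a = OrderedSimplex.mk (std hM hX μ σ)
  rw [haz']
  obtain ⟨k, m, X, hX, v, μ, f⟩ := z
  have hb : Function.Bijective f := ⟨f.injective, hz⟩
  have hm : p + 1 = m := by simpa using Fintype.card_of_bijective hb
  have hk := (isCycleBasis_markedCycles hX.connected μ).card_eq hX.connected
  obtain rfl : m = M := by omega
  obtain rfl : k = K := by omega
  refine ⟨X, hX, v, μ, (finCongr hM).symm.trans (Equiv.ofBijective f hb), ?_⟩
  congr 1

/-- Two complete representatives are related by an isomorphism, under which `coef` and the class of
the oriented graph change by the same sign; their product is well defined. -/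
theorem exists_value (h : K + r = M + 1) (hM : p + 1 = M) (s : OrderedSimplex r p) :
    ∃ y : GraphComplex.GChains K M, (s ∈ infinity r p → y = 0) ∧
      ∀ (X : FinGraph K M) (hX : X.Admissible) (v : Fin K)
        (μ : FreeGroup (Fin r) ≃* X.fundamentalGroup v) (σ : Equiv.Perm (Fin M)),
        s = OrderedSimplex.mk (std hM hX μ σ) → y = coef h hX μ σ • GraphComplex.cls X hX := by
  by_cases hs : s ∈ infinity r p
  · refine ⟨0, fun _ => rfl, fun X hX v μ σ hs' => ?_⟩
    rw [hs', mk_mem_infinity_iff] at hs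
    exact absurd hs (std_isFull hM hX μ σ).not_atInfinity
  · obtain ⟨X, hX, v, μ, σ, rfl⟩ := exists_std h hM s hs
    refine ⟨coef h hX μ σ • GraphComplex.cls X hX, fun h => absurd h hs, ?_⟩
    intro Y hY w μ' σ' heq
    obtain ⟨i, hi⟩ := exists_iso_of_rel h hM hX hY
      ((mk_eq_mk_iff_of_isFull (std_isFull hM hX μ σ) (std_isFull hM hY μ' σ')).1 heq)
    rw [hi, GraphComplex.cls_iso hX hY i, smul_smul, mul_comm]

end MarkedSimplex

/-! ### The oriented graph of a simplex, under reordering and under Out(F_r). -/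

namespace OrderedSimplex

open MarkedSimplex FinGraph

variable {r p K M : ℕ}

/-- The oriented graph of an ordered simplex. -/
def value (h : K + r = M + 1) (hM : p + 1 = M) (s : OrderedSimplex r p) :
    GraphComplex.GChains K M := (exists_value h hM s).choose

theorem value_infinity (h : K + r = M + 1) (hM : p + 1 = M) {s : OrderedSimplex r p}
    (hs : s ∈ infinity r p) : value h hM s = 0 := (exists_value h hM s).choose_spec.1 hs

theorem value_std (h : K + r = M + 1) (hM : p + 1 = M) {X : FinGraph K M} (hX : X.Admissible)
    {v : Fin K} (μ : FreeGroup (Fin r) ≃* X.fundamentalGroup v) (σ : Equiv.Perm (Fin M)) :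
    value h hM (mk (std hM hX μ σ)) = coef h hX μ σ • GraphComplex.cls X hX :=
  (exists_value h hM _).choose_spec.2 X hX v μ σ rfl

theorem permute_infinity_iff (σ : Equiv.Perm (Fin (p + 1))) (s : OrderedSimplex r p) :
    permute σ s ∈ infinity r p ↔ s ∈ infinity r p := by
  refine ⟨fun h => ?_, fun h => reindex_infinity _ h⟩
  have := reindex_infinity σ⁻¹.toEmbedding h
  rw [permute, reindex_reindex] at this
  have h1 : σ⁻¹.toEmbedding.trans σ.toEmbedding = Function.Embedding.refl _ := by
    ext i : 1; simp
  rw [h1] at this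
  obtain ⟨a⟩ := s
  exact this

theorem permute_std (hM : p + 1 = M) {X : FinGraph K M} (hX : X.Admissible)
    {v : Fin K} (μ : FreeGroup (Fin r) ≃* X.fundamentalGroup v) (σ : Equiv.Perm (Fin M))
    (τ : Equiv.Perm (Fin (p + 1))) :
    permute τ (mk (std hM hX μ σ)) =
      mk (std hM hX μ (σ * (finCongr hM).permCongr τ)) := by
  refine congrArg (Quot.mk _) ?_
  simp only [std, MarkedSimplex.reindex]
  congr 1

theorem coef_mul (h : K + r = M + 1) {X : FinGraph K M} (hX : X.Admissible)
    {v : Fin K} (μ : FreeGroup (Fin r) ≃* X.fundamentalGroup v) (σ τ : Equiv.Perm (Fin M)) :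
    coef h hX μ (σ * τ) = ((τ.sign : ℤ) : ℝ) * coef h hX μ σ := by
  simp only [coef, map_mul, Units.val_mul, Int.cast_mul]; ring

theorem value_permute (h : K + r = M + 1) (hM : p + 1 = M) (τ : Equiv.Perm (Fin (p + 1)))
    (s : OrderedSimplex r p) :
    value h hM (permute τ s) = ((τ.sign : ℤ) : ℝ) • value h hM s := by
  by_cases hs : s ∈ infinity r p
  · rw [value_infinity h hM hs, value_infinity h hM ((permute_infinity_iff τ s).2 hs), smul_zero]
  · obtain ⟨X, hX, v, μ, σ, rfl⟩ := exists_std h hM s hs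
    rw [permute_std, value_std, value_std, coef_mul, smul_smul, Equiv.Perm.sign_permCongr]

/-- α acts on markings through α⁻¹, but the determinant is ±1, so α and α⁻¹ have the same one. -/
theorem coef_act (h : K + r = M + 1) {X : FinGraph K M} (hX : X.Admissible)
    {v : Fin K} (μ : FreeGroup (Fin r) ≃* X.fundamentalGroup v) (σ : Equiv.Perm (Fin M))
    (α : MulAut (FreeGroup (Fin r))) :
    coef h hX (MulEquiv.trans (MulEquiv.symm α) μ) σ =
      ((outDet r (QuotientGroup.mk α) : ℤ) : ℝ) * coef h hX μ σ := by
  have h1 : outDet r (QuotientGroup.mk α) = outDet r (QuotientGroup.mk α⁻¹) := by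
    have h2 := outDet_mul_self r (QuotientGroup.mk α)
    have h3 : outDet r (QuotientGroup.mk α) * outDet r (QuotientGroup.mk α⁻¹) = 1 := by
      rw [← map_mul, QuotientGroup.mk_inv, mul_inv_cancel, map_one]
    exact mul_left_cancel₀ (left_ne_zero_of_mul_eq_one h2) (h2.trans h3.symm)
  rw [coef, coef, h1, outDet_mk]
  have := orNum_marking h hX.connected μ α⁻¹
  refine (congrArg _ this).trans ?_
  ring

theorem smul_std (hM : p + 1 = M) {X : FinGraph K M} (hX : X.Admissible)
    {v : Fin K} (μ : FreeGroup (Fin r) ≃* X.fundamentalGroup v) (σ : Equiv.Perm (Fin M))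
    (α : MulAut (FreeGroup (Fin r))) :
    (QuotientGroup.mk α : Out r) • mk (std hM hX μ σ) =
      mk (std hM hX (MulEquiv.trans (MulEquiv.symm α) μ) σ) := rfl

theorem smul_infinity_iff (g : Out r) (s : OrderedSimplex r p) :
    g • s ∈ infinity r p ↔ s ∈ infinity r p := by
  refine ⟨fun h => ?_, smul_infinity g⟩
  have := smul_infinity g⁻¹ h
  rwa [inv_smul_smul] at this

theorem value_smul (h : K + r = M + 1) (hM : p + 1 = M) (g : Out r) (s : OrderedSimplex r p) :
    value h hM (g • s) = ((outDet r g : ℤ) : ℝ) • value h hM s := by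
  by_cases hs : s ∈ infinity r p
  · rw [value_infinity h hM hs, value_infinity h hM ((smul_infinity_iff g s).2 hs), smul_zero]
  · obtain ⟨X, hX, v, μ, σ, rfl⟩ := exists_std h hM s hs
    obtain ⟨α, rfl⟩ := QuotientGroup.mk_surjective g
    rw [smul_std, value_std, value_std, coef_act, smul_smul]

end OrderedSimplex

/-! ### The map to the graph complex -/

namespace SimplicialChains

open OrderedSimplex MarkedSimplex FinGraph

variable {r p K M : ℕ}

/-- The map from relative chains to oriented graphs. -/
def toGraphs (h : K + r = M + 1) (hM : p + 1 = M) : RelChains r p →ₗ[ℝ] GraphComplex.GChains K M :=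
  liftRel (value h hM) (value_permute h hM) fun _ hs => value_infinity h hM hs

theorem toGraphs_cls (h : K + r = M + 1) (hM : p + 1 = M) (s : OrderedSimplex r p) :
    toGraphs h hM (cls s) = value h hM s := liftRel_cls ..

theorem rep_cls (g : Out r) (s : OrderedSimplex r p) : rep r p g (cls s) = cls (g • s) := by
  simp [rep]

theorem toGraphs_rep (h : K + r = M + 1) (hM : p + 1 = M) (g : Out r) (x : RelChains r p) :
    toGraphs h hM (rep r p g x) = ((outDet r g : ℤ) : ℝ) • toGraphs h hM x := by
  have : toGraphs h hM ∘ₗ rep r p g = ((outDet r g : ℤ) : ℝ) • toGraphs h hM :=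
    hom_ext fun s => by
      rw [LinearMap.comp_apply, LinearMap.smul_apply, rep_cls, toGraphs_cls, toGraphs_cls,
        value_smul]
  exact congrArg (fun f => f x) this

/-- Every graph of the right Euler characteristic has a marking, and the resulting coefficient is
nonzero, hence invertible in ℝ. -/
theorem toGraphs_surjective (h : K + r = M + 1) (hM : p + 1 = M) :
    Function.Surjective (toGraphs (r := r) h hM) := by
  rw [← LinearMap.range_eq_top, eq_top_iff]
  rintro y -
  obtain ⟨y, rfl⟩ := Submodule.mkQ_surjective _ y
  induction y using Finsupp.induction_linear with
  | zero => rw [map_zero]; exact Submodule.zero_mem _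
  | add y z hy hz => rw [map_add]; exact Submodule.add_mem _ hy hz
  | single X c =>
    obtain ⟨X, hX⟩ := X
    obtain ⟨μ⟩ := hX.connected.nonempty_marking h ⟨0, hX.connected.1⟩
    have h1 : (GraphComplex.orRel K M).mkQ (Finsupp.single ⟨X, hX⟩ c) =
        c • GraphComplex.cls X hX := by
      rw [GraphComplex.cls, ← map_smul]; simp
    have h2 := coef_ne_zero h hX μ 1
    refine ⟨(c * (coef h hX μ 1)⁻¹) • cls (OrderedSimplex.mk (std hM hX μ 1)), ?_⟩
    rw [map_smul, toGraphs_cls, value_std, smul_smul, h1, mul_assoc, inv_mul_cancel₀ h2, mul_one]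

/-- If the omitted edge `σ i` is a loop, the face is at infinity and the collapse is 0 by
definition. Otherwise the face is represented by the contracted graph with the remaining edges in
the order τ, and the sign of τ combines with that of `orNum_contract` so that (-1)^(σ i) drops out.
-/
theorem value_face (h : K + 2 + r = M + 1 + 1) (h' : K + 1 + r = M + 1) (hM : p + 1 + 1 = M + 1)
    (hM' : p + 1 = M) {X : FinGraph (K + 2) (M + 1)} (hX : X.Admissible) {v : Fin (K + 2)}
    (μ : FreeGroup (Fin r) ≃* X.fundamentalGroup v) (σ : Equiv.Perm (Fin (M + 1)))
    (i : Fin (M + 1)) :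
    value h' hM' (face ((finCongr hM).symm i) (OrderedSimplex.mk (std hM hX μ σ))) =
      ((-1) ^ (i : ℕ) * coef h hX μ σ) • GraphComplex.collapse ⟨X, hX⟩ (σ i) := by
  subst hM'
  obtain ⟨τ, hτ, hs⟩ := exists_perm_succAbove σ i
  by_cases hl : X.IsLoop (σ i)
  · rw [GraphComplex.collapse, dif_pos hl, smul_zero]
    apply value_infinity
    refine (mk_mem_infinity_iff _).2 (hasCycle_of_isLoop (e := σ i) hl ?_)
    rintro ⟨j, hj⟩
    exact Fin.succAbove_ne i j (σ.injective hj)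
  · have hN := normalizes_normalizer hl
    have h1 : face i (OrderedSimplex.mk (std rfl hX μ σ)) =
        OrderedSimplex.mk (std rfl (hX.contract hN) (μ.trans (hN.fundamentalGroupEquiv v)) τ) := by
      have h2 := rel_contractEdge hX v μ hN τ.toEmbedding
      have h3 : MarkedSimplex.reindex i.succAboveEmb (std rfl hX μ σ) =
          ⟨K + 2, p + 1 + 1, X, hX, v, μ, τ.toEmbedding.trans (σ i).succAboveEmb⟩ := by
        simp only [MarkedSimplex.reindex, std]
        congr 1
        ext j : 1
        exact hτ j
      refine (congrArg OrderedSimplex.mk h3).trans ?_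
      exact Quot.sound h2
    have h4 : (finCongr hM).symm i = i := rfl
    rw [h4, h1, value_std, GraphComplex.collapse, dif_neg hl, smul_smul]
    congr 1
    rw [coef, coef, orNum_contract h h' hX μ hN, hs]
    have e1 := units_cast_mul_self ((X.normalizer (σ i)).sign)
    have e2 : ((-1 : ℝ) ^ (σ i : ℕ)) * (-1) ^ (σ i : ℕ) = 1 := by rw [← mul_pow]; simp
    push_cast
    rw [one_mul]
    linear_combination (-((σ.sign : ℤ) : ℝ) * (-1) ^ (i : ℕ) *
      orNum h' (hX.contract hN).connected (μ.trans (hN.fundamentalGroupEquiv v)) *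
      (-1) ^ (σ i : ℕ)) * e1

/-- On a complete marked graph the faces correspond to the edges through σ, and the sign (-1)^i of
the face cancels the one in `value_face`. Simplices at infinity have class zero on both sides. -/
theorem toGraphs_boundary (h : K + 2 + r = M + 1 + 1) (h' : K + 1 + r = M + 1)
    (hM : p + 1 + 1 = M + 1) (hM' : p + 1 = M) (x : RelChains r (p + 1)) :
    toGraphs h' hM' (boundary r p x) = GraphComplex.edgeBoundary K M (toGraphs h hM x) := by
  have : toGraphs h' hM' ∘ₗ boundary r p = GraphComplex.edgeBoundary K M ∘ₗ toGraphs h hM := by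
    refine hom_ext fun s => ?_
    rw [LinearMap.comp_apply, LinearMap.comp_apply]
    by_cases hs : s ∈ infinity r (p + 1)
    · rw [cls_infinity hs, map_zero, map_zero, map_zero, map_zero]
    · obtain ⟨X, hX, v, μ, σ, rfl⟩ := exists_std h hM s hs
      rw [boundary_cls, map_sum, toGraphs_cls, value_std, map_smul,
        GraphComplex.edgeBoundary_cls ⟨X, hX⟩, Finset.smul_sum, ← Equiv.sum_comp σ,
        ← Equiv.sum_comp (finCongr hM).symm]
      refine Finset.sum_congr rfl fun i _ => ?_
      rw [map_smul, toGraphs_cls, value_face h h' hM hM', smul_smul]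
      congr 1
      have e2 : ((-1 : ℝ) ^ (i : ℕ)) * (-1) ^ (i : ℕ) = 1 := by rw [← mul_pow]; simp
      have e3 : (((finCongr hM).symm i : Fin (p + 1 + 1)) : ℕ) = i := rfl
      rw [e3, ← mul_assoc, e2, one_mul]
  exact congrArg (fun f => f x) this

/-- Isomorphic marked graphs give simplices in the same orbit, and their orientations compare as
those of the graphs. -/
theorem exists_smul_std (h : K + r = M + 1) (hM : p + 1 = M) {X Y : FinGraph K M}
    (hX : X.Admissible) (hY : Y.Admissible) (i : Iso X Y) {v w : Fin K}
    (μ : FreeGroup (Fin r) ≃* X.fundamentalGroup v)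
    (μ' : FreeGroup (Fin r) ≃* Y.fundamentalGroup w) (σ : Equiv.Perm (Fin M)) :
    ∃ g : Out r, OrderedSimplex.mk (std hM hY μ' (i.onE * σ)) =
        g • OrderedSimplex.mk (std hM hX μ σ) ∧
      coef h hY μ' (i.onE * σ) = ((i.orientation : ℤ) : ℝ) *
        (((outDet r g : ℤ) : ℝ) * coef h hX μ σ) := by
  let c := i.collapse
  have hinj : Function.Injective c.map := c.map_injective_of_surjective i.onE.symm.surjective
  obtain ⟨γ, hγ⟩ := hY.connected.exists_isPath (c.onV v) w
  -- The graph isomorphism on fundamental groups, with base points compared along γ. Read through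
  -- the two markings it is an automorphism of F_r, whose class is the required g.
  let δ : X.fundamentalGroup v →* Y.fundamentalGroup w :=
    { toFun := fun x => ⟨γ⁻¹ * c.map x * γ, (hγ.symm.trans (c.isPath_map x.2)).trans hγ⟩
      map_one' := Subtype.ext (by simp)
      map_mul' := fun x y => Subtype.ext (by simp [mul_assoc]) }
  have hδ : Function.Bijective δ := by
    constructor
    · intro x y hxy
      have h1 : γ⁻¹ * c.map x * γ = γ⁻¹ * c.map y * γ := congrArg Subtype.val hxy
      exact Subtype.ext (hinj (mul_left_cancel (mul_right_cancel h1)))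
    · rintro ⟨y, hy⟩
      obtain ⟨x, hx, hxy⟩ := c.exists_lift v ((hγ.trans hy).trans hγ.symm) v rfl
      exact ⟨⟨x, hx⟩, Subtype.ext (by simp [δ, hxy, mul_assoc])⟩
  let β : MulAut (FreeGroup (Fin r)) := (μ.trans (MulEquiv.ofBijective δ hδ)).trans μ'.symm
  have hm : ∀ x, (μ' x : FreeGroup (Fin M)) =
      γ⁻¹ * c.map ((MulEquiv.trans (MulEquiv.symm β) μ) x) * γ := by
    intro x
    change _ = ((δ (μ (β.symm x)) : Y.fundamentalGroup w) : FreeGroup (Fin M))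
    have h1 : μ' (β (β.symm x)) = δ (μ (β.symm x)) := by
      change μ' (μ'.symm (δ (μ (β.symm x)))) = _
      rw [MulEquiv.apply_symm_apply]
    rw [← h1, MulEquiv.apply_symm_apply]
  refine ⟨QuotientGroup.mk β, ?_, ?_⟩
  · rw [smul_std]
    refine (Quot.sound ⟨c, fun j => ?_, γ, hγ, hm⟩).symm
    change σ _ = i.onE.symm (i.onE (σ _))
    rw [Equiv.symm_apply_apply]
  · have hroot : ∀ f s, Y.root f (i.sgn (i.onE.symm f) * s) = i.onV (X.root (i.onE.symm f) s) :=
      c.root_eq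
    rw [← coef_act, coef_relabel h hX hY i.onV i.onE.symm (fun f => i.sgn (i.onE.symm f)) hroot
      (markedCycles_of_marking c hm) (σ := σ) (by ext; simp)]
    congr 3
    rw [isoOf_orientation, Iso.orientation]
    congr 1
    exact Equiv.prod_comp i.onE.symm i.sgn

/-- A linear map on the chains which transforms by the determinant factors over oriented
graphs. -/
theorem eq_zero_of_toGraphs_eq_zero (h : K + r = M + 1) (hM : p + 1 = M) {V : Type*}
    [AddCommGroup V] [Module ℝ V] (φ : RelChains r p →ₗ[ℝ] V)
    (hφ : ∀ (g : Out r) (s : OrderedSimplex r p),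
      φ (cls (g • s)) = ((outDet r g : ℤ) : ℝ) • φ (cls s))
    (x : RelChains r p) (hx : toGraphs h hM x = 0) : φ x = 0 := by
  -- The value of φ divided by `coef` depends only on the oriented graph: the factors from the
  -- marking and from the edge order occur in both and cancel. It therefore defines a linear map j
  -- on graphs with φ = j ∘ `toGraphs`.
  have ratio : ∀ {X Y : FinGraph K M} (hX : X.Admissible) (hY : Y.Admissible) (i : Iso X Y)
      {v w : Fin K} (μ : FreeGroup (Fin r) ≃* X.fundamentalGroup v)
      (μ' : FreeGroup (Fin r) ≃* Y.fundamentalGroup w) (σ σ' : Equiv.Perm (Fin M)),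
      (coef h hX μ σ)⁻¹ • φ (cls (OrderedSimplex.mk (std hM hX μ σ))) =
        ((i.orientation : ℤ) : ℝ) •
          (coef h hY μ' σ')⁻¹ • φ (cls (OrderedSimplex.mk (std hM hY μ' σ'))) := by
    intro X Y hX hY i v w μ μ' σ σ'
    obtain ⟨g, hg, hc⟩ := exists_smul_std h hM hX hY i μ μ' σ
    let τ := (i.onE * σ)⁻¹ * σ'
    have hσ' : σ' = i.onE * σ * τ := (mul_inv_cancel_left _ _).symm
    have h1 : OrderedSimplex.mk (std hM hY μ' σ') =
        permute ((finCongr hM).symm.permCongr τ) (g • OrderedSimplex.mk (std hM hX μ σ)) := by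
      rw [← hg, permute_std, hσ']
      congr 3
    have n1 := coef_ne_zero h hX μ σ
    have n2 := coef_ne_zero h hY μ' σ'
    have n3 : ((outDet r g : ℤ) : ℝ) * ((outDet r g : ℤ) : ℝ) = 1 := by
      exact_mod_cast outDet_mul_self r g
    have n4 := units_cast_mul_self τ.sign
    have n5 := units_cast_mul_self i.orientation
    have hc' : coef h hY μ' σ' = ((τ.sign : ℤ) : ℝ) * (((i.orientation : ℤ) : ℝ) *
        (((outDet r g : ℤ) : ℝ) * coef h hX μ σ)) := by
      rw [hσ', coef_mul, hc]
    rw [h1, cls_permute, map_smul, hφ, Equiv.Perm.sign_permCongr, smul_smul, smul_smul, smul_smul]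
    congr 1
    rw [hc'] at n2 ⊢
    generalize ((τ.sign : ℤ) : ℝ) = a at *
    generalize ((i.orientation : ℤ) : ℝ) = b at *
    generalize ((outDet r g : ℤ) : ℝ) = d at *
    have ha : a ≠ 0 := left_ne_zero_of_mul_eq_one n4
    have hb : b ≠ 0 := left_ne_zero_of_mul_eq_one n5
    have hd : d ≠ 0 := left_ne_zero_of_mul_eq_one n3
    field_simp
  let μ := fun X : GraphComplex.OGraph K M =>
    Classical.choice (X.2.connected.nonempty_marking (r := r) h ⟨0, X.2.connected.1⟩)
  let J : GraphComplex.OGraph K M → V := fun X =>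
    (coef h X.2 (μ X) 1)⁻¹ • φ (cls (OrderedSimplex.mk (std hM X.2 (μ X) 1)))
  let j : GraphComplex.GChains K M →ₗ[ℝ] V :=
    (GraphComplex.orRel K M).liftQ (Finsupp.linearCombination ℝ J) (by
      rw [GraphComplex.orRel, Submodule.span_le]
      rintro _ ⟨X, Y, i, rfl⟩
      simp only [SetLike.mem_coe, LinearMap.mem_ker, map_sub, map_smul,
        Finsupp.linearCombination_single, one_smul]
      rw [sub_eq_zero]
      exact ratio X.2 Y.2 i _ _ _ _)
  have hj : ∀ X (hX : X.Admissible), j (GraphComplex.cls X hX) = J ⟨X, hX⟩ := fun X hX => by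
    simp [j, GraphComplex.cls]
  have key : j ∘ₗ toGraphs h hM = φ := by
    refine hom_ext fun s => ?_
    rw [LinearMap.comp_apply]
    by_cases hs : s ∈ infinity r p
    · rw [cls_infinity hs, map_zero, map_zero, map_zero]
    · obtain ⟨X, hX, v, μ', σ, rfl⟩ := exists_std h hM s hs
      rw [toGraphs_cls, value_std, map_smul, hj]
      let i : Iso X X := ⟨1, 1, 1, by simp⟩
      have hi : i.orientation = 1 := by simp [i, Iso.orientation]
      have := ratio hX hX i μ' (μ ⟨X, hX⟩) σ 1
      rw [hi, Units.val_one, Int.cast_one, one_smul] at this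
      change coef h hX μ' σ • _ • φ _ = _
      rw [← this, smul_smul, mul_inv_cancel₀ (coef_ne_zero h hX μ' σ), one_smul]
  rw [← key, LinearMap.comp_apply, hx, map_zero]

/-- A simplex not at infinity would have a complete representative with p + 1 edges and p + 2 - r ≤
0 vertices, but a connected graph has a vertex. So all p-simplices are at infinity. -/
theorem subsingleton_relChains (hp : p + 2 ≤ r) : Subsingleton (RelChains r p) := by
  have key : LinearMap.id = (0 : RelChains r p →ₗ[ℝ] RelChains r p) := by
    refine hom_ext fun s => ?_
    rw [LinearMap.id_apply, LinearMap.zero_apply]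
    apply cls_infinity
    obtain ⟨a⟩ := s
    by_contra hs
    obtain ⟨z, hz, -⟩ := a.exists_rel_isFull fun h => hs ⟨a, h, rfl⟩
    have hm : p + 1 = z.m := by
      simpa using Fintype.card_of_bijective (f := z.edges) ⟨z.edges.injective, hz⟩
    have hk := (isCycleBasis_markedCycles z.admissible.connected z.marking).card_eq
      z.admissible.connected
    have := z.admissible.connected.1
    omega
  exact ⟨fun x y => (congrArg (fun f => f x) key).trans (congrArg (fun f => f y) key).symm⟩

end SimplicialChains

/-! ### Finiteness of stabilizers and partitions of unity -/

namespace OrderedSimplex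

open FinGraph MarkedSimplex

variable {r p : ℕ}

/-- The stabilizer of a simplex which is not at infinity is finite. -/
theorem finite_setOf_smul_eq_self {s : OrderedSimplex r p} (hs : s ∉ infinity r p) :
    {g : Out r | g • s = s}.Finite := by
  obtain ⟨a⟩ := s
  obtain ⟨z, hz, haz⟩ := a.exists_rel_isFull fun h => hs ⟨a, h, rfl⟩
  rw [show (Quot.mk _ a : OrderedSimplex r p) = mk z from Quot.sound haz]
  -- An element fixing the simplex is realized by a map of the complete graph to itself, given by
  -- finite data: the images of vertices and edges, and signs. It remains to see that these data
  -- determine the outer class.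
  let R : Out r → (Fin z.k → Fin z.k) × (Fin z.m ↪ Fin z.m) × (Fin z.m → ℤˣ) → Prop := fun g d =>
    ∃ α : MulAut (FreeGroup (Fin r)), QuotientGroup.mk α = g ∧
      ∃ c : ForestCollapse z.graph z.graph, (c.onV, c.edge, c.sgn) = d ∧
        ∃ γ, z.graph.IsPath (c.onV z.base) z.base γ ∧
          ∀ x, (z.marking x : FreeGroup (Fin z.m)) =
            γ⁻¹ * c.map (z.marking (MulEquiv.symm α x)) * γ
  have hR : ∀ g : {g : Out r | g • mk z = mk z}, ∃ d, R g d := by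
    rintro ⟨g, hg⟩
    obtain ⟨α, rfl⟩ := QuotientGroup.mk_surjective g
    obtain ⟨c, -, γ, hγ, hm⟩ := (mk_eq_mk_iff_of_isFull (z := z.act α) hz hz).1 hg
    exact ⟨_, α, rfl, c, rfl, γ, hγ, hm⟩
  have hR' : ∀ g g' d, R g d → R g' d → g = g' := by
    rintro _ _ _ ⟨α, rfl, c, rfl, γ, hγ, hm⟩ ⟨β, rfl, c', hc', γ', hγ', hm'⟩
    obtain rfl : c' = c := by
      cases c; cases c'
      simp only [Prod.mk.injEq] at hc'
      obtain ⟨rfl, rfl, rfl⟩ := hc'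
      rfl
    have hinj : Function.Injective c'.map := c'.map_injective_of_surjective
      (Finite.injective_iff_surjective.1 c'.edge.injective)
    -- Automorphisms realized by the same map differ only through the tracks of the base point. The
    -- closed path γ'γ⁻¹ lifts to a loop at the base, and conjugation by the corresponding w is
    -- β⁻¹α.
    obtain ⟨y, hy, hyγ⟩ := c'.exists_lift z.base (hγ'.trans hγ.symm) z.base rfl
    obtain ⟨w, hw⟩ := z.marking.surjective ⟨y, hy⟩
    have hmem : β⁻¹ * α ∈ Inn r → (QuotientGroup.mk α : Out r) = QuotientGroup.mk β :=
      fun h => (QuotientGroup.eq.2 h).symm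
    refine hmem ⟨w, ?_⟩
    ext x : 1
    refine z.marking.injective (Subtype.ext (hinj ?_))
    have h1 := hm (α x)
    rw [hm' (α x), MulEquiv.symm_apply_apply] at h1
    have h2 : c'.map (z.marking (MulEquiv.symm β (α x))) =
        (γ' * γ⁻¹) * c'.map (z.marking x) * (γ' * γ⁻¹)⁻¹ := by
      have h3 := congrArg (fun t => γ' * t * γ'⁻¹) h1
      simpa [mul_assoc] using h3
    rw [MulAut.conj_apply, MulAut.mul_apply]
    refine Eq.trans ?_ h2.symm
    rw [map_mul, map_mul, map_inv, hw]
    simp [hyγ]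
  choose F hF using hR
  exact Finite.of_injective F fun g g' h => Subtype.ext (hR' _ _ _ (hF g) (h ▸ hF g'))

theorem smul_permute (g : Out r) (τ : Equiv.Perm (Fin (p + 1))) (s : OrderedSimplex r p) :
    g • permute τ s = permute τ (g • s) := (smul_reindex g _ s).symm

theorem permute_permute (σ τ : Equiv.Perm (Fin (p + 1))) (s : OrderedSimplex r p) :
    permute σ (permute τ s) = permute (τ * σ) s := reindex_reindex _ _ s

theorem permute_one (s : OrderedSimplex r p) : permute 1 s = s := by
  obtain ⟨a⟩ := s; rfl

/-- The orbits of `Out(F_r)` on unordered simplices. -/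
def orbitSetoid (r p : ℕ) : Setoid (OrderedSimplex r p) where
  r s t := ∃ (g : Out r) (τ : Equiv.Perm (Fin (p + 1))), t = g • permute τ s
  iseqv :=
    { refl := fun s => ⟨1, 1, by rw [permute_one, one_smul]⟩
      symm := by
        rintro s _ ⟨g, τ, rfl⟩
        exact ⟨g⁻¹, τ⁻¹, by
          rw [← smul_permute, inv_smul_smul, permute_permute, mul_inv_cancel, permute_one]⟩
      trans := by
        rintro s _ _ ⟨g, τ, rfl⟩ ⟨g', τ', rfl⟩
        exact ⟨g' * g, τ * τ', by rw [← smul_permute, permute_permute, mul_smul]⟩ }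

/-- A representative of the orbit of a simplex. -/
def orbitRep (s : OrderedSimplex r p) : OrderedSimplex r p :=
  (Quotient.mk (orbitSetoid r p) s).out

theorem orbitRep_smul (g : Out r) (s : OrderedSimplex r p) : orbitRep (g • s) = orbitRep s :=
  congrArg Quotient.out (Quotient.sound (s := orbitSetoid r p)
    ((orbitSetoid r p).symm ⟨g, 1, by rw [permute_one]⟩))

theorem orbitRep_permute (τ : Equiv.Perm (Fin (p + 1))) (s : OrderedSimplex r p) :
    orbitRep (permute τ s) = orbitRep s :=
  congrArg Quotient.out (Quotient.sound (s := orbitSetoid r p)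
    ((orbitSetoid r p).symm ⟨1, τ, by rw [one_smul]⟩))

/-- The group elements carrying the representative of the orbit of `s` to `s`, up to order. -/
def transporter (s : OrderedSimplex r p) : Set (Out r) :=
  {g | ∃ τ, g • orbitRep s = permute τ s}

theorem transporter_permute (σ : Equiv.Perm (Fin (p + 1))) (s : OrderedSimplex r p) :
    transporter (permute σ s) = transporter s := by
  ext g
  simp only [transporter, Set.mem_ofPred_eq, orbitRep_permute, permute_permute]
  exact ⟨fun ⟨τ, h⟩ => ⟨_, h⟩, fun ⟨τ, h⟩ => ⟨σ⁻¹ * τ, by rw [mul_inv_cancel_left, h]⟩⟩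

theorem transporter_smul (h : Out r) (s : OrderedSimplex r p) :
    transporter (h • s) = (h * ·) '' transporter s := by
  ext g
  rw [Set.mem_image]
  constructor
  · rintro ⟨τ, hτ⟩
    rw [orbitRep_smul, ← smul_permute] at hτ
    exact ⟨h⁻¹ * g, ⟨τ, by rw [mul_smul, hτ, inv_smul_smul]⟩, mul_inv_cancel_left h g⟩
  · rintro ⟨g, ⟨τ, hτ⟩, rfl⟩
    exact ⟨τ, by rw [orbitRep_smul, mul_smul, hτ, smul_permute]⟩

theorem transporter_nonempty (s : OrderedSimplex r p) : (transporter s).Nonempty := by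
  obtain ⟨g, τ, h⟩ : (orbitSetoid r p).r s (orbitRep s) :=
    (orbitSetoid r p).symm (Quotient.exact (Quotient.out_eq (Quotient.mk (orbitSetoid r p) s)))
  exact ⟨g⁻¹, τ, by rw [h, inv_smul_smul]⟩

/-- For each of the finitely many orderings τ, the elements in question are either none or a coset
of the stabilizer of the representative, which is finite. -/
theorem transporter_finite {s : OrderedSimplex r p} (hs : s ∉ infinity r p) :
    (transporter s).Finite := by
  have : transporter s = ⋃ τ, {g : Out r | g • orbitRep s = permute τ s} := by
    ext g; simp [transporter]
  rw [this]
  refine Set.finite_iUnion fun τ => ?_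
  rcases Set.eq_empty_or_nonempty {g : Out r | g • orbitRep s = permute τ s} with h | ⟨g₀, h₀⟩
  · rw [h]; exact Set.finite_empty
  · have hu : orbitRep s ∉ infinity r p := fun h => hs ((permute_infinity_iff τ s).1
      (h₀ ▸ smul_infinity g₀ h))
    refine ((finite_setOf_smul_eq_self hu).image (g₀ * ·)).subset fun g hg => ?_
    refine ⟨g₀⁻¹ * g, ?_, mul_inv_cancel_left g₀ g⟩
    change (g₀⁻¹ * g) • orbitRep s = orbitRep s
    rw [mul_smul, show g • orbitRep s = _ from hg, ← show g₀ • orbitRep s = _ from h₀,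
      inv_smul_smul]

/-- The uniform distribution on a finite set. -/
def _root_.Set.uniformWeight {α : Type*} (T : Set α) : α →₀ ℝ :=
  open Classical in
  -- The default value 0 does no harm: an infinite transporter occurs only for simplices at
  -- infinity, whose relative class is zero.
  if h : T.Finite then ∑ g ∈ h.toFinset, Finsupp.single g (T.ncard : ℝ)⁻¹ else 0

/-- The uniform distribution on the transporter. -/
def weight (s : OrderedSimplex r p) : Out r →₀ ℝ := (transporter s).uniformWeight

/-- The transporter disregards the order of the vertices precisely so that this holds; it makes
`decompose` compatible with the alternating relations. -/
theorem weight_permute (σ : Equiv.Perm (Fin (p + 1))) (s : OrderedSimplex r p) :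
    weight (permute σ s) = weight s := by
  rw [weight, transporter_permute, weight]

/-- The transporter of h • s is the left translate by h. This is the source of the equivariance of
the partition of unity. -/
theorem weight_smul (h : Out r) (s : OrderedSimplex r p) :
    weight (h • s) = Finsupp.mapDomain (h * ·) (weight s) := by
  classical
  have hinj : Function.Injective (h * · : Out r → Out r) := mul_right_injective h
  simp only [weight, Set.uniformWeight, transporter_smul, Set.ncard_image_of_injective _ hinj]
  by_cases hT : (transporter s).Finite
  · rw [dif_pos hT, dif_pos (hT.image _), Set.Finite.toFinset_image _ hT,
      Finset.sum_image fun _ _ _ _ hab => hinj hab, Finsupp.mapDomain_finsetSum]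
    simp only [Finsupp.mapDomain_single]
  · rw [dif_neg hT, dif_neg fun h' => hT (h'.of_finite_image hinj.injOn), Finsupp.mapDomain_zero]

theorem weight_sum {s : OrderedSimplex r p} (hs : s ∉ infinity r p) :
    (weight s).sum (fun _ c => c) = 1 := by
  classical
  have hT := transporter_finite hs
  have hn : ((transporter s).ncard : ℝ) ≠ 0 := by
    rw [Nat.cast_ne_zero]
    exact ((Set.ncard_pos hT).2 (transporter_nonempty s)).ne'
  rw [weight, Set.uniformWeight, dif_pos hT, ← Finsupp.sum_finsetSum_index (fun _ => rfl) fun _ _ _ => rfl]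
  simp only [Finsupp.sum_single_index]
  rw [Finset.sum_const, ← Set.ncard_eq_toFinset_card _ hT, nsmul_eq_mul, mul_inv_cancel₀ hn]

end OrderedSimplex

/-! ### The partition of unity on relative chains and on their twist. -/

namespace SimplicialChains

open OrderedSimplex

variable {r p : ℕ}

/-- The decomposition of a chain according to the group elements which carry the representatives of
the orbits to its simplices. -/
def decompose (r p : ℕ) : RelChains r p →ₗ[ℝ] (Out r →₀ RelChains r p) :=
  liftRel (fun s => Finsupp.mapRange.linearMap (LinearMap.toSpanSingleton ℝ _ (cls s)) (weight s))
    (fun σ s => by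
      rw [weight_permute, cls_permute]
      ext g : 1
      simp only [Finsupp.smul_apply, Finsupp.mapRange.linearMap_apply, Finsupp.mapRange_apply,
        LinearMap.toSpanSingleton_apply]
      exact smul_comm _ _ _)
    (fun s hs => by
      rw [cls_infinity hs]
      ext g
      simp)

theorem decompose_cls (s : OrderedSimplex r p) : decompose r p (cls s) =
    Finsupp.mapRange.linearMap (LinearMap.toSpanSingleton ℝ _ (cls s)) (weight s) :=
  liftRel_cls _ _ _ _

theorem sum_decompose (x : RelChains r p) : (decompose r p x).sum (fun _ b => b) = x := by
  have : (Finsupp.lsum ℝ fun _ : Out r => (LinearMap.id : RelChains r p →ₗ[ℝ] _)) ∘ₗ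
      decompose r p = LinearMap.id := by
    refine hom_ext fun s => ?_
    rw [LinearMap.comp_apply, decompose_cls, LinearMap.id_apply]
    by_cases hs : s ∈ infinity r p
    · have h0 : Finsupp.mapRange.linearMap (0 : ℝ →ₗ[ℝ] RelChains r p) (weight s) = 0 := by
        ext g; simp
      rw [cls_infinity hs, LinearMap.toSpanSingleton_zero, h0, map_zero]
    · have h1 := congrArg (· • cls s) (weight_sum hs)
      simp only [one_smul, Finsupp.sum, Finset.sum_smul] at h1
      rw [Finsupp.lsum_apply, Finsupp.mapRange.linearMap_apply,
        Finsupp.sum_mapRange_index (by simp)]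
      exact h1
  exact congrArg (fun f => f x) this

theorem decompose_rep (h : Out r) (x : RelChains r p) : decompose r p (rep r p h x) =
    Finsupp.mapDomain (h * ·) (Finsupp.mapRange.linearMap (rep r p h) (decompose r p x)) := by
  have : decompose r p ∘ₗ rep r p h = Finsupp.lmapDomain _ ℝ (h * ·) ∘ₗ
      Finsupp.mapRange.linearMap (rep r p h) ∘ₗ decompose r p := by
    refine hom_ext fun s => ?_
    rw [LinearMap.comp_apply, LinearMap.comp_apply, LinearMap.comp_apply, rep_cls, decompose_cls,
      decompose_cls, weight_smul, Finsupp.lmapDomain_apply]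
    generalize weight s = w
    induction w using Finsupp.induction_linear with
    | zero => simp
    | add v w hv hw => simp only [Finsupp.mapDomain_add, map_add, hv, hw]
    | single g c => simp [Finsupp.mapDomain_single, rep_cls]
  exact congrArg (fun f => f x) this

theorem rid_tprod (g : Out r) (a : TensorProduct ℝ (RelChains r p) ℝ) :
    TensorProduct.rid ℝ _ (((rep r p).tprod (detRep r)) g a) =
      ((outDet r g : ℤ) : ℝ) • rep r p g (TensorProduct.rid ℝ _ a) := by
  induction a using TensorProduct.induction_on with
  | zero => simp
  | add x y hx hy => rw [map_add, map_add, map_add, map_add, smul_add, hx, hy]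
  | tmul x t => 
    rw [Representation.tprod_apply, TensorProduct.map_tmul, TensorProduct.rid_tmul,
      TensorProduct.rid_tmul, map_smul, smul_smul]
    rfl

/-- The partition of unity on the twisted chains. -/
def partition (r p : ℕ) : GroupPartition ((rep r p).tprod (detRep r)) where
  θ := Finsupp.mapRange.linearMap (TensorProduct.rid ℝ (RelChains r p)).symm.toLinearMap ∘ₗ
    decompose r p ∘ₗ (TensorProduct.rid ℝ (RelChains r p)).toLinearMap
  sum_eq a := by
    refine (TensorProduct.rid ℝ (RelChains r p)).injective ?_
    simp only [LinearMap.comp_apply, Finsupp.mapRange.linearMap_apply]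
    rw [Finsupp.sum_mapRange_index (fun _ => rfl), Finsupp.sum, map_sum]
    simp only [LinearEquiv.coe_coe, LinearEquiv.apply_symm_apply]
    exact sum_decompose _
  equivariant h a := by
    have h1 : (rep r p).tprod (detRep r) h ∘ₗ
        (TensorProduct.rid ℝ (RelChains r p)).symm.toLinearMap = ((outDet r h : ℤ) : ℝ) •
        ((TensorProduct.rid ℝ (RelChains r p)).symm.toLinearMap ∘ₗ rep r p h) := by
      refine LinearMap.ext fun x => (TensorProduct.rid ℝ (RelChains r p)).injective ?_
      rw [LinearMap.comp_apply, rid_tprod]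
      simp
    have h2 : ∀ y : Out r →₀ RelChains r p,
        Finsupp.mapRange.linearMap ((rep r p).tprod (detRep r) h)
          (Finsupp.mapRange.linearMap (TensorProduct.rid ℝ (RelChains r p)).symm.toLinearMap y) =
        ((outDet r h : ℤ) : ℝ) • Finsupp.mapRange.linearMap
          (TensorProduct.rid ℝ (RelChains r p)).symm.toLinearMap
            (Finsupp.mapRange.linearMap (rep r p h) y) := by
      intro y
      ext g : 1
      exact congrArg (fun f => f (y g)) h1
    simp only [LinearMap.comp_apply]
    rw [h2, LinearEquiv.coe_coe, rid_tprod, map_smul, map_smul, decompose_rep,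
      Finsupp.mapDomain_smul]
    congr 1
    simp only [Finsupp.mapRange.linearMap_apply]
    exact (Finsupp.mapDomain_mapRange _ _ _ _ fun x y => map_add _ x y).symm

end SimplicialChains

/-! ### Equivariant homology and graph homology -/

namespace SimplicialChains

open OrderedSimplex

variable {r p K M : ℕ}

/-- The map from twisted relative chains to oriented graphs. -/
def graphMap (h : K + r = M + 1) (hM : p + 1 = M) :
    (twistedChainComplex r).X p →ₗ[ℝ] GraphComplex.GChains K M :=
  toGraphs h hM ∘ₗ (TensorProduct.rid ℝ (RelChains r p)).toLinearMap

/-- The partition of unity on the terms of the twisted chain complex. -/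
def twistedPartition (r p : ℕ) : GroupPartition ((twistedChainComplex r).X p).ρ :=
  partition r p

theorem outDet_cast_mul_self (g : Out r) :
    ((outDet r g : ℤ) : ℝ) * ((outDet r g : ℤ) : ℝ) = 1 := by
  exact_mod_cast outDet_mul_self r g

/-- Here the twist matters: the determinant from ℝ̃ meets the one from the change of marking, and
their product is 1. So the map factors through the coinvariants. -/
theorem graphMap_rho (h : K + r = M + 1) (hM : p + 1 = M) (g : Out r)
    (a : (twistedChainComplex r).X p) :
    graphMap h hM (((twistedChainComplex r).X p).ρ g a) = graphMap h hM a := by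
  change TensorProduct ℝ (RelChains r p) ℝ at a
  change toGraphs h hM (TensorProduct.rid ℝ _ (((rep r p).tprod (detRep r)) g a)) =
    toGraphs h hM (TensorProduct.rid ℝ _ a)
  rw [rid_tprod, map_smul, toGraphs_rep, smul_smul, outDet_cast_mul_self, one_smul]

theorem graphMap_surjective (h : K + r = M + 1) (hM : p + 1 = M) :
    Function.Surjective (graphMap (r := r) h hM) :=
  (toGraphs_surjective h hM).comp (TensorProduct.rid ℝ (RelChains r p)).surjective

/-- The average is invariant for the twisted action, so on untwisted chains it transforms by the
determinant, and `eq_zero_of_toGraphs_eq_zero` applies. This is the injectivity of the map from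
coinvariants to graphs. -/
theorem average_eq_zero (h : K + r = M + 1) (hM : p + 1 = M) (a : (twistedChainComplex r).X p)
    (ha : graphMap h hM a = 0) : (twistedPartition r p).average a = 0 := by
  let e : RelChains r p ≃ₗ[ℝ] (twistedChainComplex r).X p :=
    (TensorProduct.rid ℝ (RelChains r p)).symm
  obtain ⟨x, rfl⟩ := e.surjective a
  have hx : toGraphs h hM x = 0 := by
    refine Eq.trans (congrArg (toGraphs h hM) ?_) ha
    exact ((TensorProduct.rid ℝ (RelChains r p)).apply_symm_apply x).symm
  refine eq_zero_of_toGraphs_eq_zero h hM ((twistedPartition r p).average ∘ₗ e.toLinearMap)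
    (fun g s => ?_) x hx
  have h1 : e (cls (g • s)) =
      ((outDet r g : ℤ) : ℝ) • ((twistedChainComplex r).X p).ρ g (e (cls s)) := by
    refine (TensorProduct.rid ℝ (RelChains r p)).injective ?_
    have h2 : TensorProduct.rid ℝ (RelChains r p)
        (((rep r p).tprod (detRep r)) g ((TensorProduct.rid ℝ (RelChains r p)).symm (cls s))) =
        ((outDet r g : ℤ) : ℝ) • cls (g • s) := by
      rw [rid_tprod, LinearEquiv.apply_symm_apply, rep_cls]
    refine ((TensorProduct.rid ℝ (RelChains r p)).apply_symm_apply (cls (g • s))).trans ?_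
    refine Eq.trans ?_ (map_smul (TensorProduct.rid ℝ (RelChains r p)) _ _).symm
    refine Eq.trans ?_ (congrArg (((outDet r g : ℤ) : ℝ) • ·) h2.symm)
    rw [smul_smul, outDet_cast_mul_self, one_smul]
  rw [LinearMap.comp_apply, LinearMap.comp_apply, LinearEquiv.coe_coe, h1, map_smul,
    GroupPartition.average_rho]

theorem graphMap_d (h : K + 2 + r = M + 1 + 1) (h' : K + 1 + r = M + 1)
    (hM : p + 1 + 1 = M + 1) (hM' : p + 1 = M) (a : (twistedChainComplex r).X (p + 1)) :
    graphMap h' hM' (((twistedChainComplex r).d (p + 1) p).hom a) =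
      GraphComplex.edgeBoundary K M (graphMap h hM a) := by
  have hd : ((twistedChainComplex r).d (p + 1) p).hom a =
      (boundary r p).rTensor ℝ (a : TensorProduct ℝ (RelChains r (p + 1)) ℝ) := by
    have := ChainComplex.of_d (fun p => Rep.of ((SimplicialChains.rep r p).tprod (detRep r)))
      (fun p => Rep.ofHom ((SimplicialChains.boundaryHom r p).rTensor (detRep r))) p
    exact congrArg (fun f : (twistedChainComplex r).X (p + 1) ⟶ (twistedChainComplex r).X p => f.hom a)
      this
  rw [hd]
  clear hd
  change TensorProduct ℝ (RelChains r (p + 1)) ℝ at a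
  change toGraphs h' hM' (TensorProduct.rid ℝ _ _) = GraphComplex.edgeBoundary K M
    (toGraphs h hM (TensorProduct.rid ℝ _ a))
  rw [← toGraphs_boundary h h' hM hM']
  congr 1
  induction a using TensorProduct.induction_on with
  | zero => simp
  | add x y hx hy => simp only [map_add, hx, hy]
  | tmul x t => simp

theorem subsingleton_twistedChainComplex (hp : p + 2 ≤ r) :
    Subsingleton ((twistedChainComplex r).X p) := by
  have := subsingleton_relChains hp
  exact (TensorProduct.rid ℝ (RelChains r p)).toEquiv.subsingleton

end SimplicialChains

/-! ### Differentials and vanishing terms of the graph complex. -/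

namespace GraphComplex

theorem graphComplex_d (r k : ℕ) :
    ((graphComplex r).d (k + 1) k).hom = boundary r k := by
  have := ChainComplex.of_d
    (fun k => ModuleCat.of ℝ (GraphComplex.GChains k (GraphComplex.edgeCount r k)))
    (fun k => ModuleCat.ofHom (GraphComplex.boundary r k)) k
  exact congrArg (fun f : (graphComplex r).X (k + 1) ⟶ (graphComplex r).X k => f.hom) this

theorem subsingleton_gChains {k m : ℕ} (h : ∀ X : FinGraph k m, ¬ X.Admissible) :
    Subsingleton (GChains k m) := by
  have : IsEmpty (OGraph k m) := ⟨fun X => h X.1 X.2⟩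
  exact (Submodule.mkQ_surjective (orRel k m)).subsingleton

theorem subsingleton_gChains_zero (m : ℕ) : Subsingleton (GChains 0 m) :=
  subsingleton_gChains fun _ hX => absurd hX.connected.1 (lt_irrefl 0)

/-- A lone vertex without edges is not trivalent. This is the term of degree 1 of the graph complex
for r = 0. -/
theorem subsingleton_gChains_one_zero : Subsingleton (GChains 1 0) :=
  subsingleton_gChains fun X hX => by
    have := hX.valence 0
    have h0 : X.valence 0 = 0 := by
      have : IsEmpty {h : Fin 0 × ℤˣ // X.root h.1 h.2 = 0} := ⟨fun h => h.1.1.elim0⟩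
      exact Nat.card_of_isEmpty
    omega

end GraphComplex

open SimplicialChains in
theorem subsingleton_equivariantHomology {r p : ℕ} (hp : p + 2 ≤ r) :
    Subsingleton (equivariantHomology r p) :=
  subsingleton_hyperHomology fun _ hq => subsingleton_twistedChainComplex (by omega)

/-- The equivariant homology `H_p^{Out(F_r)}(CX_r, A_r; ℝ̃)` is isomorphic to the graph
homology `H_{p+2-r}(X^{(r)})`, which is zero if `p + 2 - r < 0`. -/
theorem mainTheorem6 (r p : ℕ) :
    (∀ k : ℕ, k + r = p + 2 →
      Nonempty (equivariantHomology r p ≃ₗ[ℝ] (graphComplex r).homology k)) ∧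
    (p + 2 < r → Subsingleton (equivariantHomology r p)) := by
  refine ⟨fun k hk => ?_, fun hp => subsingleton_equivariantHomology hp.le⟩
  match k, hk with
  -- Here r = p + 2: the relative chains vanish up to degree p, and no connected graph has 0
  -- vertices, so both sides are zero.
  | 0, hk =>
    have := subsingleton_equivariantHomology (r := r) (p := p) (by omega)
    have : Subsingleton ((graphComplex r).X 0) := GraphComplex.subsingleton_gChains_zero 0
    have h0 : Limits.IsZero ((graphComplex r).X 0) := ModuleCat.isZero_of_subsingleton _
    have : Subsingleton ((graphComplex r).homology 0) := ModuleCat.subsingleton_of_isZero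
      (ShortComplex.isZero_homology_of_isZero_X₂ _ h0)
    exact ⟨0⟩
  -- Here r = p + 1, and p is the lowest degree in which relative chains can be nonzero, so no map
  -- in degree p - 1 is needed.
  | 1, hk =>
    refine nonempty_hyperHomology_equiv_of_lowest (SimplicialChains.twistedPartition r)
      (graphComplex r) p 1
      (SimplicialChains.graphMap (K := 1) (M := r + 0) (by omega) (by omega))
      (SimplicialChains.graphMap (K := 2) (M := r + 1) (by omega) (by omega))
      (fun q hq => SimplicialChains.subsingleton_twistedChainComplex (by omega)) (fun m => ?_)
      (SimplicialChains.graphMap_rho _ _) (SimplicialChains.average_eq_zero _ _) (fun a => ?_)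
      (SimplicialChains.graphMap_surjective _ _) (SimplicialChains.graphMap_surjective _ _)
    · by_cases hm : (ComplexShape.down ℕ).Rel 1 m
      · obtain rfl : m = 0 := by simpa using hm
        exact ModuleCat.hom_ext (GraphComplex.graphComplex_d r 0)
      · exact HomologicalComplex.shape _ _ _ hm
    · rw [GraphComplex.graphComplex_d]
      exact SimplicialChains.graphMap_d (K := 0) (M := r + 0) _ _ _ _ a
  | j + 2, hk =>
    obtain _ | n := p
    -- The only case with at least two vertices in which there is no degree p - 1 is p = 0, r = 0.
    -- The graph complex then vanishes in degree 1, so p = 0 is again treated as the lowest degree.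
    · obtain rfl : j = 0 := by omega
      obtain rfl : r = 0 := by omega
      refine nonempty_hyperHomology_equiv_of_lowest (SimplicialChains.twistedPartition 0)
        (graphComplex 0) 0 2
        (SimplicialChains.graphMap (K := 2) (M := 0 + 1) (by omega) (by omega))
        (SimplicialChains.graphMap (K := 3) (M := 0 + 2) (by omega) (by omega))
        (fun q hq => absurd hq (Nat.not_lt_zero q)) (fun m => ?_)
        (SimplicialChains.graphMap_rho _ _) (SimplicialChains.average_eq_zero _ _) (fun a => ?_)
        (SimplicialChains.graphMap_surjective _ _) (SimplicialChains.graphMap_surjective _ _)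
      · by_cases hm : (ComplexShape.down ℕ).Rel 2 m
        · obtain rfl : m = 1 := by simpa using hm
          have : Subsingleton ((graphComplex 0).X 1) := GraphComplex.subsingleton_gChains_one_zero
          exact (ModuleCat.isZero_of_subsingleton _).eq_of_tgt _ _
        · exact HomologicalComplex.shape _ _ _ hm
      · rw [GraphComplex.graphComplex_d]
        exact SimplicialChains.graphMap_d (K := 1) (M := 0 + 1) _ _ _ _ a
    · refine nonempty_hyperHomology_equiv (SimplicialChains.twistedPartition r) (graphComplex r)
        n (j + 1)
        (SimplicialChains.graphMap (K := j + 1) (M := r + j) (by omega) (by omega))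
        (SimplicialChains.graphMap (K := j + 2) (M := r + (j + 1)) (by omega) (by omega))
        (SimplicialChains.graphMap (K := j + 3) (M := r + (j + 2)) (by omega) (by omega))
        (SimplicialChains.graphMap_rho _ _) (SimplicialChains.graphMap_rho _ _)
        (SimplicialChains.average_eq_zero _ _) (SimplicialChains.average_eq_zero _ _)
        (fun a => ?_) (fun a => ?_)
        (SimplicialChains.graphMap_surjective _ _) (SimplicialChains.graphMap_surjective _ _)
      · rw [GraphComplex.graphComplex_d]
        exact SimplicialChains.graphMap_d (K := j) (M := r + j) _ _ _ _ a
      · rw [GraphComplex.graphComplex_d]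
        exact SimplicialChains.graphMap_d (K := j + 1) (M := r + (j + 1)) _ _ _ _ a

end
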